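/- **Setting.** All Hilbert spaces are finite-dimensional and complex; $\|\cdot\|_1$ and $\|\cdot\|_2$ are the Schatten norms. For a density matrix $\sigma$ on $\mathbb C^D$, the ensemble $\mathrm{Scrooge}(\sigma)$ is the law of the unit vector $\sqrt\sigma|\phi\rangle/\|\sqrt\sigma|\phi\rangle\|$, where $\phi$ has density $D\langle\phi|\sigma|\phi\rangle$ with respect to the uniform (Haar) probability measure on the unit sphere of $\mathbb C^D$. Its $k$-th moment is $$\rho^{(k)}_{\mathrm{Scrooge}}(\sigma)=D\,\mathbb E_{\phi\sim\mathrm{Haar}}\frac{(\sqrt\sigma|\phi\rangle\langle\phi|\sqrt\sigma)^{\otimes k}}{\langle\phi|\sigma|\phi\rangle^{k-1}} .$$ A probability distribution of unit vectors $\psi$ is a $\mathrm{Scrooge}(\sigma)$ $k$-design with relative error $\epsilon$ if its $k$-th moment $\rho^{(k)}=\mathbb E_\psi(|\psi\rangle\langle\psi|)^{\otimes k}$ satisfies $(1-\epsilon)\rho^{(k)}_{\mathrm{Scrooge}}(\sigma)\preceq\rho^{(k)}\preceq(1+\epsilon)\rho^{(k)}_{\mathrm{Scrooge}}(\sigma)$.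 **Theorem.** Fix an integer $k\ge 1$. There is a constant $C_k>0$, depending only on $k$, such that the following holds. Let $A$, $B$ have dimensions $D_A$, $D_B$, let $\sigma$ be a density matrix on $AB$ with $\sigma_B=\mathrm{Tr}_A\,\sigma$, let $\epsilon\ge 0$, let $|\Psi\rangle$ be drawn from any $\mathrm{Scrooge}(\sigma)$ $2k$-design with relative error $\epsilon$, and let $\{|z\rangle\}_{z=1}^{D_B}$ be any orthonormal basis of $B$. Put $|\tilde\psi_z\rangle=(I_A\otimes\langle z|)|\Psi\rangle$, $p_z=\langle\tilde\psi_z|\tilde\psi_z\rangle$, let $$\rho^{(k)}_{\mathcal E}(\Psi)=\sum_{z:\,p_z>0} p_z\,\big(|\psi_z\rangle\langle\psi_z|\big)^{\otimes k},\qquad |\psi_z\rangle=|\tilde\psi_z\rangle/\sqrt{p_z},$$ be the $k$-th moment of the projected ensemble on $A$, and let $\hat\sigma_{A|z}=(I_A\otimes\langle z|)\,\sigma\,(I_A\otimes|z\rangle)/\langle z|\sigma_B|z\rangle$ (outcomes with $\langle z|\sigma_B|z\rangle=0$ contribute nothing below). Then $$\mathbb E_\Psi\Big\|\rho^{(k)}_{\mathcal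 E}(\Psi)-\sum_{z=1}^{D_B}\langle z|\sigma_B|z\rangle\,\rho^{(k)}_{\mathrm{Scrooge}}(\hat\sigma_{A|z})\Big\|_1\;\le\; C_k\Big(\sqrt{D_A^{\,k}\,(\epsilon+\|\sigma\|_2)}\;+\;(k-1)\sum_{z=1}^{D_B}\langle z|\sigma_B|z\rangle\,\|\hat\sigma_{A|z}\|_2\Big).$$ In the low-purity regime $\|\hat\sigma_{A|z}\|_2\ll1$ for all $z$, $1\ll D_A\le D_B$, the last term is a vanishing correction, and the leading error is $O\big(\sqrt{D_A^{\,k}(\epsilon+\|\sigma\|_2)}\big)$. -/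

import Mathlib

open MeasureTheory Matrix
open scoped MatrixOrder ComplexOrder

/-! ### Matrices, norms, tensor powers

Operators on a finite-dimensional Hilbert space with computational basis `ι` are matrices
`Matrix ι ι ℂ`; state vectors are elements of `EuclideanSpace ℂ ι`. The `k`-fold tensor power
of `ℂ^ι` has computational basis `Fin k → ι`. -/

noncomputable section

/-- The Schatten 1-norm (trace norm) `‖M‖₁ = Tr √(M† M)`. -/
def traceNorm {ι : Type*} [Fintype ι] [DecidableEq ι] (M : Matrix ι ι ℂ) : ℝ :=
  (CFC.sqrt (Mᴴ * M)).trace.re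

/-- The Schatten 2-norm (Hilbert-Schmidt norm) `‖M‖₂ = √(Tr (M† M))`. -/
def hsNorm {ι : Type*} [Fintype ι] (M : Matrix ι ι ℂ) : ℝ :=
  Real.sqrt (Mᴴ * M).trace.re

/-- A density matrix: positive semidefinite with unit trace. -/
def IsDensityMatrix {ι : Type*} [Fintype ι] (σ : Matrix ι ι ℂ) : Prop :=
  σ.PosSemidef ∧ σ.trace = 1

/-- The rank-one operator `|v⟩⟨v|`. -/
def ketBra {ι : Type*} (v : EuclideanSpace ℂ ι) : Matrix ι ι ℂ :=
  Matrix.of fun i j => v i * star (v j)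

/-- The `k`-fold tensor power `M ⊗ ⋯ ⊗ M`. -/
def tensorPow {ι : Type*} (k : ℕ) (M : Matrix ι ι ℂ) : Matrix (Fin k → ι) (Fin k → ι) ℂ :=
  Matrix.of fun f g => ∏ j, M (f j) (g j)

/-- The real number `⟨v|M|v⟩` (the real part, which is the full value for Hermitian `M`). -/
def expVal {ι : Type*} [Fintype ι] (M : Matrix ι ι ℂ) (v : EuclideanSpace ℂ ι) : ℝ :=
  (∑ i, ∑ j, star (v i) * M i j * v j).re

/-! ### Ensembles of pure states, Haar and Scrooge ensembles, designs -/

/-- An ensemble of pure states of `ℂ^ι`: a Borel probability measure on `ℂ^ι` that is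
concentrated on unit vectors. -/
def IsPureStateEnsemble {ι : Type*} [Fintype ι] (μ : Measure (EuclideanSpace ℂ ι)) : Prop :=
  IsProbabilityMeasure μ ∧ ∀ᵐ ψ ∂μ, ‖ψ‖ = 1

/-- The `k`-th moment `E_{ψ ∼ μ} (|ψ⟩⟨ψ|)^{⊗ k}` of an ensemble (entrywise integral). -/
def ensembleMoment {ι : Type*} [Fintype ι] (k : ℕ) (μ : Measure (EuclideanSpace ℂ ι)) :
    Matrix (Fin k → ι) (Fin k → ι) ℂ :=
  Matrix.of fun f g => ∫ ψ, tensorPow k (ketBra ψ) f g ∂μ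

/-- The Haar ensemble: the uniform (normalised surface) probability measure on the unit sphere
of `ℂ^ι`, as a measure on `ℂ^ι`. -/
def haarState (ι : Type*) [Fintype ι] : Measure (EuclideanSpace ℂ ι) :=
  ((volume : Measure (EuclideanSpace ℂ ι)).toSphere Set.univ)⁻¹ •
    ((volume : Measure (EuclideanSpace ℂ ι)).toSphere.map Subtype.val)

/-- The unnormalised vector `√σ |φ⟩`. -/
def sqrtApply {ι : Type*} [Fintype ι] [DecidableEq ι] (σ : Matrix ι ι ℂ)
    (φ : EuclideanSpace ℂ ι) : EuclideanSpace ℂ ι :=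
  WithLp.toLp 2 (CFC.sqrt σ *ᵥ φ.ofLp)

/-- The ensemble `Scrooge(σ) = {D ⟨φ|σ|φ⟩ dφ, √σ|φ⟩ / ‖√σ|φ⟩‖}`, with `dφ` the Haar measure on
the unit sphere of `ℂ^D`. -/
def scroogeEnsemble {ι : Type*} [Fintype ι] [DecidableEq ι] (σ : Matrix ι ι ℂ) :
    Measure (EuclideanSpace ℂ ι) :=
  ((haarState ι).withDensity
      fun φ => ENNReal.ofReal ((Fintype.card ι : ℝ) * expVal σ φ)).map
    fun φ => ((‖sqrtApply σ φ‖⁻¹ : ℝ) : ℂ) • sqrtApply σ φ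

/-- The `k`-th moment `ρ_Scrooge^{(k)}(σ)`. -/
def scroogeMoment {ι : Type*} [Fintype ι] [DecidableEq ι] (k : ℕ) (σ : Matrix ι ι ℂ) :
    Matrix (Fin k → ι) (Fin k → ι) ℂ :=
  ensembleMoment k (scroogeEnsemble σ)

/-- `μ` is a Scrooge(`σ`) `k`-design with relative error `ε`:
`(1 - ε) ρ_Scrooge^{(k)}(σ) ≼ ρ_μ^{(k)} ≼ (1 + ε) ρ_Scrooge^{(k)}(σ)` in the Loewner order. -/
def IsScroogeDesign {ι : Type*} [Fintype ι] [DecidableEq ι] (σ : Matrix ι ι ℂ) (k : ℕ) (ε : ℝ)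
    (μ : Measure (EuclideanSpace ℂ ι)) : Prop :=
  IsPureStateEnsemble μ ∧
    (ensembleMoment k μ - ((1 - ε : ℝ) : ℂ) • scroogeMoment k σ).PosSemidef ∧
    (((1 + ε : ℝ) : ℂ) • scroogeMoment k σ - ensembleMoment k μ).PosSemidef

/-! ### Bipartite systems and projected ensembles

The system `AB` has computational basis `α × β`. -/

/-- The unnormalised projected state `(I_A ⊗ ⟨v|) |Ψ⟩` for a vector `v` of `B`. -/
def projVec {α β : Type*} [Fintype β] (v : EuclideanSpace ℂ β)
    (Ψ : EuclideanSpace ℂ (α × β)) : EuclideanSpace ℂ α :=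
  WithLp.toLp 2 fun a => ∑ b, star (v b) * Ψ (a, b)

/-- The `k`-th moment `∑_z p_z (|ψ_z⟩⟨ψ_z|)^{⊗ k}` of the projected ensemble of `|Ψ⟩` for the
measurement of `B` in the orthonormal basis `e`, where `p_z = ‖(I_A ⊗ ⟨z|)|Ψ⟩‖²` and
`|ψ_z⟩ = (I_A ⊗ ⟨z|)|Ψ⟩ / √p_z`. -/
def projectedMoment {α β : Type*} [Fintype α] [Fintype β] (k : ℕ)
    (e : OrthonormalBasis β ℂ (EuclideanSpace ℂ β)) (Ψ : EuclideanSpace ℂ (α × β)) :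
    Matrix (Fin k → α) (Fin k → α) ℂ :=
  ∑ z, ((‖projVec (e z) Ψ‖ ^ 2 : ℝ) : ℂ) •
    tensorPow k (ketBra (((‖projVec (e z) Ψ‖⁻¹ : ℝ) : ℂ) • projVec (e z) Ψ))

/-- The reduced state `σ_B = Tr_A σ`. -/
def reducedB {α β : Type*} [Fintype α] (σ : Matrix (α × β) (α × β) ℂ) : Matrix β β ℂ :=
  Matrix.of fun b b' => ∑ a, σ (a, b) (a, b')

/-- The unnormalised conditional state `σ_{A|v} = (I_A ⊗ ⟨v|) σ (I_A ⊗ |v⟩)`. -/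
def condState {α β : Type*} [Fintype β] (σ : Matrix (α × β) (α × β) ℂ)
    (v : EuclideanSpace ℂ β) : Matrix α α ℂ :=
  Matrix.of fun a a' => ∑ b, ∑ b', star (v b) * σ (a, b) (a', b') * v b'

/-- The normalised conditional state `σ_{A|v} / ⟨v|σ_B|v⟩` (equal to `0` when
`⟨v|σ_B|v⟩ = 0`; it then only occurs with weight `0`). -/
def normCondState {α β : Type*} [Fintype α] [Fintype β] (σ : Matrix (α × β) (α × β) ℂ)
    (v : EuclideanSpace ℂ β) : Matrix α α ℂ :=
  (((expVal (reducedB σ) v)⁻¹ : ℝ) : ℂ) • condState σ v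

/-- The `k`-th moment `∑_z ⟨z|σ_B|z⟩ ρ_Scrooge^{(k)}(σ_{A|z} / ⟨z|σ_B|z⟩)` of the generalized
Scrooge ensemble on `A`. -/
def scroogeMixtureMoment {α β : Type*} [Fintype α] [DecidableEq α] [Fintype β] (k : ℕ)
    (σ : Matrix (α × β) (α × β) ℂ) (e : OrthonormalBasis β ℂ (EuclideanSpace ℂ β)) :
    Matrix (Fin k → α) (Fin k → α) ℂ :=
  ∑ z, ((expVal (reducedB σ) (e z) : ℝ) : ℂ) • scroogeMoment k (normCondState σ (e z))

end

/-!
The proof replaces the Scrooge ensemble of `σ` by a Gaussian vector. If `S Sᴴ = σ` and `g` is a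
standard complex Gaussian vector, then `Scrooge(σ)` is the law of `S g / ‖S g‖` under the Gaussian
measure reweighted by `n = ‖S g‖²` (`exists_isGaussianFactor`). The variable `n` has mean `1` and
variance `‖σ‖₂²`, and its inverse moments are bounded when `‖σ‖₂` is small
(`integral_inv_pow_le`), so Scrooge averages of polynomials agree with Gaussian averages up to `O(‖σ‖₂)`
(`IsGaussianFactor.abs_integral_isSquareSum_sub_le`). A relative-error design reproduces, up to the
relative error `ε`, the averages of all sums of squared moduli of forms of degree `2k`
(`IsScroogeDesign.integral_isSquareSum`).

Let `p_z` be the outcome probabilities of `Ψ`, `q_z = ⟨z|σ_B|z⟩`, and `ψ_z` the unnormalised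
projected states. The moment `∑ p_z^(1-k) (ψ_z ψ_z†)^⊗k` of the projected ensemble is not a polynomial in `Ψ`,
but `R = ∑ q_z^(1-k) (ψ_z ψ_z†)^⊗k` is (`weightedMoment`). With `G` the Gaussian average of `R`, the
trace-norm distance splits into three parts (`traceNorm_projectedMoment_sub_le`):

* The distance of the projected ensemble from `R` is at most `∑ |p_z - q_z^(1-k) p_z^k|`. It is
  small since `p_z / q_z` concentrates around `1` with variance about `‖σ_{A|z}‖₂² / q_z²`
  (`exists_integral_abs_sub_outcomeWeight_le`), and vanishes for `k = 1`.
* The distance of `R` from `G` is at most `√(D_A^k) ‖R - G‖₂`. In the expansion of `E ‖R - G‖₂²` the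
  quantities `(Tr R)²`, `(Tr R)² - Tr R²` and `Tr (R G)` are sums of squares, so the design may be
  replaced by the Gaussian vector. There Wick's formula (`wick`) leaves only the pairings that mix
  the two copies of `R`, and these are bounded by `D_A^k ‖σ‖₂²` in total
  (`integral_hsNorm_weightedMoment_sq_le`). The result is `E ‖R - G‖₂² = O(ε + ‖σ‖₂)`
  (`exists_integral_hsNorm_weightedMoment_sub_sq_le`), this being the source of the leading term.
* The distance of `G` from the mixture of Scrooge moments is, outcome by outcome, the mean of
  `|n^k - n|` for a Gaussian vector on `A` (`norm_trace_mul_gaussianMoment_sub_le`).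

If `D_A^k (ε + ‖σ‖₂)` is not small, the trivial bound `2` on the distance is enough.
-/

/-! ### Complex Gaussian vectors and Wick's formula -/

/-- The standard complex Gaussian measure on `ℂ`, with density `π⁻¹ exp(-|z|²)`, so that
`E |z|² = 1`. -/
noncomputable def complexGaussian : Measure ℂ :=
  volume.withDensity fun z => ENNReal.ofReal (Real.pi⁻¹ * Real.exp (-‖z‖ ^ 2))

/-- The standard complex Gaussian measure on `ℂ^ι`: independent standard complex Gaussian
coordinates. -/
noncomputable def stdGaussian (ι : Type*) [Fintype ι] : Measure (EuclideanSpace ℂ ι) :=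
  (Measure.pi fun _ : ι => complexGaussian).map (WithLp.toLp 2)

lemma integral_complexGaussian {F : Type*} [NormedAddCommGroup F] [NormedSpace ℝ F] (f : ℂ → F) :
    ∫ z, f z ∂complexGaussian = ∫ z, (Real.pi⁻¹ * Real.exp (-‖z‖ ^ 2)) • f z := by
  rw [complexGaussian, integral_withDensity_eq_integral_toReal_smul (by fun_prop) (by simp)]
  refine integral_congr_ae (.of_forall fun z => ?_)
  simp only
  rw [ENNReal.toReal_ofReal (by positivity)]

lemma integrable_complexGaussian_iff {F : Type*} [NormedAddCommGroup F] [NormedSpace ℝ F]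
    (f : ℂ → F) : Integrable f complexGaussian ↔
      Integrable fun z => (Real.pi⁻¹ * Real.exp (-‖z‖ ^ 2)) • f z := by
  rw [complexGaussian, integrable_withDensity_iff_integrable_smul' (by fun_prop) (by simp)]
  refine integrable_congr (.of_forall fun z => ?_)
  simp only
  rw [ENNReal.toReal_ofReal (by positivity)]

lemma integral_norm_rpow_complexGaussian {q : ℝ} (hq : -2 < q) :
    ∫ z, ‖z‖ ^ q ∂complexGaussian = Real.Gamma (q / 2 + 1) := by
  have h := Complex.integral_rpow_mul_exp_neg_rpow (p := 2) (by norm_num) hq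
  rw [integral_complexGaussian]
  have : ∀ z : ℂ, (Real.pi⁻¹ * Real.exp (-‖z‖ ^ 2)) • ‖z‖ ^ q
      = Real.pi⁻¹ * (‖z‖ ^ q * Real.exp (-‖z‖ ^ (2 : ℝ))) := by
    intro z
    rw [Real.rpow_two, smul_eq_mul]; ring
  simp_rw [this]
  rw [integral_const_mul, h]
  have := Real.pi_pos
  field_simp

lemma integrable_norm_rpow_complexGaussian {q : ℝ} (hq : -2 < q) :
    Integrable (fun z => ‖z‖ ^ q) complexGaussian := by
  refine not_imp_comm.1 integral_undef ?_
  rw [integral_norm_rpow_complexGaussian hq]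
  exact (Real.Gamma_pos_of_pos (by linarith)).ne'

instance : IsProbabilityMeasure complexGaussian := by
  have h := integral_norm_rpow_complexGaussian (q := 0) (by norm_num)
  have hi := integrable_norm_rpow_complexGaussian (q := 0) (by norm_num)
  simp only [Real.rpow_zero, zero_div, zero_add, Real.Gamma_one] at h hi
  have : IsFiniteMeasure complexGaussian := by
    rw [integrable_const_iff] at hi
    simpa [isFiniteMeasure_iff] using hi
  rw [integral_const, smul_eq_mul, mul_one] at h
  exact ⟨by simpa [Measure.real, ENNReal.toReal_eq_one_iff] using h⟩

instance (ι : Type*) [Fintype ι] : IsProbabilityMeasure (stdGaussian ι) :=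
  Measure.isProbabilityMeasure_map (by fun_prop)

lemma integrable_monomial_complexGaussian (a b : ℕ) :
    Integrable (fun z : ℂ => z ^ a * star z ^ b) complexGaussian := by
  have h := integrable_norm_rpow_complexGaussian (q := ((a + b : ℕ) : ℝ))
    (by have := Nat.cast_nonneg (α := ℝ) (a + b); linarith)
  simp only [Real.rpow_natCast] at h
  refine h.mono' (by fun_prop) (.of_forall fun z => ?_)
  simp [pow_add]

/-- The complex Gaussian measure is invariant under rotations. -/
lemma complexGaussian_map_mul {c : ℂ} (hc : ‖c‖ = 1) :
    MeasurePreserving (fun z : ℂ => c * z) complexGaussian complexGaussian := by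
  have hc0 : c ≠ 0 := by rintro rfl; simp at hc
  let u : Circle := ⟨c, mem_sphere_zero_iff_norm.2 hc⟩
  have h : MeasurePreserving (fun z : ℂ => c * z) volume volume :=
    (rotation u).measurePreserving
  refine ⟨by fun_prop, ?_⟩
  ext s hs
  rw [Measure.map_apply (by fun_prop) hs, complexGaussian,
    withDensity_apply _ (h.measurable hs), withDensity_apply _ hs,
    ← h.setLIntegral_comp_preimage hs (by fun_prop)]
  simp [hc]

lemma integral_monomial_complexGaussian (a b : ℕ) :
    ∫ z : ℂ, z ^ a * star z ^ b ∂complexGaussian = if a = b then (a.factorial : ℂ) else 0 := by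
  split_ifs with h
  · subst h
    have h := integral_norm_rpow_complexGaussian (q := ((2 * a : ℕ) : ℝ))
      (by have := Nat.cast_nonneg (α := ℝ) (2 * a); linarith)
    simp only [Real.rpow_natCast] at h
    have h2 : ∀ z : ℂ, z ^ a * star z ^ a = ((‖z‖ ^ (2 * a) : ℝ) : ℂ) := by
      intro z
      rw [← mul_pow, Complex.star_def, Complex.mul_conj, Complex.normSq_eq_norm_sq, pow_mul]
      norm_cast
    simp_rw [h2]
    rw [integral_complex_ofReal, h]
    push_cast
    rw [mul_div_cancel_left₀ _ (by norm_num), Real.Gamma_nat_eq_factorial]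
    norm_cast
  · -- a rotation by a suitable unit `c` multiplies the integral by `c ^ a * conj c ^ b ≠ 1`
    obtain ⟨c, hc, hne⟩ : ∃ c : ℂ, ‖c‖ = 1 ∧ c ^ a * star c ^ b ≠ 1 := by
      refine ⟨Complex.exp ((1 : ℝ) * Complex.I), Complex.norm_exp_ofReal_mul_I _, ?_⟩
      intro h1
      have e1 : star (Complex.exp ((1 : ℝ) * Complex.I)) = Complex.exp (-Complex.I) := by
        rw [Complex.star_def, ← Complex.exp_conj]; simp
      rw [e1, ← Complex.exp_nat_mul, ← Complex.exp_nat_mul, ← Complex.exp_add,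
        Complex.exp_eq_one_iff] at h1
      obtain ⟨n, hn⟩ := h1
      have h3 := congrArg Complex.im hn
      simp at h3
      have h4 : ((a : ℤ) - b : ℤ) ≠ 0 := by omega
      have h5 : Real.pi * (2 * n : ℤ) = ((a : ℤ) - b : ℤ) := by push_cast; linarith
      by_cases hn0 : n = 0
      · subst hn0; simp at h5; apply h4; exact_mod_cast h5.symm
      · refine irrational_pi ⟨(((a : ℤ) - b : ℤ) : ℚ) / (2 * n : ℤ), ?_⟩
        have : ((2 * n : ℤ) : ℝ) ≠ 0 := by exact_mod_cast (by omega : 2 * n ≠ 0)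
        rw [Rat.cast_div, Rat.cast_intCast, Rat.cast_intCast, ← h5]
        field_simp
    have h1 := (complexGaussian_map_mul hc).integral_comp
      (Homeomorph.mulLeft₀ c (by rintro rfl; simp at hc)).measurableEmbedding
      (fun z : ℂ => z ^ a * star z ^ b)
    have h2 : ∀ z : ℂ, (c * z) ^ a * star (c * z) ^ b
        = (c ^ a * star c ^ b) * (z ^ a * star z ^ b) := by
      intro z; rw [star_mul']; ring
    simp_rw [h2] at h1
    rw [integral_const_mul] at h1
    have h3 : (c ^ a * star c ^ b - 1) * ∫ z : ℂ, z ^ a * star z ^ b ∂complexGaussian = 0 := by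
      rw [sub_mul, h1]; simp
    exact (mul_eq_zero.1 h3).resolve_left (sub_ne_zero.2 hne)

section
variable {ι : Type*} [Fintype ι]

lemma integral_stdGaussian {F : Type*} [NormedAddCommGroup F] [NormedSpace ℝ F]
    (f : EuclideanSpace ℂ ι → F) :
    ∫ g, f g ∂stdGaussian ι = ∫ x, f (WithLp.toLp 2 x) ∂Measure.pi fun _ : ι => complexGaussian :=
  integral_map_equiv (MeasurableEquiv.toLp 2 (ι → ℂ)) f

lemma integrable_stdGaussian_iff {F : Type*} [NormedAddCommGroup F]
    (f : EuclideanSpace ℂ ι → F) : Integrable f (stdGaussian ι) ↔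
      Integrable (fun x => f (WithLp.toLp 2 x)) (Measure.pi fun _ : ι => complexGaussian) :=
  integrable_map_equiv (MeasurableEquiv.toLp 2 (ι → ℂ)) f

lemma integral_prod_stdGaussian {𝕜 : Type*} [RCLike 𝕜] (h : ι → ℂ → 𝕜) :
    ∫ g, ∏ i, h i (g i) ∂stdGaussian ι = ∏ i, ∫ z, h i z ∂complexGaussian := by
  rw [integral_stdGaussian]
  exact integral_fintype_prod_eq_prod h

lemma integrable_prod_stdGaussian {𝕜 : Type*} [RCLike 𝕜] {h : ι → ℂ → 𝕜}
    (hh : ∀ i, Integrable (h i) complexGaussian) :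
    Integrable (fun g => ∏ i, h i (g i)) (stdGaussian ι) := by
  rw [integrable_stdGaussian_iff]
  exact Integrable.fintype_prod hh

lemma prod_coord_eq_prod_pow [DecidableEq ι] {J : Type*} [Fintype J]
    (i l : J → ι) (g : EuclideanSpace ℂ ι) :
    ∏ j, g (i j) * star (g (l j))
      = ∏ a, (g a ^ (Fintype.card {j // i j = a})
        * star (g a) ^ (Fintype.card {j // l j = a})) := by
  rw [Finset.prod_mul_distrib, Finset.prod_mul_distrib]
  congr 1
  · rw [← Finset.prod_fiberwise' Finset.univ i (fun a => g a)]
    simp [Finset.prod_const, Fintype.card_subtype]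
  · rw [← Finset.prod_fiberwise' Finset.univ l (fun a => star (g a))]
    simp [Finset.prod_const, Fintype.card_subtype]

lemma integrable_prod_coord [DecidableEq ι] {J : Type*} [Fintype J] (i l : J → ι) :
    Integrable (fun g : EuclideanSpace ℂ ι => ∏ j, g (i j) * star (g (l j))) (stdGaussian ι) := by
  simp_rw [prod_coord_eq_prod_pow]
  exact integrable_prod_stdGaussian fun a => integrable_monomial_complexGaussian _ _

/-- The number of permutations matching two colourings: both sides vanish unless the colourings
have fibres of equal size. -/
lemma sum_perm_ite_eq [DecidableEq ι] {J : Type*} [Fintype J] [DecidableEq J] (i l : J → ι) :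
    ∑ π : Equiv.Perm J, (∏ j, if i j = l (π j) then (1 : ℂ) else 0)
      = ∏ a, if Fintype.card {j // i j = a} = Fintype.card {j // l j = a}
          then ((Fintype.card {j // i j = a}).factorial : ℂ) else 0 := by
  have h1 : ∀ π : Equiv.Perm J, (∏ j, if i j = l (π j) then (1 : ℂ) else 0)
      = if i = l ∘ π then 1 else 0 := by
    intro π
    rw [Finset.prod_ite_zero]
    simp [funext_iff]
  simp_rw [h1]
  rw [Finset.sum_boole]
  by_cases h : ∀ a, Fintype.card {j // i j = a} = Fintype.card {j // l j = a}
  · rw [Finset.prod_congr rfl fun a _ => if_pos (h a)]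
    let e : ∀ a, {j // i j = a} ≃ {j // l j = a} := fun a => Fintype.equivOfCardEq (h a)
    let π₀ : Equiv.Perm J := (Equiv.sigmaFiberEquiv i).symm.trans
      ((Equiv.sigmaCongrRight e).trans (Equiv.sigmaFiberEquiv l))
    have hπ₀ : ∀ j, l (π₀ j) = i j := fun j => (e (i j) ⟨j, rfl⟩).2
    rw [← Nat.cast_prod, ← DomMulAct.stabilizer_card i, ← Fintype.card_subtype]
    congr 1
    refine Fintype.card_congr
      ⟨fun π => ⟨π.1.trans π₀.symm, ?_⟩, fun π => ⟨π.1.trans π₀, ?_⟩, ?_, ?_⟩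
    · ext j
      have := congrFun π.2 j
      simp only [Function.comp_apply] at this ⊢
      rw [← hπ₀]; simp [this]
    · ext j
      have := congrFun π.2 j
      simp only [Function.comp_apply] at this ⊢
      simp [hπ₀, this]
    · intro π; ext; simp
    · intro π; ext; simp
  · push Not at h
    obtain ⟨a, ha⟩ := h
    rw [Finset.prod_eq_zero (Finset.mem_univ a) (if_neg ha), Finset.card_eq_zero.2, Nat.cast_zero]
    rw [Finset.filter_eq_empty_iff]
    rintro π - hπ
    apply ha
    refine Fintype.card_congr (π.subtypeEquiv fun j => ?_)
    rw [hπ]; rfl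

/-- Wick's formula for products of coordinates and their conjugates. -/
lemma integral_prod_coord [DecidableEq ι] {J : Type*} [Fintype J] [DecidableEq J] (i l : J → ι) :
    ∫ g : EuclideanSpace ℂ ι, ∏ j, g (i j) * star (g (l j)) ∂stdGaussian ι
      = ∑ π : Equiv.Perm J, (∏ j, if i j = l (π j) then (1 : ℂ) else 0) := by
  simp_rw [prod_coord_eq_prod_pow]
  rw [integral_prod_stdGaussian (fun a z => z ^ (Fintype.card {j // i j = a}) *
    star z ^ (Fintype.card {j // l j = a})), sum_perm_ite_eq]
  simp_rw [integral_monomial_complexGaussian]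

/-- Multilinear expansion of a product of linear forms and their conjugates. -/
lemma prod_linear_expand {J X : Type*} [Fintype J] [DecidableEq J] (S : Matrix X ι ℂ) (x y : J → X)
    (g : EuclideanSpace ℂ ι) :
    ∏ j, (S *ᵥ g.ofLp) (x j) * star ((S *ᵥ g.ofLp) (y j))
      = ∑ i : J → ι, ∑ l : J → ι, (∏ j, S (x j) (i j) * star (S (y j) (l j)))
          * ∏ j, g (i j) * star (g (l j)) := by
  rw [Finset.prod_mul_distrib]
  simp only [mulVec, dotProduct, star_sum, star_mul']
  rw [Finset.prod_univ_sum, Finset.prod_univ_sum, Fintype.piFinset_univ, Finset.sum_mul_sum]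
  refine Finset.sum_congr rfl fun i _ => Finset.sum_congr rfl fun l _ => ?_
  simp only [Finset.prod_mul_distrib]
  ring

lemma integrable_prod_linear {J X : Type*} [Fintype J] (S : Matrix X ι ℂ) (x y : J → X) :
    Integrable (fun g : EuclideanSpace ℂ ι =>
      ∏ j, (S *ᵥ g.ofLp) (x j) * star ((S *ᵥ g.ofLp) (y j))) (stdGaussian ι) := by
  classical
  simp_rw [prod_linear_expand]
  exact integrable_finsetSum _ fun i _ => integrable_finsetSum _ fun l _ =>
    (integrable_prod_coord i l).const_mul _

/-- **Wick's formula** for the circularly symmetric complex Gaussian vector `S g`, whose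
covariance is `S Sᴴ`. -/
lemma wick {J X : Type*} [Fintype J] [DecidableEq J] (S : Matrix X ι ℂ)
    (x y : J → X) :
    ∫ g : EuclideanSpace ℂ ι, ∏ j, (S *ᵥ g.ofLp) (x j) * star ((S *ᵥ g.ofLp) (y j)) ∂stdGaussian ι
      = ∑ π : Equiv.Perm J, ∏ j, (S * Sᴴ) (x j) (y (π j)) := by
  classical
  simp_rw [prod_linear_expand]
  rw [integral_finsetSum _ fun i _ => integrable_finsetSum _ fun l _ =>
    (integrable_prod_coord i l).const_mul _]
  simp_rw [integral_finsetSum _ fun l (_ : l ∈ Finset.univ) =>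
    (integrable_prod_coord _ l).const_mul _, integral_const_mul, integral_prod_coord,
    Finset.mul_sum]
  rw [Finset.sum_congr rfl fun i _ => Finset.sum_comm, Finset.sum_comm]
  refine Finset.sum_congr rfl fun π _ => ?_
  have h1 : ∀ (i l : J → ι), (∏ j, if i j = l (π j) then (1 : ℂ) else 0)
      = if l = i ∘ π.symm then 1 else 0 := by
    intro i l
    rw [Finset.prod_ite_zero]
    simp only [Finset.prod_const_one, Finset.mem_univ, true_imp_iff]
    congr 1
    rw [eq_iff_iff, Equiv.eq_comp_symm, funext_iff]
    exact forall_congr' fun j => eq_comm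
  simp_rw [h1, mul_ite, mul_one, mul_zero, Finset.sum_ite_eq', Finset.mem_univ, if_true]
  have h2 : ∀ i : J → ι, ∏ j, S (x j) (i j) * star (S (y j) ((i ∘ π.symm) j))
      = ∏ j, S (x j) (i j) * star (S (y (π j)) (i j)) := by
    intro i
    rw [Finset.prod_mul_distrib, Finset.prod_mul_distrib]
    congr 1
    rw [← Equiv.prod_comp π (fun j => star (S (y j) ((i ∘ π.symm) j)))]
    simp
  have h3 : ∀ j, (S * Sᴴ) (x j) (y (π j)) = ∑ a, S (x j) a * star (S (y (π j)) a) := fun j => by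
    simp [Matrix.mul_apply]
  rw [Finset.prod_congr rfl fun j _ => h3 j, Finset.prod_univ_sum, Fintype.piFinset_univ]
  exact Finset.sum_congr rfl fun i _ => h2 i

end

/-! ### Moments of the norm of a Gaussian vector -/

lemma integral_mul_le_sqrt_mul_sqrt {Ω : Type*} [MeasurableSpace Ω] {μ : Measure Ω} {f g : Ω → ℝ}
    (hf : AEStronglyMeasurable f μ) (hg : AEStronglyMeasurable g μ)
    (hf2 : Integrable (fun x => f x ^ 2) μ) (hg2 : Integrable (fun x => g x ^ 2) μ) :
    Integrable (fun x => |f x| * |g x|) μ ∧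
      ∫ x, |f x| * |g x| ∂μ ≤ Real.sqrt (∫ x, f x ^ 2 ∂μ) * Real.sqrt (∫ x, g x ^ 2 ∂μ) := by
  have hfm : MemLp (fun x => |f x|) 2 μ := ((memLp_two_iff_integrable_sq hf).2 hf2).abs
  have hgm : MemLp (fun x => |g x|) 2 μ := ((memLp_two_iff_integrable_sq hg).2 hg2).abs
  refine ⟨hfm.integrable_mul hgm, ?_⟩
  have h := integral_mul_le_Lp_mul_Lq_of_nonneg (μ := μ) Real.HolderConjugate.two_two
    (f := fun x => |f x|) (g := fun x => |g x|) (.of_forall fun _ => abs_nonneg _)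
    (.of_forall fun _ => abs_nonneg _) (by simpa using hfm) (by simpa using hgm)
  simpa [Real.sqrt_eq_rpow] using h

lemma hsNorm_sq {ι : Type*} [Fintype ι] (M : Matrix ι ι ℂ) :
    hsNorm M ^ 2 = ∑ i, ∑ j, ‖M i j‖ ^ 2 := by
  have h : (Mᴴ * M).trace.re = ∑ i, ∑ j, ‖M i j‖ ^ 2 := by
    rw [Finset.sum_comm]
    simp [Matrix.trace, Matrix.mul_apply, Complex.sq_norm, Complex.normSq_apply]
  rw [hsNorm, Real.sq_sqrt, h]
  rw [h]; positivity

lemma hsNorm_nonneg {ι : Type*} [Fintype ι] (M : Matrix ι ι ℂ) : 0 ≤ hsNorm M :=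
  Real.sqrt_nonneg _

lemma mul_conjTranspose_self_apply_self {ι X : Type*} [Fintype ι] (S : Matrix X ι ℂ) (x : X) :
    (S * Sᴴ) x x = ((∑ i, ‖S x i‖ ^ 2 : ℝ) : ℂ) := by
  simp [Matrix.mul_apply, Complex.mul_conj, Complex.normSq_eq_norm_sq]

lemma norm_mul_conjTranspose_self_apply_le {ι X : Type*} [Fintype ι] (S : Matrix X ι ℂ) (x y : X) :
    ‖(S * Sᴴ) x y‖ ≤ Real.sqrt ((S * Sᴴ) x x).re * Real.sqrt ((S * Sᴴ) y y).re := by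
  rw [mul_conjTranspose_self_apply_self, mul_conjTranspose_self_apply_self, Complex.ofReal_re,
    Complex.ofReal_re]
  calc ‖(S * Sᴴ) x y‖ ≤ ∑ i, ‖S x i‖ * ‖S y i‖ := by
        rw [Matrix.mul_apply]
        refine (norm_sum_le _ _).trans_eq ?_
        simp
    _ ≤ _ := Real.sum_mul_le_sqrt_mul_sqrt _ _ _

section
variable {ι X : Type*} [Fintype ι] [Fintype X]

/-- The squared norm `‖S g‖²`, as a function of `g`. -/
noncomputable def imageNormSq (S : Matrix X ι ℂ) (g : EuclideanSpace ℂ ι) : ℝ :=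
  ∑ x, ‖(S *ᵥ g.ofLp) x‖ ^ 2

lemma imageNormSq_nonneg (S : Matrix X ι ℂ) (g : EuclideanSpace ℂ ι) : 0 ≤ imageNormSq S g := by
  unfold imageNormSq; positivity

@[fun_prop]
lemma continuous_imageNormSq (S : Matrix X ι ℂ) : Continuous (imageNormSq S) := by
  unfold imageNormSq
  fun_prop

lemma ofReal_imageNormSq_pow (S : Matrix X ι ℂ) (m : ℕ) (g : EuclideanSpace ℂ ι) :
    ((imageNormSq S g ^ m : ℝ) : ℂ)
      = ∑ x : Fin m → X, ∏ j, (S *ᵥ g.ofLp) (x j) * star ((S *ᵥ g.ofLp) (x j)) := by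
  have h : (imageNormSq S g : ℂ) = ∑ x, (S *ᵥ g.ofLp) x * star ((S *ᵥ g.ofLp) x) := by
    simp [imageNormSq, Complex.mul_conj, Complex.normSq_eq_norm_sq]
  rw [Complex.ofReal_pow, h, Fintype.sum_pow]

lemma integrable_imageNormSq_pow (S : Matrix X ι ℂ) (m : ℕ) :
    Integrable (fun g => imageNormSq S g ^ m) (stdGaussian ι) := by
  have h : Integrable (fun g => ((imageNormSq S g ^ m : ℝ) : ℂ)) (stdGaussian ι) := by
    simp_rw [ofReal_imageNormSq_pow]
    exact integrable_finsetSum _ fun x _ => integrable_prod_linear S x x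
  exact h.re.congr (.of_forall fun g => Complex.ofReal_re _)

lemma integral_imageNormSq_pow (S : Matrix X ι ℂ) (m : ℕ) :
    ((∫ g, imageNormSq S g ^ m ∂stdGaussian ι : ℝ) : ℂ)
      = ∑ x : Fin m → X, ∑ π : Equiv.Perm (Fin m), ∏ j, (S * Sᴴ) (x j) (x (π j)) := by
  rw [← integral_complex_ofReal]
  simp_rw [ofReal_imageNormSq_pow]
  rw [integral_finsetSum _ fun x _ => integrable_prod_linear S x x]
  simp_rw [wick]

lemma integral_imageNormSq (S : Matrix X ι ℂ) :
    ∫ g, imageNormSq S g ∂stdGaussian ι = (S * Sᴴ).trace.re := by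
  have h := integral_imageNormSq_pow S 1
  simp only [pow_one] at h
  have h2 := congrArg Complex.re h
  rw [Complex.ofReal_re] at h2
  rw [h2]
  congr 1
  rw [← Equiv.sum_comp (Equiv.funUnique (Fin 1) X).symm]
  simp [Matrix.trace]

lemma integral_imageNormSq_pow_le (S : Matrix X ι ℂ) (m : ℕ) :
    ∫ g, imageNormSq S g ^ m ∂stdGaussian ι ≤ m.factorial * (S * Sᴴ).trace.re ^ m := by
  have h := congrArg Complex.re (integral_imageNormSq_pow S m)
  rw [Complex.ofReal_re] at h
  rw [h, Complex.re_sum]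
  have htr : (S * Sᴴ).trace.re = ∑ x, ((S * Sᴴ) x x).re := by simp [Matrix.trace]
  rw [htr, Fintype.sum_pow, Finset.mul_sum]
  refine Finset.sum_le_sum fun x _ => ?_
  rw [Complex.re_sum]
  calc ∑ π : Equiv.Perm (Fin m), (∏ j, (S * Sᴴ) (x j) (x (π j))).re
      ≤ ∑ π : Equiv.Perm (Fin m), ∏ j, ((S * Sᴴ) (x j) (x j)).re := by
        refine Finset.sum_le_sum fun π _ => (Complex.re_le_norm _).trans ?_
        rw [norm_prod]
        refine (Finset.prod_le_prod (fun _ _ => norm_nonneg _) fun j _ =>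
          norm_mul_conjTranspose_self_apply_le S (x j) (x (π j))).trans_eq ?_
        rw [Finset.prod_mul_distrib,
          Equiv.prod_comp π (fun j => Real.sqrt ((S * Sᴴ) (x j) (x j)).re),
          ← Finset.prod_mul_distrib]
        refine Finset.prod_congr rfl fun j _ => Real.mul_self_sqrt ?_
        rw [mul_conjTranspose_self_apply_self, Complex.ofReal_re]
        positivity
    _ = _ := by
        rw [Finset.sum_const, Finset.card_univ, Fintype.card_perm, Fintype.card_fin, nsmul_eq_mul]

lemma integral_imageNormSq_sq (S : Matrix X ι ℂ) :
    ∫ g, imageNormSq S g ^ 2 ∂stdGaussian ι = (S * Sᴴ).trace.re ^ 2 + hsNorm (S * Sᴴ) ^ 2 := by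
  have h := congrArg Complex.re (integral_imageNormSq_pow S 2)
  rw [Complex.ofReal_re] at h
  have htr : (S * Sᴴ).trace.re = ∑ x, ((S * Sᴴ) x x).re := by simp [Matrix.trace]
  have hperm : ∀ F : Equiv.Perm (Fin 2) → ℂ, ∑ π, F π = F 1 + F (Equiv.swap 0 1) := by
    intro F
    have : (Finset.univ : Finset (Equiv.Perm (Fin 2))) = {1, Equiv.swap 0 1} := by decide
    rw [this, Finset.sum_pair (by decide)]
  rw [h, ← Equiv.sum_comp (finTwoArrowEquiv X).symm, Fintype.sum_prod_type, hsNorm_sq, htr, sq,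
    Finset.sum_mul_sum, Complex.re_sum, ← Finset.sum_add_distrib]
  refine Finset.sum_congr rfl fun x _ => ?_
  rw [Complex.re_sum, ← Finset.sum_add_distrib]
  refine Finset.sum_congr rfl fun y _ => ?_
  rw [hperm]
  have hs : (S * Sᴴ) y x = star ((S * Sᴴ) x y) := by
    rw [← conjTranspose_apply, conjTranspose_mul, conjTranspose_conjTranspose]
  simp only [Fin.prod_univ_two, finTwoArrowEquiv_symm_apply, Equiv.Perm.one_apply,
    Equiv.swap_apply_left, Equiv.swap_apply_right, Matrix.cons_val_zero, Matrix.cons_val_one,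
    Complex.add_re]
  rw [hs, mul_conjTranspose_self_apply_self, mul_conjTranspose_self_apply_self,
    ← Complex.ofReal_mul, Complex.star_def, Complex.mul_conj, Complex.normSq_eq_norm_sq]
  simp only [Complex.ofReal_re]

/-- The variance of `‖S g‖²` is the squared Hilbert-Schmidt norm of the covariance. -/
lemma integral_imageNormSq_sub_sq (S : Matrix X ι ℂ) (h1 : (S * Sᴴ).trace.re = 1) :
    Integrable (fun g => (1 - imageNormSq S g) ^ 2) (stdGaussian ι) ∧
    ∫ g, (1 - imageNormSq S g) ^ 2 ∂stdGaussian ι = hsNorm (S * Sᴴ) ^ 2 := by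
  have e : ∀ g, (1 - imageNormSq S g) ^ 2
      = 1 - 2 * imageNormSq S g + imageNormSq S g ^ 2 := fun g => by ring
  have i1 : Integrable (fun g => imageNormSq S g) (stdGaussian ι) := by
    simpa using integrable_imageNormSq_pow S 1
  have i2 := integrable_imageNormSq_pow S 2
  have i3 : Integrable (fun g => 1 - 2 * imageNormSq S g) (stdGaussian ι) :=
    (integrable_const 1).sub (i1.const_mul 2)
  simp_rw [e]
  refine ⟨i3.add i2, ?_⟩
  rw [integral_add i3 i2, integral_sub (integrable_const 1) (i1.const_mul 2), integral_const_mul,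
    integral_imageNormSq, integral_imageNormSq_sq, h1]
  simp
  ring

end

section
variable {ι : Type*} [Fintype ι]

lemma ae_coord_ne_zero : ∀ᵐ g ∂stdGaussian ι, ∀ i, g i ≠ 0 := by
  rw [ae_all_iff]
  intro i
  have : NullSingletonClass complexGaussian := by
    unfold complexGaussian
    infer_instance
  rw [stdGaussian, ae_map_iff (by fun_prop)]
  · have h := Measure.ae_eval_ne (fun _ : ι => complexGaussian) i 0
    exact h
  · exact (measurableSet_singleton (0 : ℂ)).compl.preimage
      (by fun_prop : Measurable fun x : EuclideanSpace ℂ ι => x i)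

/-- Log-convexity of the Gamma function between the arguments `1 / 2` and `1`. -/
lemma Gamma_one_sub_le {x : ℝ} (h0 : 0 ≤ x) (h1 : x ≤ 1 / 2) :
    Real.Gamma (1 - x) ≤ Real.pi ^ x := by
  rcases h0.eq_or_lt with rfl | h0
  · simp
  rcases h1.eq_or_lt with rfl | h1
  · norm_num
    rw [Real.Gamma_one_half_eq, Real.sqrt_eq_rpow]
  have h := Real.Gamma_mul_add_mul_le_rpow_Gamma_mul_rpow_Gamma (s := 1) (t := 1 / 2)
    (a := 1 - 2 * x) (b := 2 * x) one_pos (by norm_num) (by linarith) (by linarith) (by ring)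
  rw [Real.Gamma_one, Real.one_rpow, one_mul, Real.Gamma_one_half_eq, Real.sqrt_eq_rpow,
    ← Real.rpow_mul Real.pi_pos.le] at h
  convert h using 2 <;> ring

/-- Inverse moments of `∑ λ_i |g_i|²`: by the weighted AM-GM inequality the sum dominates
`∏ |g_i|^(2 λ_i)`, a product of independent factors. -/
lemma integral_inv_pow_le (lam : ι → ℝ) (h0 : ∀ i, 0 ≤ lam i) (h1 : ∑ i, lam i = 1) (m : ℕ)
    (hm : ∀ i, m * lam i ≤ 1 / 2) :
    Integrable (fun g : EuclideanSpace ℂ ι => (∑ i, lam i * ‖g i‖ ^ 2)⁻¹ ^ m) (stdGaussian ι) ∧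
      ∫ g : EuclideanSpace ℂ ι, (∑ i, lam i * ‖g i‖ ^ 2)⁻¹ ^ m ∂stdGaussian ι ≤ Real.pi ^ m := by
  have hq : ∀ i, -2 < -2 * (m * lam i) := fun i => by linarith [hm i]
  have hint : Integrable (fun g : EuclideanSpace ℂ ι => ∏ i, ‖g i‖ ^ (-2 * (m * lam i)))
      (stdGaussian ι) :=
    integrable_prod_stdGaussian (h := fun i z => ‖z‖ ^ (-2 * (m * lam i)))
      fun i => integrable_norm_rpow_complexGaussian (hq i)
  have hle : ∀ᵐ g : EuclideanSpace ℂ ι ∂stdGaussian ι,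
      (∑ i, lam i * ‖g i‖ ^ 2)⁻¹ ^ m ≤ ∏ i, ‖g i‖ ^ (-2 * (m * lam i)) := by
    filter_upwards [ae_coord_ne_zero] with g hg
    have hpos : ∀ i, 0 < ‖g i‖ := fun i => norm_pos_iff.2 (hg i)
    have h := Real.geom_mean_le_arith_mean_weighted Finset.univ lam (fun i => ‖g i‖ ^ 2)
      (fun i _ => h0 i) h1 (fun i _ => by positivity)
    have hP : 0 < ∏ i, (‖g i‖ ^ 2) ^ lam i :=
      Finset.prod_pos fun i _ => Real.rpow_pos_of_pos (by have := hpos i; positivity) _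
    calc (∑ i, lam i * ‖g i‖ ^ 2)⁻¹ ^ m ≤ (∏ i, (‖g i‖ ^ 2) ^ lam i)⁻¹ ^ m := by
          exact pow_le_pow_left₀ (inv_nonneg.2 (hP.le.trans h)) (inv_anti₀ hP h) m
      _ = ∏ i, ‖g i‖ ^ (-2 * (m * lam i)) := by
          rw [← Finset.prod_inv_distrib, ← Finset.prod_pow]
          refine Finset.prod_congr rfl fun i _ => ?_
          rw [← Real.rpow_natCast _ 2, ← Real.rpow_mul (hpos i).le, ← Real.rpow_neg (hpos i).le,
            ← Real.rpow_natCast, ← Real.rpow_mul (hpos i).le]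
          congr 1
          push_cast; ring
  have hnn : ∀ g : EuclideanSpace ℂ ι, 0 ≤ (∑ i, lam i * ‖g i‖ ^ 2)⁻¹ ^ m := fun g => by
    have : 0 ≤ ∑ i, lam i * ‖g i‖ ^ 2 :=
      Finset.sum_nonneg fun i _ => mul_nonneg (h0 i) (by positivity)
    positivity
  have hint' : Integrable (fun g : EuclideanSpace ℂ ι => (∑ i, lam i * ‖g i‖ ^ 2)⁻¹ ^ m)
      (stdGaussian ι) := by
    refine hint.mono' (by fun_prop) ?_
    filter_upwards [hle] with g hg
    rwa [Real.norm_of_nonneg (hnn g)]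
  refine ⟨hint', (integral_mono_ae hint' hint hle).trans ?_⟩
  rw [integral_prod_stdGaussian (fun i z => ‖z‖ ^ (-2 * (m * lam i)))]
  calc ∏ i, ∫ z, ‖z‖ ^ (-2 * (m * lam i)) ∂complexGaussian
      ≤ ∏ i, Real.pi ^ (m * lam i) := by
        refine Finset.prod_le_prod (fun i _ => integral_nonneg fun z => by positivity) fun i _ => ?_
        rw [integral_norm_rpow_complexGaussian (hq i)]
        have := Gamma_one_sub_le (x := m * lam i) (mul_nonneg (by positivity) (h0 i)) (hm i)
        rwa [show -2 * (m * lam i) / 2 + 1 = 1 - m * lam i by ring]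
    _ = Real.pi ^ m := by
        rw [← Real.rpow_sum_of_pos Real.pi_pos, ← Finset.mul_sum, h1, mul_one, Real.rpow_natCast]

lemma abs_inv_pow_sub_one_le {n : ℝ} (hn : 0 < n) (m : ℕ) :
    |n⁻¹ ^ m - 1| ≤ |1 - n| * ∑ j ∈ Finset.range m, n⁻¹ ^ (j + 1) := by
  have h := geom_sum_mul n⁻¹ m
  have e : n⁻¹ - 1 = (1 - n) * n⁻¹ := by field_simp
  rw [← h, e, abs_mul, abs_mul, abs_of_nonneg (Finset.sum_nonneg fun i _ => by positivity),
    abs_of_pos (inv_pos.2 hn)]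
  refine le_of_eq ?_
  simp_rw [pow_succ, ← Finset.sum_mul]
  ring

/-- Under the Gaussian measure, the weight `‖S g‖ ^ (-2 m)` changes the expectation of a
nonnegative function with bounded fourth moment by at most a multiple of the Hilbert-Schmidt norm
of the covariance: `n⁻¹ ^ m - 1` has the factor `1 - n`, whose second moment is `‖S Sᴴ‖₂²`, and the
inverse powers of `n` left over are integrable since no `λ_i` is large. -/
lemma abs_integral_inv_pow_mul_sub_le {X : Type*} [Fintype X] (S : Matrix X ι ℂ) (lam : ι → ℝ)
    (h0 : ∀ i, 0 ≤ lam i) (hS : ∀ g, imageNormSq S g = ∑ i, lam i * ‖g i‖ ^ 2)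
    (h1 : ∑ i, lam i = 1) (htr : (S * Sᴴ).trace.re = 1) (m : ℕ)
    (hm : ∀ i, 4 * m * lam i ≤ 1 / 2) (F : EuclideanSpace ℂ ι → ℝ) (hFm : Measurable F)
    (hF0 : ∀ g, 0 ≤ F g) (K : ℝ) (hFi : Integrable (fun g => F g ^ 4) (stdGaussian ι))
    (hFK : ∫ g, F g ^ 4 ∂stdGaussian ι ≤ K) :
    Integrable (fun g => (imageNormSq S g)⁻¹ ^ m * F g) (stdGaussian ι) ∧
    |∫ g, (imageNormSq S g)⁻¹ ^ m * F g ∂stdGaussian ι - ∫ g, F g ∂stdGaussian ι|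
      ≤ m * Real.sqrt (Real.pi ^ (4 * m) + K) * hsNorm (S * Sᴴ) := by
  have hpos : ∀ᵐ g ∂stdGaussian ι, 0 < imageNormSq S g := by
    filter_upwards [ae_coord_ne_zero] with g hg
    rw [hS]
    obtain ⟨i, hi⟩ : ∃ i, lam i ≠ 0 := by
      by_contra! h
      simp [h] at h1
    refine Finset.sum_pos' (fun i _ => mul_nonneg (h0 i) (by positivity)) ⟨i, Finset.mem_univ _, ?_⟩
    exact mul_pos ((h0 i).lt_of_ne' hi) (by have := norm_pos_iff.2 (hg i); positivity)
  have hFint : Integrable F (stdGaussian ι) := by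
    refine ((integrable_const (1 : ℝ)).add hFi).mono' hFm.aestronglyMeasurable
      (.of_forall fun g => ?_)
    rw [Real.norm_of_nonneg (hF0 g)]
    simp only [Pi.add_apply]
    nlinarith [sq_nonneg (F g ^ 2 - 1), sq_nonneg (F g - 1), sq_nonneg (F g ^ 2)]
  have hinv : ∀ j, j ≤ 4 * m → Integrable (fun g => (imageNormSq S g)⁻¹ ^ j) (stdGaussian ι) ∧
      ∫ g, (imageNormSq S g)⁻¹ ^ j ∂stdGaussian ι ≤ Real.pi ^ j := by
    intro j hj
    simp_rw [hS]
    refine integral_inv_pow_le lam h0 h1 j fun i => le_trans ?_ (hm i)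
    have : (j : ℝ) ≤ 4 * m := by exact_mod_cast hj
    exact mul_le_mul_of_nonneg_right this (h0 i)
  have hK : 0 ≤ K := (integral_nonneg fun g => by positivity).trans hFK
  have hnm : Measurable (imageNormSq S) := (continuous_imageNormSq S).measurable
  have hterm : ∀ j ∈ Finset.range m,
      Integrable (fun g => |1 - imageNormSq S g| * |(imageNormSq S g)⁻¹ ^ (j + 1) * F g|)
        (stdGaussian ι) ∧
      ∫ g, |1 - imageNormSq S g| * |(imageNormSq S g)⁻¹ ^ (j + 1) * F g| ∂stdGaussian ι
        ≤ hsNorm (S * Sᴴ) * Real.sqrt (Real.pi ^ (4 * m) + K) := by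
    intro j hj
    rw [Finset.mem_range] at hj
    obtain ⟨hi2, he2⟩ := integral_imageNormSq_sub_sq S htr
    obtain ⟨hi4, hb4⟩ := hinv (4 * (j + 1)) (by omega)
    have hle : ∀ g, ((imageNormSq S g)⁻¹ ^ (j + 1) * F g) ^ 2
        ≤ (imageNormSq S g)⁻¹ ^ (4 * (j + 1)) + F g ^ 4 := fun g => by
      have e : (imageNormSq S g)⁻¹ ^ (4 * (j + 1)) = ((imageNormSq S g)⁻¹ ^ (j + 1)) ^ 4 := by
        rw [mul_comm, pow_mul]
      rw [e]
      nlinarith [sq_nonneg (((imageNormSq S g)⁻¹ ^ (j + 1)) ^ 2 - F g ^ 2),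
        sq_nonneg (((imageNormSq S g)⁻¹ ^ (j + 1)) ^ 2), sq_nonneg (F g ^ 2)]
    have hisq : Integrable (fun g => ((imageNormSq S g)⁻¹ ^ (j + 1) * F g) ^ 2)
        (stdGaussian ι) := by
      refine (hi4.add hFi).mono' (by fun_prop) (.of_forall fun g => ?_)
      rw [Real.norm_of_nonneg (by positivity)]
      exact hle g
    have h := integral_mul_le_sqrt_mul_sqrt (μ := stdGaussian ι)
      (f := fun g => 1 - imageNormSq S g)
      (g := fun g => (imageNormSq S g)⁻¹ ^ (j + 1) * F g)
      (by fun_prop) (by fun_prop) hi2 hisq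
    refine ⟨h.1, h.2.trans ?_⟩
    rw [he2, Real.sqrt_sq (hsNorm_nonneg _)]
    refine mul_le_mul_of_nonneg_left (Real.sqrt_le_sqrt ?_) (hsNorm_nonneg _)
    calc _ ≤ ∫ g, ((imageNormSq S g)⁻¹ ^ (4 * (j + 1)) + F g ^ 4) ∂stdGaussian ι :=
          integral_mono hisq (hi4.add hFi) hle
      _ ≤ Real.pi ^ (4 * (j + 1)) + K := by
          rw [integral_add hi4 hFi]
          exact add_le_add hb4 hFK
      _ ≤ _ := by
          gcongr
          · linarith [Real.pi_gt_three]
          · omega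
  have hdom : ∀ᵐ g ∂stdGaussian ι, ‖(imageNormSq S g)⁻¹ ^ m * F g - F g‖
      ≤ ∑ j ∈ Finset.range m, |1 - imageNormSq S g| * |(imageNormSq S g)⁻¹ ^ (j + 1) * F g| := by
    filter_upwards [hpos] with g hg
    have e : (imageNormSq S g)⁻¹ ^ m * F g - F g = ((imageNormSq S g)⁻¹ ^ m - 1) * F g := by ring
    rw [e, norm_mul, Real.norm_eq_abs, Real.norm_of_nonneg (hF0 g)]
    refine (mul_le_mul_of_nonneg_right (abs_inv_pow_sub_one_le hg m) (hF0 g)).trans_eq ?_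
    rw [mul_assoc, Finset.sum_mul, Finset.mul_sum]
    refine Finset.sum_congr rfl fun j _ => ?_
    rw [abs_of_nonneg (mul_nonneg (by positivity) (hF0 g))]
  have hdi : Integrable (fun g => (imageNormSq S g)⁻¹ ^ m * F g - F g) (stdGaussian ι) :=
    (integrable_finsetSum _ fun j hj => (hterm j hj).1).mono' (by fun_prop) hdom
  have hi : Integrable (fun g => (imageNormSq S g)⁻¹ ^ m * F g) (stdGaussian ι) := by
    exact (hdi.add hFint).congr (.of_forall fun g => by simp)
  refine ⟨hi, ?_⟩
  rw [← integral_sub hi hFint, ← Real.norm_eq_abs]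
  refine (norm_integral_le_of_norm_le (integrable_finsetSum _ fun j hj => (hterm j hj).1)
    hdom).trans ?_
  rw [integral_finsetSum _ fun j hj => (hterm j hj).1]
  refine (Finset.sum_le_sum fun j hj => (hterm j hj).2).trans_eq ?_
  rw [Finset.sum_const, Finset.card_range, nsmul_eq_mul]
  ring

end

/-! ### Gaussian averages and Haar averages -/

section
variable {ι : Type*} [Fintype ι]

lemma pi_complexGaussian_eq :
    (Measure.pi fun _ : ι => complexGaussian)
      = (Measure.pi fun _ : ι => (volume : Measure ℂ)).withDensity
          fun x => ENNReal.ofReal (∏ i, (Real.pi⁻¹ * Real.exp (-‖x i‖ ^ 2))) := by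
  have hint : Integrable (fun z : ℂ => Real.pi⁻¹ * Real.exp (-‖z‖ ^ 2)) := by
    have := (integrable_complexGaussian_iff (fun _ : ℂ => (1 : ℝ))).1 (integrable_const 1)
    simpa using this
  refine Measure.pi_eq fun s hs => ?_
  rw [withDensity_apply _ (MeasurableSet.univ_pi hs), Measure.restrict_pi_pi,
    ← ofReal_integral_eq_lintegral_ofReal
      (Integrable.fintype_prod fun i => hint.restrict)
      (.of_forall fun x => Finset.prod_nonneg fun i _ => by positivity),
    integral_fintype_prod_eq_prod (fun i z => Real.pi⁻¹ * Real.exp (-‖z‖ ^ 2)),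
    ENNReal.ofReal_prod_of_nonneg fun i _ => integral_nonneg fun z => by positivity]
  refine Finset.prod_congr rfl fun i _ => ?_
  rw [complexGaussian, withDensity_apply _ (hs i),
    ofReal_integral_eq_lintegral_ofReal hint.restrict (.of_forall fun x => by positivity)]

/-- The standard Gaussian measure has a density proportional to `exp(-‖x‖²)`. -/
lemma exists_stdGaussian_eq_withDensity :
    ∃ c : ENNReal, stdGaussian ι
      = (c • (volume : Measure (EuclideanSpace ℂ ι))).withDensity
          fun x => ENNReal.ofReal (Real.exp (-‖x‖ ^ 2)) := by
  let L : (ι → ℂ) ≃L[ℝ] EuclideanSpace ℂ ι :=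
    (PiLp.continuousLinearEquiv 2 ℝ (fun _ : ι => ℂ)).symm
  let ν : Measure (EuclideanSpace ℂ ι) :=
    (Measure.pi fun _ : ι => (volume : Measure ℂ)).map (WithLp.toLp 2)
  have hν : ν.IsAddHaarMeasure := by
    have : (Measure.pi fun _ : ι => (volume : Measure ℂ)).IsAddHaarMeasure :=
      inferInstance
    exact L.isAddHaarMeasure_map (Measure.pi fun _ : ι => (volume : Measure ℂ))
  obtain ⟨c, hc⟩ : ∃ c : ENNReal, ν = c • (volume : Measure (EuclideanSpace ℂ ι)) :=
    ⟨_, Measure.isAddLeftInvariant_eq_smul ν volume⟩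
  refine ⟨ENNReal.ofReal (Real.pi⁻¹ ^ Fintype.card ι) * c, ?_⟩
  refine Measure.ext_of_lintegral _ fun f hf => ?_
  have hd : ∀ x : ι → ℂ, ENNReal.ofReal (∏ i, (Real.pi⁻¹ * Real.exp (-‖x i‖ ^ 2)))
      = ENNReal.ofReal (Real.pi⁻¹ ^ Fintype.card ι)
        * ENNReal.ofReal (Real.exp (-‖WithLp.toLp 2 x‖ ^ 2)) := by
    intro x
    rw [← ENNReal.ofReal_mul (by positivity), Finset.prod_mul_distrib, ← Real.exp_sum,
      EuclideanSpace.norm_sq_eq]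
    simp
  have hm : Measurable (WithLp.toLp 2 : (ι → ℂ) → EuclideanSpace ℂ ι) := by fun_prop
  rw [stdGaussian, lintegral_map hf hm, pi_complexGaussian_eq]
  refine (lintegral_withDensity_eq_lintegral_mul _ (by fun_prop) (hf.comp hm)).trans ?_
  rw [lintegral_withDensity_eq_lintegral_mul _ (by fun_prop) hf,
    mul_smul, ← hc, lintegral_smul_measure, lintegral_map (by fun_prop) hm,
    smul_eq_mul, ← lintegral_const_mul _ (by fun_prop)]
  refine lintegral_congr fun x => ?_
  simp only [Pi.mul_apply, Function.comp_apply]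
  rw [hd, mul_assoc]

lemma imageNormSq_eq_of_diagonal {X : Type*} [Fintype X] [DecidableEq ι] {S : Matrix X ι ℂ}
    {lam : ι → ℝ} (h : Sᴴ * S = diagonal fun i => (lam i : ℂ)) (g : EuclideanSpace ℂ ι) :
    imageNormSq S g = ∑ i, lam i * ‖g i‖ ^ 2 := by
  have h1 : (imageNormSq S g : ℂ) = star (S *ᵥ g.ofLp) ⬝ᵥ (S *ᵥ g.ofLp) := by
    simp [imageNormSq, dotProduct, Complex.conj_mul']
  have h2 : star (S *ᵥ g.ofLp) ⬝ᵥ (S *ᵥ g.ofLp) = ((∑ i, lam i * ‖g i‖ ^ 2 : ℝ) : ℂ) := by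
    rw [star_mulVec, ← dotProduct_mulVec, mulVec_mulVec, h]
    simp only [dotProduct, Pi.star_apply, mulVec_diagonal]
    push_cast
    refine Finset.sum_congr rfl fun i _ => ?_
    rw [← Complex.conj_mul']
    simp; ring
  exact_mod_cast h1.trans h2

lemma norm_toLp_mulVec_sq {X : Type*} [Fintype X] (S : Matrix X ι ℂ) (g : EuclideanSpace ℂ ι) :
    ‖(WithLp.toLp 2 (S *ᵥ g.ofLp) : EuclideanSpace ℂ X)‖ ^ 2 = imageNormSq S g := by
  rw [EuclideanSpace.norm_sq_eq, imageNormSq]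

lemma norm_sq_eq_imageNormSq_one [DecidableEq ι] (g : EuclideanSpace ℂ ι) :
    ‖g‖ ^ 2 = imageNormSq (1 : Matrix ι ι ℂ) g := by
  rw [← norm_toLp_mulVec_sq]; simp

/-- Unitary invariance of the standard Gaussian measure. -/
lemma measurePreserving_unitary_stdGaussian [DecidableEq ι] {V : Matrix ι ι ℂ}
    (hV : Vᴴ * V = 1) :
    MeasurePreserving (fun g : EuclideanSpace ℂ ι => WithLp.toLp 2 (V *ᵥ g.ofLp))
      (stdGaussian ι) (stdGaussian ι) := by
  have hnorm : ∀ g : EuclideanSpace ℂ ι,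
      ‖(WithLp.toLp 2 (V *ᵥ g.ofLp) : EuclideanSpace ℂ ι)‖ = ‖g‖ := by
    intro g
    have h : ‖(WithLp.toLp 2 (V *ᵥ g.ofLp) : EuclideanSpace ℂ ι)‖ ^ 2 = ‖g‖ ^ 2 := by
      rw [norm_toLp_mulVec_sq, imageNormSq_eq_of_diagonal (lam := fun _ => 1) (by simp [hV]),
        EuclideanSpace.norm_sq_eq]
      simp
    exact (pow_left_inj₀ (norm_nonneg _) (norm_nonneg _) two_ne_zero).1 h
  let li : EuclideanSpace ℂ ι →ₗᵢ[ℝ] EuclideanSpace ℂ ι :=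
    { toLinearMap := (toEuclideanLin V).restrictScalars ℝ
      norm_map' := hnorm }
  have hp : MeasurePreserving (fun g : EuclideanSpace ℂ ι =>
      (WithLp.toLp 2 (V *ᵥ g.ofLp) : EuclideanSpace ℂ ι)) volume volume :=
    (li.toLinearIsometryEquiv rfl).measurePreserving
  obtain ⟨c, hc⟩ := exists_stdGaussian_eq_withDensity (ι := ι)
  refine ⟨hp.measurable, Measure.ext_of_lintegral _ fun f hf => ?_⟩
  have hm := hp.measurable
  have hd : Measurable fun x : EuclideanSpace ℂ ι => ENNReal.ofReal (Real.exp (-‖x‖ ^ 2)) := by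
    fun_prop
  rw [lintegral_map hf hm, hc]
  refine (lintegral_withDensity_eq_lintegral_mul _ hd (hf.comp hm)).trans ?_
  rw [lintegral_withDensity_eq_lintegral_mul _ hd hf,
    lintegral_smul_measure, lintegral_smul_measure]
  congr 1
  refine Eq.trans ?_ (hp.lintegral_comp
    (f := fun x => ENNReal.ofReal (Real.exp (-‖x‖ ^ 2)) * f x) (by fun_prop))
  refine lintegral_congr fun g => ?_
  simp [hnorm]

/-- Polar coordinates: for a function which is homogeneous of degree two, the Gaussian integral is
proportional to the integral over the unit sphere. -/
lemma exists_lintegral_stdGaussian_eq_sphere :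
    ∃ B : ENNReal, ∀ F : EuclideanSpace ℂ ι → ENNReal, Measurable F → F 0 = 0 →
      (∀ (r : ℝ) (x), 0 < r → F (r • x) = ENNReal.ofReal (r ^ 2) * F x) →
      ∫⁻ g, F g ∂stdGaussian ι
        = B * ∫⁻ x, F x.1 ∂(volume : Measure (EuclideanSpace ℂ ι)).toSphere := by
  obtain ⟨c, hc⟩ := exists_stdGaussian_eq_withDensity (ι := ι)
  let E := EuclideanSpace ℂ ι
  refine ⟨c * ∫⁻ r : Set.Ioi (0 : ℝ), ENNReal.ofReal (Real.exp (-r.1 ^ 2) * r.1 ^ 2)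
    ∂(Measure.volumeIoiPow (Module.finrank ℝ E - 1)), fun F hF hF0 hFh => ?_⟩
  have hmp := (volume : Measure E).measurePreserving_homeomorphUnitSphereProd
  let H : E → ENNReal := fun x => ENNReal.ofReal (Real.exp (-‖x‖ ^ 2)) * F x
  have hH : Measurable H := by fun_prop
  rw [hc, lintegral_withDensity_eq_lintegral_mul _ (by fun_prop) hF, lintegral_smul_measure,
    smul_eq_mul, mul_assoc]
  congr 1
  have hs : MeasurableSet ({0}ᶜ : Set E) := (measurableSet_singleton 0).compl
  have e1 : ∫⁻ x : E, H x = ∫⁻ x in ({0}ᶜ : Set E), H x := by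
    rw [← lintegral_indicator hs]
    refine lintegral_congr fun x => ?_
    by_cases hx : x = 0
    · simp [hx, H, hF0]
    · rw [Set.indicator_of_mem (by simpa using hx)]
  have e2 : ∫⁻ x in ({0}ᶜ : Set E), H x
      = ∫⁻ x : ({0}ᶜ : Set E), H x.1 ∂(Measure.comap Subtype.val volume) :=
    (lintegral_subtype_comap hs H).symm
  have e3 : ∫⁻ x : ({0}ᶜ : Set E), H x.1 ∂(Measure.comap Subtype.val volume)
      = ∫⁻ y, H ((homeomorphUnitSphereProd E).symm y).1
          ∂((volume : Measure E).toSphere.prod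
            (Measure.volumeIoiPow (Module.finrank ℝ E - 1))) := by
    refine Eq.trans ?_ (hmp.lintegral_comp
      (hH.comp (measurable_subtype_coe.comp (homeomorphUnitSphereProd E).symm.measurable)))
    simp
  have e4 : ∀ y : Metric.sphere (0 : E) 1 × Set.Ioi (0 : ℝ),
      H ((homeomorphUnitSphereProd E).symm y).1
        = F y.1.1 * ENNReal.ofReal (Real.exp (-y.2.1 ^ 2) * y.2.1 ^ 2) := by
    rintro ⟨x, r⟩
    have hr : 0 < r.1 := r.2
    have hx : ‖x.1‖ = 1 := by simp
    simp only [homeomorphUnitSphereProd_symm_apply_coe, H]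
    rw [hFh _ _ hr, norm_smul, hx, ENNReal.ofReal_mul (by positivity)]
    simp
    ring
  change ∫⁻ x : E, H x = _
  rw [e1, e2, e3]
  simp_rw [e4]
  refine (lintegral_prod_mul (f := fun x : Metric.sphere (0 : E) 1 => F x.1)
    (g := fun r : Set.Ioi (0 : ℝ) => ENNReal.ofReal (Real.exp (-r.1 ^ 2) * r.1 ^ 2))
    (by fun_prop) (by fun_prop)).trans (mul_comm _ _)

lemma lintegral_norm_sq_stdGaussian :
    ∫⁻ g : EuclideanSpace ℂ ι, ENNReal.ofReal (‖g‖ ^ 2) ∂stdGaussian ι = Fintype.card ι := by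
  classical
  simp_rw [norm_sq_eq_imageNormSq_one]
  have h := integrable_imageNormSq_pow (1 : Matrix ι ι ℂ) 1
  simp only [pow_one] at h
  rw [← ofReal_integral_eq_lintegral_ofReal h (.of_forall fun g => imageNormSq_nonneg _ _),
    integral_imageNormSq]
  simp

/-- For a function which is homogeneous of degree two, the Gaussian expectation is `D` times the
Haar average over the unit sphere. -/
lemma lintegral_stdGaussian_eq_haarState [Nonempty ι] (F : EuclideanSpace ℂ ι → ENNReal)
    (hF : Measurable F) (hF0 : F 0 = 0)
    (hFh : ∀ (r : ℝ) (x), 0 < r → F (r • x) = ENNReal.ofReal (r ^ 2) * F x) :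
    ∫⁻ g, F g ∂stdGaussian ι = Fintype.card ι * ∫⁻ x, F x ∂haarState ι := by
  obtain ⟨B, hB⟩ := exists_lintegral_stdGaussian_eq_sphere (ι := ι)
  have h2 := hB (fun x => ENNReal.ofReal (‖x‖ ^ 2)) (by fun_prop) (by simp) (by
    intro r x hr
    rw [norm_smul, mul_pow, ENNReal.ofReal_mul (by positivity)]
    simp)
  have hT0 : (volume : Measure (EuclideanSpace ℂ ι)).toSphere Set.univ ≠ 0 := by
    rw [Ne, Measure.measure_univ_eq_zero]
    exact Measure.toSphere_ne_zero _
  have hT1 : (volume : Measure (EuclideanSpace ℂ ι)).toSphere Set.univ ≠ ⊤ := measure_ne_top _ _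
  have h3 : ∀ x : Metric.sphere (0 : EuclideanSpace ℂ ι) 1, ENNReal.ofReal (‖x.1‖ ^ 2) = 1 := by
    intro x
    simp
  rw [lintegral_norm_sq_stdGaussian] at h2
  simp_rw [h3] at h2
  rw [lintegral_one] at h2
  rw [hB F hF hF0 hFh, haarState, lintegral_smul_measure, lintegral_map hF measurable_subtype_coe,
    h2, smul_eq_mul, mul_assoc, ← mul_assoc _ (_⁻¹), ENNReal.mul_inv_cancel hT0 hT1, one_mul]

end

/-! ### The Gaussian description of the Scrooge ensemble -/

section
variable {ι : Type*} [Fintype ι]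

lemma expVal_conjTranspose_mul_self {X : Type*} [Fintype X] (S : Matrix X ι ℂ)
    (g : EuclideanSpace ℂ ι) : expVal (Sᴴ * S) g = imageNormSq S g := by
  have h1 : (imageNormSq S g : ℂ) = star (S *ᵥ g.ofLp) ⬝ᵥ (S *ᵥ g.ofLp) := by
    simp [imageNormSq, dotProduct, Complex.conj_mul']
  have h2 : star (S *ᵥ g.ofLp) ⬝ᵥ (S *ᵥ g.ofLp)
      = ∑ i, ∑ j, star (g i) * (Sᴴ * S) i j * g j := by
    rw [star_mulVec, ← dotProduct_mulVec, mulVec_mulVec]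
    simp only [dotProduct, mulVec, Finset.mul_sum, Pi.star_apply, mul_assoc]
  rw [expVal, ← h2, ← h1, Complex.ofReal_re]

lemma mulVec_ofLp_real_smul {X : Type*} (S : Matrix X ι ℂ) (r : ℝ)
    (g : EuclideanSpace ℂ ι) : S *ᵥ (r • g).ofLp = (r : ℂ) • (S *ᵥ g.ofLp) := by
  rw [← mulVec_smul]; rfl

lemma imageNormSq_smul {X : Type*} [Fintype X] (S : Matrix X ι ℂ) (r : ℝ)
    (g : EuclideanSpace ℂ ι) : imageNormSq S (r • g) = r ^ 2 * imageNormSq S g := by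
  simp only [imageNormSq, mulVec_ofLp_real_smul, Pi.smul_apply, norm_smul, mul_pow, Finset.mul_sum]
  simp

/-- The unit vector in the direction of `S g` (zero if `S g = 0`). -/
noncomputable def normalizedImage {X : Type*} [Fintype X] (S : Matrix X ι ℂ)
    (g : EuclideanSpace ℂ ι) : EuclideanSpace ℂ X :=
  ((‖(WithLp.toLp 2 (S *ᵥ g.ofLp) : EuclideanSpace ℂ X)‖⁻¹ : ℝ) : ℂ)
    • WithLp.toLp 2 (S *ᵥ g.ofLp)

lemma measurable_normalizedImage {X : Type*} [Fintype X] (S : Matrix X ι ℂ) :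
    Measurable (normalizedImage S) := by
  unfold normalizedImage
  fun_prop

lemma normalizedImage_smul {X : Type*} [Fintype X] (S : Matrix X ι ℂ) {r : ℝ} (hr : 0 < r)
    (g : EuclideanSpace ℂ ι) : normalizedImage S (r • g) = normalizedImage S g := by
  have h : (WithLp.toLp 2 (S *ᵥ (r • g).ofLp) : EuclideanSpace ℂ X)
      = (r : ℂ) • WithLp.toLp 2 (S *ᵥ g.ofLp) := by
    rw [mulVec_ofLp_real_smul]; rfl
  rw [normalizedImage, normalizedImage, h, norm_smul, smul_smul]
  congr 1
  have : (r : ℂ) ≠ 0 := by exact_mod_cast hr.ne'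
  simp [abs_of_pos hr]
  field_simp

/-- The data of a Gaussian vector `S g` with covariance `σ = S Sᴴ`, in which `S` is chosen such
that `‖S g‖² = ∑ λ_i |g_i|²` for the eigenvalues `λ_i` of `σ`. The Scrooge ensemble of `σ` is the
law of the normalisation of `S g` under the Gaussian measure reweighted by `‖S g‖²`. -/
structure IsGaussianFactor [DecidableEq ι] (σ S : Matrix ι ι ℂ) (lam : ι → ℝ) : Prop where
  cov : S * Sᴴ = σ
  trace : (S * Sᴴ).trace.re = 1
  nonneg : ∀ i, 0 ≤ lam i
  sum_eq_one : ∑ i, lam i = 1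
  le_hsNorm : ∀ i, lam i ≤ hsNorm σ
  normSq_eq : ∀ g, imageNormSq S g = ∑ i, lam i * ‖g i‖ ^ 2
  ensemble_eq : scroogeEnsemble σ = ((stdGaussian ι).withDensity
    fun g => ENNReal.ofReal (imageNormSq S g)).map (normalizedImage S)

/-- Every density matrix has a Gaussian factor: `S = √σ U`, where `U` diagonalises `σ`. By unitary
invariance `√σ U g` and `√σ g` have the same law, and since the reweighting by `‖√σ g‖²` makes the
integrand homogeneous of degree two, the Gaussian `g` can be replaced by a Haar random vector. -/
theorem exists_isGaussianFactor [DecidableEq ι] {σ : Matrix ι ι ℂ} (hσ : IsDensityMatrix σ) :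
    ∃ (S : Matrix ι ι ℂ) (lam : ι → ℝ), IsGaussianFactor σ S lam := by
  obtain ⟨hpos, htr⟩ := hσ
  have : Nonempty ι := by
    by_contra h
    rw [not_nonempty_iff] at h
    simp [Matrix.trace] at htr
  set R := CFC.sqrt σ with hR
  have hRR : R * R = σ := CFC.sqrt_mul_sqrt_self σ hpos.nonneg
  have hRh : Rᴴ = R := (Matrix.nonneg_iff_posSemidef.1 (CFC.sqrt_nonneg σ)).1
  let U : Matrix ι ι ℂ := hpos.1.eigenvectorUnitary
  have hUU : Uᴴ * U = 1 := mem_unitaryGroup_iff'.1 hpos.1.eigenvectorUnitary.2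
  have hUU' : U * Uᴴ = 1 := mem_unitaryGroup_iff.1 hpos.1.eigenvectorUnitary.2
  have hdiag : (R * U)ᴴ * (R * U) = diagonal fun i => (hpos.1.eigenvalues i : ℂ) := by
    rw [conjTranspose_mul, hRh, Matrix.mul_assoc, ← Matrix.mul_assoc R, hRR, ← Matrix.mul_assoc]
    have := hpos.1.conjStarAlgAut_star_eigenvectorUnitary
    rw [Unitary.conjStarAlgAut_apply] at this
    simpa [U, star_eq_conjTranspose, Function.comp_def] using this
  have hcov : (R * U) * (R * U)ᴴ = σ := by
    rw [conjTranspose_mul, hRh, Matrix.mul_assoc, ← Matrix.mul_assoc U, hUU', Matrix.one_mul, hRR]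
  refine ⟨R * U, hpos.1.eigenvalues, hcov, by rw [hcov, htr, Complex.one_re],
    hpos.eigenvalues_nonneg, ?_, ?_, imageNormSq_eq_of_diagonal hdiag, ?_⟩
  · have h := hpos.1.trace_eq_sum_eigenvalues
    rw [htr] at h
    have h2 := congrArg Complex.re h
    simpa using h2.symm
  · intro i
    have h1 : hsNorm σ ^ 2 = ∑ i, hpos.1.eigenvalues i ^ 2 := by
      have e : σᴴ * σ = (R * U) * ((R * U)ᴴ * (R * U) * (R * U)ᴴ) := by
        rw [hpos.1.eq, ← Matrix.mul_assoc, ← Matrix.mul_assoc, hcov, Matrix.mul_assoc, hcov]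
      have e2 : (σᴴ * σ).trace = ((∑ i, hpos.1.eigenvalues i ^ 2 : ℝ) : ℂ) := by
        rw [e, Matrix.trace_mul_comm, Matrix.mul_assoc, hdiag, diagonal_mul_diagonal,
          trace_diagonal]
        push_cast
        exact Finset.sum_congr rfl fun i _ => by ring
      rw [hsNorm, e2, Complex.ofReal_re, Real.sq_sqrt (by positivity)]
    refine abs_le_of_sq_le_sq' ?_ (hsNorm_nonneg σ) |>.2
    rw [h1]
    exact Finset.single_le_sum (f := fun i => hpos.1.eigenvalues i ^ 2) (fun i _ => sq_nonneg _)
      (Finset.mem_univ i)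
  · have hexp : ∀ φ : EuclideanSpace ℂ ι, expVal σ φ = imageNormSq R φ := fun φ => by
      rw [← expVal_conjTranspose_mul_self, hRh, hRR]
    have hsa : (fun φ : EuclideanSpace ℂ ι =>
        ((‖sqrtApply σ φ‖⁻¹ : ℝ) : ℂ) • sqrtApply σ φ) = normalizedImage R := rfl
    have hR0 : imageNormSq R 0 = 0 := by simp [imageNormSq]
    have hmR := measurable_normalizedImage R
    have hmS := measurable_normalizedImage (R * U)
    refine Measure.ext_of_lintegral _ fun f hf => ?_
    have hcR := (continuous_imageNormSq R).measurable
    have hcS := (continuous_imageNormSq (R * U)).measurable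
    rw [scroogeEnsemble, hsa, lintegral_map hf hmR, lintegral_map hf hmS]
    simp_rw [hexp]
    refine (lintegral_withDensity_eq_lintegral_mul _ (by fun_prop) (hf.comp hmR)).trans ?_
    refine Eq.trans ?_
      (lintegral_withDensity_eq_lintegral_mul _ (by fun_prop) (hf.comp hmS)).symm
    have h1 := lintegral_stdGaussian_eq_haarState
      (fun φ : EuclideanSpace ℂ ι => ENNReal.ofReal (imageNormSq R φ) * f (normalizedImage R φ))
      (by fun_prop) (by simp [hR0]) (by
        intro r x hr
        rw [imageNormSq_smul, normalizedImage_smul R hr, ENNReal.ofReal_mul (by positivity),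
          mul_assoc])
    have h2 := (measurePreserving_unitary_stdGaussian hUU).lintegral_comp
      (f := fun φ : EuclideanSpace ℂ ι =>
        ENNReal.ofReal (imageNormSq R φ) * f (normalizedImage R φ)) (by fun_prop)
    have e1 : ∀ g : EuclideanSpace ℂ ι,
        imageNormSq R (WithLp.toLp 2 (U *ᵥ g.ofLp)) = imageNormSq (R * U) g := fun g => by
      simp [imageNormSq, mulVec_mulVec]
    have e2 : ∀ g : EuclideanSpace ℂ ι,
        normalizedImage R (WithLp.toLp 2 (U *ᵥ g.ofLp)) = normalizedImage (R * U) g := fun g => by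
      simp [normalizedImage, mulVec_mulVec]
    simp_rw [e1, e2] at h2
    refine Eq.trans ?_ (h1.symm.trans h2.symm)
    rw [← lintegral_const_mul _ (by fun_prop)]
    refine lintegral_congr fun φ => ?_
    simp only [Pi.mul_apply, Function.comp_apply]
    rw [ENNReal.ofReal_mul (by positivity), ENNReal.ofReal_natCast, mul_assoc]

end

/-! ### Sums of squares and relative-error designs -/

lemma continuous_tensorPow_ketBra {ι : Type*} (n : ℕ) (x y : Fin n → ι) :
    Continuous fun Ψ : EuclideanSpace ℂ ι => tensorPow n (ketBra Ψ) x y := by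
  simp only [tensorPow, ketBra, of_apply]
  fun_prop

section
variable {ι : Type*} [Fintype ι]

lemma norm_normalizedImage_le {X : Type*} [Fintype X] (S : Matrix X ι ℂ)
    (g : EuclideanSpace ℂ ι) : ‖normalizedImage S g‖ ≤ 1 := by
  rw [normalizedImage, norm_smul, Complex.norm_real, norm_inv, norm_norm]
  exact inv_mul_le_one

lemma integrable_of_ae_norm_le_one {E F : Type*} [NormedAddCommGroup E] [ProperSpace E]
    [MeasurableSpace E] [OpensMeasurableSpace E] [NormedAddCommGroup F]
    [SecondCountableTopology E]
    {μ : Measure E} [IsFiniteMeasure μ] (hμ : ∀ᵐ x ∂μ, ‖x‖ ≤ 1) {f : E → F} (hf : Continuous f) :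
    Integrable f μ := by
  obtain ⟨C, hC⟩ := (isCompact_closedBall (0 : E) 1).exists_bound_of_continuousOn hf.continuousOn
  refine (integrable_const C).mono' hf.aestronglyMeasurable ?_
  filter_upwards [hμ] with x hx
  exact hC x (by simpa using hx)

section
variable [DecidableEq ι] {σ S : Matrix ι ι ℂ} {lam : ι → ℝ}

lemma IsGaussianFactor.integral_scrooge {F : Type*} [NormedAddCommGroup F] [NormedSpace ℝ F]
    (h : IsGaussianFactor σ S lam) {f : EuclideanSpace ℂ ι → F}
    (hf : StronglyMeasurable f) :
    ∫ ψ, f ψ ∂scroogeEnsemble σ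
      = ∫ g, imageNormSq S g • f (normalizedImage S g) ∂stdGaussian ι := by
  have hm := (continuous_imageNormSq S).measurable
  rw [h.ensemble_eq, integral_map (measurable_normalizedImage S).aemeasurable
    hf.aestronglyMeasurable,
    integral_withDensity_eq_integral_toReal_smul (by fun_prop) (by simp)]
  refine integral_congr_ae (.of_forall fun g => ?_)
  simp only
  rw [ENNReal.toReal_ofReal (imageNormSq_nonneg _ _)]

lemma IsGaussianFactor.isProbabilityMeasure (h : IsGaussianFactor σ S lam) :
    IsProbabilityMeasure (scroogeEnsemble σ) := by
  have hi : Integrable (fun g => imageNormSq S g) (stdGaussian ι) := by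
    simpa using integrable_imageNormSq_pow S 1
  constructor
  rw [h.ensemble_eq, Measure.map_apply (measurable_normalizedImage S) .univ, Set.preimage_univ,
    withDensity_apply _ .univ, setLIntegral_univ,
    ← ofReal_integral_eq_lintegral_ofReal hi (.of_forall fun g => imageNormSq_nonneg _ _),
    integral_imageNormSq, h.trace, ENNReal.ofReal_one]

/-- The Scrooge ensemble lives on unit vectors: the event `S g = 0` has weight `‖S g‖² = 0`. -/
lemma IsGaussianFactor.ae_norm_eq_one (h : IsGaussianFactor σ S lam) :
    ∀ᵐ ψ ∂scroogeEnsemble σ, ‖ψ‖ = 1 := by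
  have hm : Measurable fun g => ENNReal.ofReal (imageNormSq S g) :=
    (continuous_imageNormSq S).measurable.ennreal_ofReal
  rw [h.ensemble_eq, ae_map_iff (measurable_normalizedImage S).aemeasurable
    (measurableSet_eq_fun measurable_norm measurable_const), ae_withDensity_iff hm]
  refine .of_forall fun g hg => ?_
  have h0 : ‖(WithLp.toLp 2 (S *ᵥ g.ofLp) : EuclideanSpace ℂ ι)‖ ≠ 0 := by
    intro h0
    rw [← norm_toLp_mulVec_sq, h0] at hg
    simp at hg
  rw [normalizedImage, norm_smul, Complex.norm_real, norm_inv, norm_norm, inv_mul_cancel₀ h0]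

lemma IsGaussianFactor.ae_norm_le_one (h : IsGaussianFactor σ S lam) :
    ∀ᵐ ψ ∂scroogeEnsemble σ, ‖ψ‖ ≤ 1 :=
  h.ae_norm_eq_one.mono fun _ h => h.le

end

/-- Homogeneous polynomials of degree `n` in the coordinates of a state vector, written as
contractions of `Ψ ^ ⊗n` with a fixed tensor. -/
def IsTensorForm (n : ℕ) (h : EuclideanSpace ℂ ι → ℂ) : Prop :=
  ∃ a : (Fin n → ι) → ℂ, ∀ Ψ, h Ψ = ∑ x, a x * ∏ j, Ψ (x j)

namespace IsTensorForm

lemma one : IsTensorForm 0 (fun _ : EuclideanSpace ℂ ι => (1 : ℂ)) :=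
  ⟨fun _ => 1, fun Ψ => by simp⟩

lemma zero (n : ℕ) : IsTensorForm n (fun _ : EuclideanSpace ℂ ι => (0 : ℂ)) :=
  ⟨fun _ => 0, fun Ψ => by simp⟩

lemma add {n : ℕ} {h₁ h₂ : EuclideanSpace ℂ ι → ℂ} (H₁ : IsTensorForm n h₁)
    (H₂ : IsTensorForm n h₂) : IsTensorForm n (fun Ψ => h₁ Ψ + h₂ Ψ) := by
  obtain ⟨a, ha⟩ := H₁
  obtain ⟨b, hb⟩ := H₂
  exact ⟨fun x => a x + b x, fun Ψ => by simp [ha, hb, add_mul, Finset.sum_add_distrib]⟩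

lemma const_mul {n : ℕ} {h : EuclideanSpace ℂ ι → ℂ} (H : IsTensorForm n h) (c : ℂ) :
    IsTensorForm n (fun Ψ => c * h Ψ) := by
  obtain ⟨a, ha⟩ := H
  exact ⟨fun x => c * a x, fun Ψ => by simp [ha, Finset.mul_sum, mul_assoc]⟩

lemma sub {n : ℕ} {h₁ h₂ : EuclideanSpace ℂ ι → ℂ} (H₁ : IsTensorForm n h₁)
    (H₂ : IsTensorForm n h₂) : IsTensorForm n (fun Ψ => h₁ Ψ - h₂ Ψ) := by
  simpa [sub_eq_add_neg] using H₁.add (H₂.const_mul (-1))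

lemma sum {n : ℕ} {J : Type*} (s : Finset J) {h : J → EuclideanSpace ℂ ι → ℂ}
    (H : ∀ j, IsTensorForm n (h j)) : IsTensorForm n (fun Ψ => ∑ j ∈ s, h j Ψ) := by
  classical
  induction s using Finset.induction_on with
  | empty => simpa using zero n
  | insert j s hj ih => simpa [Finset.sum_insert hj] using (H j).add ih

lemma mul {m n : ℕ} {h₁ h₂ : EuclideanSpace ℂ ι → ℂ} (H₁ : IsTensorForm m h₁)
    (H₂ : IsTensorForm n h₂) : IsTensorForm (m + n) (fun Ψ => h₁ Ψ * h₂ Ψ) := by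
  obtain ⟨a, ha⟩ := H₁
  obtain ⟨b, hb⟩ := H₂
  refine ⟨fun x => a (fun i => x (Fin.castAdd n i)) * b (fun i => x (Fin.natAdd m i)), fun Ψ => ?_⟩
  change h₁ Ψ * h₂ Ψ = _
  rw [ha, hb, Finset.sum_mul_sum, ← Fintype.sum_prod_type', ← (Fin.appendEquiv m n).sum_comp]
  refine Finset.sum_congr rfl fun x _ => ?_
  rw [Fin.prod_univ_add]
  simp [Fin.appendEquiv]
  ring

lemma prod {k : ℕ} {h : Fin k → EuclideanSpace ℂ ι → ℂ} (H : ∀ j, IsTensorForm 1 (h j)) :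
    IsTensorForm k (fun Ψ => ∏ j, h j Ψ) := by
  induction k with
  | zero => simpa using one
  | succ k ih =>
    simp_rw [Fin.prod_univ_castSucc]
    exact (ih fun j => H _).mul (H _)

lemma linear (a : ι → ℂ) : IsTensorForm 1 (fun Ψ : EuclideanSpace ℂ ι => ∑ i, a i * Ψ i) := by
  refine ⟨fun x => a (x 0), fun Ψ => ?_⟩
  rw [← Equiv.sum_comp (Equiv.funUnique (Fin 1) ι).symm]
  simp

lemma continuous {n : ℕ} {h : EuclideanSpace ℂ ι → ℂ} (H : IsTensorForm n h) : Continuous h := by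
  obtain ⟨a, ha⟩ := H
  rw [funext ha]
  fun_prop

lemma smul {n : ℕ} {h : EuclideanSpace ℂ ι → ℂ} (H : IsTensorForm n h) (c : ℂ)
    (Ψ : EuclideanSpace ℂ ι) : h (c • Ψ) = c ^ n * h Ψ := by
  obtain ⟨a, ha⟩ := H
  rw [ha, ha, Finset.mul_sum]
  refine Finset.sum_congr rfl fun x _ => ?_
  simp [Finset.prod_mul_distrib]
  ring

end IsTensorForm

/-- Sums of squared moduli of homogeneous polynomials of degree `n`. These are the functions
`⟨Ψ^⊗n|Q|Ψ^⊗n⟩` with `Q` positive semidefinite, whose averages a relative-error design controls. -/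
def IsSquareSum (n : ℕ) (f : EuclideanSpace ℂ ι → ℝ) : Prop :=
  ∃ (J : Type) (_ : Fintype J) (h : J → EuclideanSpace ℂ ι → ℂ),
    (∀ j, IsTensorForm n (h j)) ∧ ∀ Ψ, f Ψ = ∑ j, ‖h j Ψ‖ ^ 2

lemma IsTensorForm.isSquareSum {n : ℕ} {h : EuclideanSpace ℂ ι → ℂ} (H : IsTensorForm n h) :
    IsSquareSum n (fun Ψ => ‖h Ψ‖ ^ 2) :=
  ⟨Unit, inferInstance, fun _ => h, fun _ => H, fun Ψ => by simp⟩

namespace IsSquareSum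

lemma nonneg {n : ℕ} {f : EuclideanSpace ℂ ι → ℝ} (H : IsSquareSum n f) (Ψ) : 0 ≤ f Ψ := by
  obtain ⟨J, _, h, -, hf⟩ := H
  rw [hf]; positivity

lemma continuous {n : ℕ} {f : EuclideanSpace ℂ ι → ℝ} (H : IsSquareSum n f) : Continuous f := by
  obtain ⟨J, _, h, hh, hf⟩ := H
  rw [funext hf]
  have := fun j => (hh j).continuous
  fun_prop

lemma smul {n : ℕ} {f : EuclideanSpace ℂ ι → ℝ} (H : IsSquareSum n f) (c : ℂ)
    (Ψ : EuclideanSpace ℂ ι) : f (c • Ψ) = (‖c‖ ^ 2) ^ n * f Ψ := by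
  obtain ⟨J, _, h, hh, hf⟩ := H
  rw [hf, hf, Finset.mul_sum]
  refine Finset.sum_congr rfl fun j _ => ?_
  rw [(hh j).smul, norm_mul, norm_pow]
  ring

lemma one : IsSquareSum 0 (fun _ : EuclideanSpace ℂ ι => (1 : ℝ)) := by
  simpa using IsTensorForm.one.isSquareSum (ι := ι)

lemma sum {n : ℕ} {J : Type} [Fintype J] {f : J → EuclideanSpace ℂ ι → ℝ}
    (H : ∀ j, IsSquareSum n (f j)) : IsSquareSum n (fun Ψ => ∑ j, f j Ψ) := by
  choose K hK h hh hf using H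
  refine ⟨Σ j, K j, inferInstance, fun p => h p.1 p.2, fun p => hh p.1 p.2, fun Ψ => ?_⟩
  rw [Fintype.sum_sigma]
  exact Finset.sum_congr rfl fun j _ => hf j Ψ

lemma mul {m n : ℕ} {f₁ f₂ : EuclideanSpace ℂ ι → ℝ} (H₁ : IsSquareSum m f₁)
    (H₂ : IsSquareSum n f₂) : IsSquareSum (m + n) (fun Ψ => f₁ Ψ * f₂ Ψ) := by
  obtain ⟨J₁, _, h₁, hh₁, hf₁⟩ := H₁
  obtain ⟨J₂, _, h₂, hh₂, hf₂⟩ := H₂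
  refine ⟨J₁ × J₂, inferInstance, fun p Ψ => h₁ p.1 Ψ * h₂ p.2 Ψ,
    fun p => (hh₁ p.1).mul (hh₂ p.2), fun Ψ => ?_⟩
  change f₁ Ψ * f₂ Ψ = _
  rw [hf₁, hf₂, Finset.sum_mul_sum, ← Fintype.sum_prod_type']
  refine Finset.sum_congr rfl fun p _ => ?_
  rw [norm_mul, mul_pow]

lemma pow {m : ℕ} {f : EuclideanSpace ℂ ι → ℝ} (H : IsSquareSum m f) (n : ℕ) :
    IsSquareSum (m * n) (fun Ψ => f Ψ ^ n) := by
  induction n with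
  | zero => simpa using one
  | succ n ih => simpa [pow_succ, mul_add] using ih.mul H

lemma const_mul {n : ℕ} {f : EuclideanSpace ℂ ι → ℝ} (H : IsSquareSum n f) {c : ℝ} (hc : 0 ≤ c) :
    IsSquareSum n (fun Ψ => c * f Ψ) := by
  obtain ⟨J, _, h, hh, hf⟩ := H
  refine ⟨J, inferInstance, fun j Ψ => (Real.sqrt c : ℂ) * h j Ψ, fun j => (hh j).const_mul _,
    fun Ψ => ?_⟩
  change c * f Ψ = _
  rw [hf, Finset.mul_sum]
  refine Finset.sum_congr rfl fun j _ => ?_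
  rw [norm_mul, mul_pow, Complex.norm_real, Real.norm_of_nonneg (Real.sqrt_nonneg _),
    Real.sq_sqrt hc]

lemma norm_sq : IsSquareSum 1 (fun Ψ : EuclideanSpace ℂ ι => ‖Ψ‖ ^ 2) := by
  classical
  have e : (fun Ψ : EuclideanSpace ℂ ι => ‖Ψ‖ ^ 2)
      = fun Ψ => ∑ i : Fin (Fintype.card ι), ‖Ψ ((Fintype.equivFin ι).symm i)‖ ^ 2 := by
    funext Ψ
    rw [EuclideanSpace.norm_sq_eq, (Fintype.equivFin ι).symm.sum_comp (fun i => ‖Ψ i‖ ^ 2)]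
  rw [e]
  refine sum fun i => IsTensorForm.isSquareSum ?_
  simpa [Pi.single_apply] using
    IsTensorForm.linear (Pi.single ((Fintype.equivFin ι).symm i) (1 : ℂ))

/-- Multiplication by a power of `‖Ψ‖²` raises the degree without changing the values on unit
vectors. -/
lemma raise_degree {m n : ℕ} {f : EuclideanSpace ℂ ι → ℝ} (H : IsSquareSum m f) (h : m ≤ n) :
    IsSquareSum n (fun Ψ => f Ψ * (‖Ψ‖ ^ 2) ^ (n - m)) := by
  have := H.mul (norm_sq.pow (n - m))
  rwa [one_mul, Nat.add_sub_cancel' h] at this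

end IsSquareSum

lemma norm_sq_sum_mul_prod {n : ℕ} (a : (Fin n → ι) → ℂ) (Ψ : EuclideanSpace ℂ ι) :
    ((‖∑ x, a x * ∏ j, Ψ (x j)‖ ^ 2 : ℝ) : ℂ)
      = ∑ x, ∑ y, a x * star (a y) * tensorPow n (ketBra Ψ) x y := by
  rw [← Complex.normSq_eq_norm_sq, ← Complex.mul_conj, map_sum, Finset.sum_mul_sum]
  refine Finset.sum_congr rfl fun x _ => Finset.sum_congr rfl fun y _ => ?_
  simp [tensorPow, ketBra, Finset.prod_mul_distrib]
  ring

lemma integral_norm_sq_sum_mul_prod {n : ℕ} {μ : Measure (EuclideanSpace ℂ ι)}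
    [IsFiniteMeasure μ] (hμ : ∀ᵐ x ∂μ, ‖x‖ ≤ 1) (a : (Fin n → ι) → ℂ) :
    ((∫ Ψ, ‖∑ x, a x * ∏ j, Ψ (x j)‖ ^ 2 ∂μ : ℝ) : ℂ)
      = star (star a) ⬝ᵥ (ensembleMoment n μ *ᵥ star a) := by
  rw [← integral_complex_ofReal]
  simp_rw [norm_sq_sum_mul_prod]
  have hi := fun x y : Fin n → ι =>
    (integrable_of_ae_norm_le_one hμ (continuous_tensorPow_ketBra n x y))
  rw [integral_finsetSum _ fun x _ => integrable_finsetSum _ fun y _ => (hi x y).const_mul _]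
  simp only [dotProduct, mulVec, star_star, Finset.mul_sum]
  refine Finset.sum_congr rfl fun x _ => ?_
  rw [integral_finsetSum _ fun y _ => (hi x y).const_mul _]
  refine Finset.sum_congr rfl fun y _ => ?_
  rw [integral_const_mul, ensembleMoment, of_apply, Pi.star_apply]
  ring

/-- A relative-error design reproduces the averages of sums of squares up to the same relative
error. -/
lemma IsScroogeDesign.integral_isSquareSum [DecidableEq ι] {σ : Matrix ι ι ℂ}
    (hσ : IsDensityMatrix σ) {n : ℕ} {ε : ℝ} {μ : Measure (EuclideanSpace ℂ ι)}
    (hμ : IsScroogeDesign σ n ε μ) {f : EuclideanSpace ℂ ι → ℝ} (hf : IsSquareSum n f) :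
    (1 - ε) * ∫ ψ, f ψ ∂scroogeEnsemble σ ≤ ∫ ψ, f ψ ∂μ ∧
      ∫ ψ, f ψ ∂μ ≤ (1 + ε) * ∫ ψ, f ψ ∂scroogeEnsemble σ := by
  obtain ⟨⟨hp, hae⟩, hlo, hhi⟩ := hμ
  obtain ⟨S, lam, hS⟩ := exists_isGaussianFactor hσ
  have hps := hS.isProbabilityMeasure
  have haes := hS.ae_norm_le_one
  have hae' : ∀ᵐ ψ ∂μ, ‖ψ‖ ≤ 1 := hae.mono fun _ h => h.le
  obtain ⟨J, _, h, hh, hf⟩ := hf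
  choose a ha using hh
  simp_rw [hf]
  have hi1 := fun j => integrable_of_ae_norm_le_one hae'
    (show Continuous fun Ψ => ‖h j Ψ‖ ^ 2 by
      have : Continuous (h j) := IsTensorForm.continuous ⟨a j, ha j⟩
      fun_prop)
  have hi2 := fun j => integrable_of_ae_norm_le_one haes
    (show Continuous fun Ψ => ‖h j Ψ‖ ^ 2 by
      have : Continuous (h j) := IsTensorForm.continuous ⟨a j, ha j⟩
      fun_prop)
  rw [integral_finsetSum _ fun j _ => hi1 j, integral_finsetSum _ fun j _ => hi2 j,
    Finset.mul_sum, Finset.mul_sum]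
  have key : ∀ j, (1 - ε) * ∫ ψ, ‖h j ψ‖ ^ 2 ∂scroogeEnsemble σ ≤ ∫ ψ, ‖h j ψ‖ ^ 2 ∂μ ∧
      ∫ ψ, ‖h j ψ‖ ^ 2 ∂μ ≤ (1 + ε) * ∫ ψ, ‖h j ψ‖ ^ 2 ∂scroogeEnsemble σ := by
    intro j
    simp_rw [ha]
    have e1 := integral_norm_sq_sum_mul_prod hae' (a j)
    have e2 := integral_norm_sq_sum_mul_prod haes (a j)
    have l1 := hlo.dotProduct_mulVec_nonneg (star (a j))
    have l2 := hhi.dotProduct_mulVec_nonneg (star (a j))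
    rw [sub_mulVec, dotProduct_sub, smul_mulVec, dotProduct_smul, scroogeMoment, ← e1, ← e2,
      smul_eq_mul, ← Complex.ofReal_mul, ← Complex.ofReal_sub, Complex.zero_le_real] at l1 l2
    constructor <;> linarith
  exact ⟨Finset.sum_le_sum fun j _ => (key j).1, Finset.sum_le_sum fun j _ => (key j).2⟩

/-- Averages of sums of squares over the Scrooge ensemble, as Gaussian averages. -/
lemma IsGaussianFactor.integral_isSquareSum [DecidableEq ι] {σ S : Matrix ι ι ℂ} {lam : ι → ℝ}
    (h : IsGaussianFactor σ S lam) {n : ℕ} {f : EuclideanSpace ℂ ι → ℝ}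
    (hf : IsSquareSum (n + 1) f) :
    ∫ ψ, f ψ ∂scroogeEnsemble σ
      = ∫ g, (imageNormSq S g)⁻¹ ^ n * f (WithLp.toLp 2 (S *ᵥ g.ofLp)) ∂stdGaussian ι := by
  rw [h.integral_scrooge hf.continuous.stronglyMeasurable]
  refine integral_congr_ae (.of_forall fun g => ?_)
  simp only
  rw [normalizedImage, hf.smul, smul_eq_mul, Complex.norm_real, norm_inv, norm_norm, inv_pow,
    norm_toLp_mulVec_sq]
  by_cases h0 : imageNormSq S g = 0
  · have hz : (WithLp.toLp 2 (S *ᵥ g.ofLp) : EuclideanSpace ℂ ι) = (0 : ℂ) • 0 := by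
      rw [← norm_toLp_mulVec_sq, sq_eq_zero_iff, norm_eq_zero] at h0
      rw [h0, smul_zero]
    rw [hz, hf.smul, norm_zero]
    simp
  · rw [pow_succ]
    field_simp

end

/-! ### Duality for the trace norm -/

section
variable {ι : Type*} [Fintype ι]

/-- For Hermitian `X` the trace norm is attained as `Re Tr(W X)` with `W` the unitary sign
of `X`. -/
lemma exists_unitary_traceNorm_eq [DecidableEq ι] {X : Matrix ι ι ℂ} (hX : X.IsHermitian) :
    ∃ W : Matrix ι ι ℂ, Wᴴ * W = 1 ∧ traceNorm X = (W * X).trace.re := by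
  let U : Matrix ι ι ℂ := hX.eigenvectorUnitary
  let l := hX.eigenvalues
  have hUU : Uᴴ * U = 1 := mem_unitaryGroup_iff'.1 hX.eigenvectorUnitary.2
  have hUU' : U * Uᴴ = 1 := mem_unitaryGroup_iff.1 hX.eigenvectorUnitary.2
  have hspec : X = U * diagonal (fun i => (l i : ℂ)) * Uᴴ := by
    conv_lhs => rw [hX.spectral_theorem]
    rw [Unitary.conjStarAlgAut_apply]
    simp [U, l, star_eq_conjTranspose, Function.comp_def]
  have hconj : ∀ a b : ι → ℂ, (U * diagonal a * Uᴴ) * (U * diagonal b * Uᴴ)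
      = U * diagonal (fun i => a i * b i) * Uᴴ := fun a b => by
    rw [← diagonal_mul_diagonal]
    calc (U * diagonal a * Uᴴ) * (U * diagonal b * Uᴴ)
        = U * diagonal a * (Uᴴ * U) * diagonal b * Uᴴ := by simp only [Matrix.mul_assoc]
      _ = _ := by rw [hUU, Matrix.mul_one]; simp only [Matrix.mul_assoc]
  have hstar : ∀ a : ι → ℂ, (U * diagonal a * Uᴴ)ᴴ = U * diagonal (star a) * Uᴴ := fun a => by
    rw [conjTranspose_mul, conjTranspose_mul, conjTranspose_conjTranspose, diagonal_conjTranspose,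
      Matrix.mul_assoc]
  let A : Matrix ι ι ℂ := U * diagonal (fun i => ((|l i| : ℝ) : ℂ)) * Uᴴ
  let s : ι → ℂ := fun i => if 0 ≤ l i then 1 else -1
  have hA0 : A.PosSemidef := by
    refine PosSemidef.mul_mul_conjTranspose_same (PosSemidef.diagonal fun i => ?_) U
    simp
  have hsqrt : CFC.sqrt (Xᴴ * X) = A := by
    refine CFC.sqrt_unique ?_ hA0.nonneg
    rw [hX.eq, hspec, hconj, hconj]
    congr 3
    funext i
    rw [← Complex.ofReal_mul, ← Complex.ofReal_mul, abs_mul_abs_self]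
  refine ⟨U * diagonal s * Uᴴ, ?_, ?_⟩
  · rw [hstar, hconj]
    have : (fun i => star s i * s i) = fun _ => (1 : ℂ) := by
      funext i
      simp only [s, Pi.star_apply]
      split_ifs <;> simp
    rw [this, diagonal_one, Matrix.mul_one, hUU']
  · rw [traceNorm, hsqrt, hspec, hconj]
    have h : (fun i => ((|l i| : ℝ) : ℂ)) = fun i => s i * l i := by
      funext i
      simp only [s]
      split_ifs with h
      · rw [abs_of_nonneg h, one_mul]
      · rw [abs_of_neg (not_le.1 h)]; simp
    rw [← h]

open scoped Matrix.Norms.L2Operator in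
lemma continuous_traceNorm [DecidableEq ι] : Continuous fun X : Matrix ι ι ℂ => traceNorm X := by
  have h : Continuous fun X : Matrix ι ι ℂ => CFC.sqrt (Xᴴ * X) :=
    CFC.continuousOn_sqrt.comp_continuous (by fun_prop)
      (fun X => (posSemidef_conjTranspose_mul_self X).nonneg)
  exact Complex.continuous_re.comp h.matrix_trace

lemma sum_norm_sq_of_unitary [DecidableEq ι] {W : Matrix ι ι ℂ} (hW : Wᴴ * W = 1) :
    ∑ i, ∑ j, ‖W i j‖ ^ 2 = Fintype.card ι := by
  rw [← hsNorm_sq, hsNorm, hW, Real.sq_sqrt] <;> simp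

lemma norm_trace_mul_le_of_unitary [DecidableEq ι] {W : Matrix ι ι ℂ} (hW : Wᴴ * W = 1)
    (Y : Matrix ι ι ℂ) : ‖(W * Y).trace‖ ≤ Real.sqrt (Fintype.card ι) * hsNorm Y := by
  have h1 : ‖(W * Y).trace‖ ≤ ∑ p : ι × ι, ‖W p.1 p.2‖ * ‖Y p.2 p.1‖ := by
    rw [Fintype.sum_prod_type]
    simp only [Matrix.trace, Matrix.diag, Matrix.mul_apply]
    refine (norm_sum_le _ _).trans (Finset.sum_le_sum fun i _ => (norm_sum_le _ _).trans_eq ?_)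
    simp
  refine h1.trans ((Real.sum_mul_le_sqrt_mul_sqrt _ _ _).trans_eq ?_)
  rw [Fintype.sum_prod_type, Fintype.sum_prod_type, sum_norm_sq_of_unitary hW, Finset.sum_comm]
  change _ * Real.sqrt (∑ i, ∑ j, ‖Y i j‖ ^ 2) = _
  rw [← hsNorm_sq, Real.sqrt_sq (hsNorm_nonneg Y)]

lemma norm_trace_mul_tensorPow_ketBra_le [DecidableEq ι] {k : ℕ}
    {W : Matrix (Fin k → ι) (Fin k → ι) ℂ} (hW : Wᴴ * W = 1) (v : EuclideanSpace ℂ ι) :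
    ‖(W * tensorPow k (ketBra v)).trace‖ ≤ (‖v‖ ^ 2) ^ k := by
  let a : EuclideanSpace ℂ (Fin k → ι) := WithLp.toLp 2 fun x => ∏ j, v (x j)
  have ha : ‖a‖ ^ 2 = (‖v‖ ^ 2) ^ k := by
    rw [EuclideanSpace.norm_sq_eq, EuclideanSpace.norm_sq_eq, Fintype.sum_pow]
    simp [a, Finset.prod_pow]
  have hWa : ‖(WithLp.toLp 2 (W *ᵥ a.ofLp) : EuclideanSpace ℂ (Fin k → ι))‖ ^ 2 = ‖a‖ ^ 2 := by
    rw [norm_toLp_mulVec_sq, imageNormSq_eq_of_diagonal (lam := fun _ => 1) (by simp [hW]),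
      EuclideanSpace.norm_sq_eq]
    simp
  have hWa' : ‖(WithLp.toLp 2 (W *ᵥ a.ofLp) : EuclideanSpace ℂ (Fin k → ι))‖ = ‖a‖ :=
    (pow_left_inj₀ (norm_nonneg _) (norm_nonneg _) two_ne_zero).1 hWa
  have h : (W * tensorPow k (ketBra v)).trace = inner ℂ a (WithLp.toLp 2 (W *ᵥ a.ofLp)) := by
    simp only [Matrix.trace, Matrix.diag, Matrix.mul_apply, PiLp.inner_apply, mulVec, dotProduct,
      tensorPow, ketBra, of_apply, a, Finset.prod_mul_distrib]
    refine Finset.sum_congr rfl fun x _ => ?_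
    rw [RCLike.inner_apply, Finset.sum_mul]
    refine Finset.sum_congr rfl fun y _ => ?_
    simp
    ring
  rw [h, ← ha, sq]
  refine (norm_inner_le_norm _ _).trans_eq ?_
  rw [hWa']

end

/-! ### Block-mixing pairings in Wick's formula -/

lemma Fintype.prod_ite_eq_mul_pow {J R : Type*} [Fintype J] [DecidableEq J] [CommMonoid R]
    (i₀ : J) (A B : R) :
    ∏ i, (if i = i₀ then A else B) = A * B ^ (Fintype.card J - 1) := by
  rw [← Finset.mul_prod_erase _ _ (Finset.mem_univ i₀), if_pos rfl]
  congr 1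
  rw [Finset.prod_congr rfl fun i hi => if_neg (Finset.ne_of_mem_erase hi), Finset.prod_const,
    Finset.card_erase_of_mem (Finset.mem_univ _), Finset.card_univ]

lemma Fintype.sum_prod_apply {J α R : Type*} [Fintype J] [DecidableEq J] [Fintype α]
    [CommSemiring R] (h : J → α → R) :
    ∑ a : J → α, ∏ i, h i (a i) = ∏ i, ∑ x, h i x := by
  rw [Finset.prod_univ_sum, Fintype.piFinset_univ]

/-- A Cauchy-Schwarz bound for a sum over colourings in which the colours at two (possibly equal)
places are coupled by `M`. -/
lemma sum_norm_mul_prod_le {J α : Type*} [Fintype J] [DecidableEq J] [Fintype α] (i₀ i₁ : J)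
    (M : α → α → ℂ) (u v : α → ℝ) (hu : ∀ x, 0 ≤ u x) (hv : ∀ x, 0 ≤ v x) :
    ∑ a : J → α, ‖M (a i₀) (a i₁)‖ * (∏ i, if i = i₀ then 1 else u (a i))
        * (∏ i, if i = i₁ then 1 else v (a i))
      ≤ Real.sqrt ((Fintype.card α) ^ (Fintype.card J) * (∑ x, ∑ y, ‖M x y‖ ^ 2)
          * ((∑ x, u x ^ 2) * ∑ x, v x ^ 2) ^ (Fintype.card J - 1)) := by
  have hcard : 0 < Fintype.card J := Fintype.card_pos_iff.2 ⟨i₀⟩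
  set n := Fintype.card J - 1 with hn
  have hn1 : Fintype.card J = n + 1 := by omega
  set Qu := ∑ x, u x ^ 2
  set Qv := ∑ x, v x ^ 2
  have hQu : 0 ≤ Qu := Finset.sum_nonneg fun x _ => sq_nonneg _
  have hQv : 0 ≤ Qv := Finset.sum_nonneg fun x _ => sq_nonneg _
  have hvle : ∀ x, v x ≤ Real.sqrt Qv := fun x => by
    refine Real.le_sqrt_of_sq_le ?_
    exact Finset.single_le_sum (f := fun x => v x ^ 2) (fun x _ => sq_nonneg _) (Finset.mem_univ x)
  have h1 : ∀ a : J → α, (∏ i, if i = i₁ then 1 else v (a i)) ≤ Real.sqrt Qv ^ n := fun a => by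
    have := Fintype.prod_ite_eq_mul_pow i₁ (1 : ℝ) (Real.sqrt Qv)
    rw [one_mul] at this
    rw [← this]
    refine Finset.prod_le_prod (fun i _ => ?_) fun i _ => ?_
    · split_ifs <;> simp [hv]
    · split_ifs <;> simp [hvle]
  have hPu0 : ∀ a : J → α, 0 ≤ ∏ i, if i = i₀ then 1 else u (a i) := fun a =>
    Finset.prod_nonneg fun i _ => by split_ifs <;> simp [hu]
  have hPu : ∑ a : J → α, (∏ i, if i = i₀ then 1 else u (a i)) ^ 2
      = Fintype.card α * Qu ^ n := by
    have e : ∀ a : J → α, (∏ i, if i = i₀ then 1 else u (a i)) ^ 2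
        = ∏ i, (if i = i₀ then 1 else u (a i) ^ 2) := fun a => by
      rw [← Finset.prod_pow]
      exact Finset.prod_congr rfl fun i _ => by split_ifs <;> simp
    simp_rw [e]
    rw [Fintype.sum_prod_apply (fun i x => if i = i₀ then (1 : ℝ) else u x ^ 2),
      ← Fintype.prod_ite_eq_mul_pow i₀]
    exact Finset.prod_congr rfl fun i _ => by split_ifs <;> simp [Qu]
  have hM : ∑ a : J → α, ‖M (a i₀) (a i₁)‖ ^ 2
      ≤ (Fintype.card α) ^ n * ∑ x, ∑ y, ‖M x y‖ ^ 2 := by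
    calc ∑ a : J → α, ‖M (a i₀) (a i₁)‖ ^ 2
        ≤ ∑ a : J → α, ∏ i, (if i = i₀ then ∑ y, ‖M (a i) y‖ ^ 2 else 1) := by
          refine Finset.sum_le_sum fun a _ => ?_
          rw [Finset.prod_ite_eq' Finset.univ i₀ (fun i => ∑ y, ‖M (a i) y‖ ^ 2),
            if_pos (Finset.mem_univ _)]
          exact Finset.single_le_sum (f := fun y => ‖M (a i₀) y‖ ^ 2) (fun x _ => sq_nonneg _)
            (Finset.mem_univ _)
      _ = _ := by
          rw [Fintype.sum_prod_apply (fun i x => if i = i₀ then ∑ y, ‖M x y‖ ^ 2 else (1 : ℝ)),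
            mul_comm, hn, ← Fintype.prod_ite_eq_mul_pow i₀]
          exact Finset.prod_congr rfl fun i _ => by split_ifs <;> simp
  have hCS := Real.sum_mul_le_sqrt_mul_sqrt Finset.univ (fun a : J → α => ‖M (a i₀) (a i₁)‖)
    (fun a => ∏ i, if i = i₀ then 1 else u (a i))
  calc _ ≤ ∑ a : J → α, ‖M (a i₀) (a i₁)‖ * (∏ i, if i = i₀ then 1 else u (a i))
        * Real.sqrt Qv ^ n :=
        Finset.sum_le_sum fun a _ => mul_le_mul_of_nonneg_left (h1 a)
          (mul_nonneg (norm_nonneg _) (hPu0 a))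
    _ ≤ Real.sqrt ((Fintype.card α) ^ n * ∑ x, ∑ y, ‖M x y‖ ^ 2)
          * Real.sqrt (Fintype.card α * Qu ^ n) * Real.sqrt (Qv ^ n) := by
        rw [← Finset.sum_mul, Real.sqrt_eq_rpow (Qv ^ n), ← Real.rpow_natCast_mul hQv,
          mul_comm (n : ℝ), Real.rpow_mul_natCast hQv, ← Real.sqrt_eq_rpow]
        refine mul_le_mul_of_nonneg_right (hCS.trans ?_) (by positivity)
        rw [hPu]
        exact mul_le_mul_of_nonneg_right (Real.sqrt_le_sqrt hM) (Real.sqrt_nonneg _)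
    _ = _ := by
        rw [← Real.sqrt_mul (by positivity), ← Real.sqrt_mul (by positivity), hn1]
        congr 1
        rw [mul_pow]
        ring

/-- A permutation of `Fin k ⊕ Fin k` that does not preserve the two blocks moves some element of
each block to the other block. -/
lemma exists_crossing {k : ℕ} {π : Equiv.Perm (Fin k ⊕ Fin k)}
    (hπ : π ∉ (Equiv.Perm.sumCongrHom (Fin k) (Fin k)).range) :
    ∃ i₀ i₀' i₁ i₁', π (Sum.inl i₀) = Sum.inr i₀' ∧ π (Sum.inr i₁) = Sum.inl i₁' := by
  have h0 : ∃ i₀ i₀', π (Sum.inl i₀) = Sum.inr i₀' := by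
    by_contra! h
    refine hπ (Equiv.Perm.mem_sumCongrHom_range_of_perm_mapsTo_inl ?_)
    rintro _ ⟨i, rfl⟩
    cases hi : π (Sum.inl i) with
    | inl j => exact ⟨j, rfl⟩
    | inr j => exact absurd hi (h i j)
  have h1 : ∃ i₁ i₁', π (Sum.inr i₁) = Sum.inl i₁' := by
    -- otherwise `π` maps the right block onto itself, hence also the left one
    by_contra! h
    have hr : ∀ i, ∃ j, π (Sum.inr i) = Sum.inr j := fun i => by
      cases hi : π (Sum.inr i) with
      | inl j => exact absurd hi (h i j)
      | inr j => exact ⟨j, rfl⟩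
    choose f hf using hr
    have hinj : Function.Injective f := fun a b hab => by
      have : π (Sum.inr a) = π (Sum.inr b) := by rw [hf, hf, hab]
      exact Sum.inr_injective (π.injective this)
    have hsurj := Finite.surjective_of_injective hinj
    obtain ⟨i₀, i₀', h0⟩ := h0
    obtain ⟨j, hj⟩ := hsurj i₀'
    have : π (Sum.inr j) = π (Sum.inl i₀) := by rw [hf, hj, h0]
    exact absurd (π.injective this) (by simp)
  obtain ⟨i₀, i₀', h0⟩ := h0
  obtain ⟨i₁, i₁', h1⟩ := h1
  exact ⟨i₀, i₀', i₁, i₁', h0, h1⟩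

/-- The row and column labels of the `2k` factors of
`⟨a|(ψ_z ψ_z†)^⊗k|b⟩ ⟨b|(ψ_z' ψ_z'†)^⊗k|a⟩`: the holomorphic factors are labelled by
`pairLabel a b z z'`, the antiholomorphic ones by `pairLabel b a z z'`. -/
def pairLabel {α β : Type*} {k : ℕ} (a b : Fin k → α) (z z' : β) : Fin k ⊕ Fin k → α × β :=
  Sum.elim (fun i => (a i, z)) (fun i => (b i, z'))

/-- A block-mixing Wick pairing is controlled by the Hilbert-Schmidt norm of the off-diagonal block
of the covariance. Two of its factors, one for each direction of crossing, are entries of that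
block; all the others are bounded by diagonal entries, the covariance being positive. -/
lemma sum_norm_prod_crossing_le {α β ι : Type*} [Fintype α] [Fintype ι]
    (S : Matrix (α × β) ι ℂ) {k : ℕ} (z z' : β) {π : Equiv.Perm (Fin k ⊕ Fin k)}
    (hπ : π ∉ (Equiv.Perm.sumCongrHom (Fin k) (Fin k)).range) :
    ∑ a : Fin k → α, ∑ b : Fin k → α,
        ‖∏ j, (S * Sᴴ) (pairLabel a b z z' j) (pairLabel b a z z' (π j))‖
      ≤ Fintype.card α ^ k * (∑ x, ∑ y, ‖(S * Sᴴ) (x, z) (y, z')‖ ^ 2)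
        * ((∑ x, ((S * Sᴴ) (x, z) (x, z)).re) * ∑ x, ((S * Sᴴ) (x, z') (x, z')).re) ^ (k - 1) := by
  obtain ⟨i₀, i₀', i₁, i₁', h0, h1⟩ := exists_crossing hπ
  set τ := S * Sᴴ with hτ
  let t : α × β → ℝ := fun x => Real.sqrt (τ x x).re
  have ht0 : ∀ x, 0 ≤ t x := fun x => Real.sqrt_nonneg _
  have htsq : ∀ x, t x ^ 2 = (τ x x).re := fun x => by
    refine Real.sq_sqrt ?_
    rw [hτ, mul_conjTranspose_self_apply_self, Complex.ofReal_re]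
    positivity
  let A : (Fin k → α) → ℝ := fun a => ‖τ (a i₀, z) (a i₀', z')‖
    * (∏ i, if i = i₀ then 1 else t (a i, z)) * (∏ i, if i = i₀' then 1 else t (a i, z'))
  let B : (Fin k → α) → ℝ := fun b => ‖τ (b i₁, z') (b i₁', z)‖
    * (∏ i, if i = i₁ then 1 else t (b i, z')) * (∏ i, if i = i₁' then 1 else t (b i, z))
  have hterm : ∀ a b : Fin k → α,
      ‖∏ j, τ (pairLabel a b z z' j) (pairLabel b a z z' (π j))‖ ≤ A a * B b := by
    intro a b
    let x := pairLabel a b z z'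
    let y := pairLabel b a z z'
    -- `w` collects the two crossing factors, `u` and `v` the diagonal bounds for the others
    let w : Fin k ⊕ Fin k → ℝ := fun j =>
      if j = Sum.inl i₀ ∨ j = Sum.inr i₁ then ‖τ (x j) (y (π j))‖ else 1
    let u : Fin k ⊕ Fin k → ℝ := fun j =>
      if j = Sum.inl i₀ ∨ j = Sum.inr i₁ then 1 else t (x j)
    let v : Fin k ⊕ Fin k → ℝ := fun j =>
      if j = Sum.inr i₀' ∨ j = Sum.inl i₁' then 1 else t (y j)
    have hv : ∀ j, v (π j) = if j = Sum.inl i₀ ∨ j = Sum.inr i₁ then 1 else t (y (π j)) := by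
      intro j
      simp only [v]
      rw [← h0, ← h1]
      simp only [EmbeddingLike.apply_eq_iff_eq]
    calc ‖∏ j, τ (x j) (y (π j))‖ = ∏ j, ‖τ (x j) (y (π j))‖ := norm_prod _ _
      _ ≤ ∏ j, w j * u j * v (π j) := by
          refine Finset.prod_le_prod (fun _ _ => norm_nonneg _) fun j _ => ?_
          rw [hv]
          simp only [w, u]
          split_ifs
          · simp
          · rw [one_mul]
            exact norm_mul_conjTranspose_self_apply_le S _ _
      _ = (∏ j, w j) * (∏ j, u j) * ∏ j, v j := by
          rw [Finset.prod_mul_distrib, Finset.prod_mul_distrib, Equiv.prod_comp π v]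
      _ = A a * B b := by
          rw [Fintype.prod_sum_type w, Fintype.prod_sum_type u, Fintype.prod_sum_type v]
          simp only [w, u, v, Sum.inl.injEq, Sum.inr.injEq, reduceCtorEq, or_false, false_or,
            Finset.prod_ite_eq', Finset.mem_univ, if_true, h0, h1, x, y, pairLabel, Sum.elim_inl,
            Sum.elim_inr, A, B]
          ring
  have hMsymm : ∑ x, ∑ y, ‖τ (x, z') (y, z)‖ ^ 2 = ∑ x, ∑ y, ‖τ (x, z) (y, z')‖ ^ 2 := by
    rw [Finset.sum_comm]
    refine Finset.sum_congr rfl fun x _ => Finset.sum_congr rfl fun y _ => ?_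
    have : τ (y, z') (x, z) = star (τ (x, z) (y, z')) := by
      rw [← conjTranspose_apply, hτ, conjTranspose_mul, conjTranspose_conjTranspose]
    rw [this, norm_star]
  have hA := sum_norm_mul_prod_le i₀ i₀' (fun x y => τ (x, z) (y, z')) (fun x => t (x, z))
    (fun x => t (x, z')) (fun _ => ht0 _) (fun _ => ht0 _)
  have hB := sum_norm_mul_prod_le i₁ i₁' (fun x y => τ (x, z') (y, z)) (fun x => t (x, z'))
    (fun x => t (x, z)) (fun _ => ht0 _) (fun _ => ht0 _)
  simp only [htsq, hMsymm, Fintype.card_fin] at hA hB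
  rw [mul_comm (∑ x, (τ (x, z') (x, z')).re)] at hB
  have hre : ∀ w, 0 ≤ ∑ x, (τ (x, w) (x, w)).re := fun w =>
    Finset.sum_nonneg fun x _ => by rw [← htsq]; positivity
  have hz := hre z
  have hz' := hre z'
  have hA0 : ∀ a, 0 ≤ A a := fun a => by
    refine mul_nonneg (mul_nonneg (norm_nonneg _) ?_) ?_ <;>
    exact Finset.prod_nonneg fun i _ => by split_ifs <;> simp [ht0]
  have hB0 : ∀ a, 0 ≤ B a := fun a => by
    refine mul_nonneg (mul_nonneg (norm_nonneg _) ?_) ?_ <;>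
    exact Finset.prod_nonneg fun i _ => by split_ifs <;> simp [ht0]
  calc _ ≤ ∑ a : Fin k → α, ∑ b : Fin k → α, A a * B b :=
        Finset.sum_le_sum fun a _ => Finset.sum_le_sum fun b _ => hterm a b
    _ = (∑ a, A a) * ∑ b, B b := by rw [Finset.sum_mul_sum]
    _ ≤ _ := (mul_le_mul hA hB (Finset.sum_nonneg fun b _ => hB0 b) (Real.sqrt_nonneg _)).trans_eq
        (Real.mul_self_sqrt (by positivity))

/-- The `k`-th moment `E (ψψ†)^⊗k` of a Gaussian vector `ψ` with covariance `M`, given by Wick's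
formula. -/
def gaussianMoment {α : Type*} (k : ℕ) (M : Matrix α α ℂ) : Matrix (Fin k → α) (Fin k → α) ℂ :=
  Matrix.of fun c c' => ∑ π : Equiv.Perm (Fin k), ∏ j, M (c j) (c' (π j))

/-- The pairings that preserve both blocks factorise into the product of the two means, so that
only the block-mixing ones contribute to a covariance. -/
lemma sum_perm_sub_gaussianMoment_mul {α β : Type*} (τ : Matrix (α × β) (α × β) ℂ) {k : ℕ}
    (a b : Fin k → α) (z z' : β) :
    ∑ π : Equiv.Perm (Fin k ⊕ Fin k), ∏ j, τ (pairLabel a b z z' j) (pairLabel b a z z' (π j))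
      - gaussianMoment k (Matrix.of fun x y => τ (x, z) (y, z)) a b
        * gaussianMoment k (Matrix.of fun x y => τ (x, z') (y, z')) b a
    = ∑ π ∈ Finset.univ.filter
        (fun π => π ∉ (Equiv.Perm.sumCongrHom (Fin k) (Fin k)).range),
        ∏ j, τ (pairLabel a b z z' j) (pairLabel b a z z' (π j)) := by
  classical
  have h1 : gaussianMoment k (Matrix.of fun x y => τ (x, z) (y, z)) a b
        * gaussianMoment k (Matrix.of fun x y => τ (x, z') (y, z')) b a
      = ∑ π ∈ Finset.univ.filter
        (fun π => π ∈ (Equiv.Perm.sumCongrHom (Fin k) (Fin k)).range),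
        ∏ j, τ (pairLabel a b z z' j) (pairLabel b a z z' (π j)) := by
    rw [gaussianMoment, gaussianMoment, of_apply, of_apply, Finset.sum_mul_sum,
      ← Fintype.sum_prod_type']
    have hinj := Equiv.Perm.sumCongrHom_injective (α := Fin k) (β := Fin k)
    have himg : Finset.univ.filter
        (fun π => π ∈ (Equiv.Perm.sumCongrHom (Fin k) (Fin k)).range)
        = Finset.univ.image (Equiv.Perm.sumCongrHom (Fin k) (Fin k)) := by
      ext π
      simp [MonoidHom.mem_range]
    rw [himg, Finset.sum_image fun _ _ _ _ h => hinj h]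
    refine Finset.sum_congr rfl fun p _ => ?_
    rw [Fintype.prod_sum_type]
    simp [pairLabel]
  rw [h1, ← Finset.sum_filter_add_sum_filter_not Finset.univ
    (fun π => π ∈ (Equiv.Perm.sumCongrHom (Fin k) (Fin k)).range)]
  ring

/-! ### Gaussian moment operators -/

lemma tensorPow_ketBra_isHermitian {α : Type*} (k : ℕ) (v : EuclideanSpace ℂ α) :
    (tensorPow k (ketBra v)).IsHermitian := by
  ext c c'
  simp [tensorPow, ketBra, conjTranspose_apply, mul_comm]

section
variable {X ι : Type*} [Fintype ι]

lemma tensorPow_ketBra_mulVec [Fintype X] (S : Matrix X ι ℂ) (k : ℕ) (g : EuclideanSpace ℂ ι)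
    (c c' : Fin k → X) :
    tensorPow k (ketBra (WithLp.toLp 2 (S *ᵥ g.ofLp) : EuclideanSpace ℂ X)) c c'
      = ∏ j, (S *ᵥ g.ofLp) (c j) * star ((S *ᵥ g.ofLp) (c' j)) := rfl

lemma integrable_tensorPow_ketBra_mulVec [Fintype X] (S : Matrix X ι ℂ) (k : ℕ)
    (c c' : Fin k → X) :
    Integrable (fun g : EuclideanSpace ℂ ι =>
      tensorPow k (ketBra (WithLp.toLp 2 (S *ᵥ g.ofLp) : EuclideanSpace ℂ X)) c c')
      (stdGaussian ι) :=
  integrable_prod_linear S c c'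

lemma integral_tensorPow_ketBra_mulVec [Fintype X] (S : Matrix X ι ℂ) (k : ℕ)
    (c c' : Fin k → X) :
    ∫ g : EuclideanSpace ℂ ι,
      tensorPow k (ketBra (WithLp.toLp 2 (S *ᵥ g.ofLp) : EuclideanSpace ℂ X)) c c' ∂stdGaussian ι
      = gaussianMoment k (S * Sᴴ) c c' :=
  wick S c c'

lemma gaussianMoment_posSemidef [Fintype X] (S : Matrix X ι ℂ) (k : ℕ) :
    (gaussianMoment k (S * Sᴴ)).PosSemidef := by
  classical
  let U : EuclideanSpace ℂ ι → (Fin k → X) → ℂ := fun g c => ∏ j, (S *ᵥ g.ofLp) (c j)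
  have hU : ∀ g c c', tensorPow k (ketBra (WithLp.toLp 2 (S *ᵥ g.ofLp) : EuclideanSpace ℂ X)) c c'
      = U g c * star (U g c') := fun g c c' => by
    rw [tensorPow_ketBra_mulVec, Finset.prod_mul_distrib, star_prod]
  have hint := integrable_tensorPow_ketBra_mulVec S k
  refine PosSemidef.of_dotProduct_mulVec_nonneg ?_ fun x => ?_
  · ext c c'
    rw [conjTranspose_apply, ← integral_tensorPow_ketBra_mulVec,
      ← integral_tensorPow_ketBra_mulVec, Complex.star_def, ← integral_conj]
    refine integral_congr_ae (.of_forall fun g => ?_)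
    simp only [hU]
    simp [mul_comm]
  · have e : star x ⬝ᵥ gaussianMoment k (S * Sᴴ) *ᵥ x
        = ((∫ g, ‖∑ c, star (x c) * U g c‖ ^ 2 ∂stdGaussian ι : ℝ) : ℂ) := by
      rw [← integral_complex_ofReal]
      have h1 : ∀ g, ((‖∑ c, star (x c) * U g c‖ ^ 2 : ℝ) : ℂ)
          = ∑ c, ∑ c', star (x c) * x c' * tensorPow k
            (ketBra (WithLp.toLp 2 (S *ᵥ g.ofLp) : EuclideanSpace ℂ X)) c c' := fun g => by
        rw [← Complex.normSq_eq_norm_sq, ← Complex.mul_conj, map_sum, Finset.sum_mul_sum]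
        refine Finset.sum_congr rfl fun c _ => Finset.sum_congr rfl fun c' _ => ?_
        rw [hU]
        simp
        ring
      simp_rw [h1]
      rw [integral_finsetSum _ fun c _ => integrable_finsetSum _ fun c' _ =>
        (hint c c').const_mul _]
      simp only [dotProduct, mulVec, Finset.mul_sum]
      refine Finset.sum_congr rfl fun c _ => ?_
      rw [integral_finsetSum _ fun c' _ => (hint c c').const_mul _]
      refine Finset.sum_congr rfl fun c' _ => ?_
      rw [integral_const_mul, integral_tensorPow_ketBra_mulVec, Pi.star_apply]
      ring
    rw [e, Complex.zero_le_real]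
    exact integral_nonneg fun g => sq_nonneg _

end

/-! ### Hilbert-Schmidt geometry of Hermitian matrices -/

lemma hsNorm_sq_eq_trace {ι : Type*} [Fintype ι] {A : Matrix ι ι ℂ} (hA : A.IsHermitian) :
    ((hsNorm A ^ 2 : ℝ) : ℂ) = (A * A).trace := by
  rw [hsNorm_sq]
  simp only [Matrix.trace, Matrix.diag, Matrix.mul_apply]
  push_cast
  refine Finset.sum_congr rfl fun i _ => Finset.sum_congr rfl fun j _ => ?_
  rw [← hA.apply j i, ← Complex.mul_conj', Complex.star_def]

lemma hsNorm_sub_sq {ι : Type*} [Fintype ι] {A B : Matrix ι ι ℂ} (hA : A.IsHermitian)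
    (hB : B.IsHermitian) :
    hsNorm (A - B) ^ 2 = hsNorm A ^ 2 - 2 * (A * B).trace.re + hsNorm B ^ 2 := by
  have h := hsNorm_sq_eq_trace (hA.sub hB)
  have h2 := congrArg Complex.re h
  have hA2 := congrArg Complex.re (hsNorm_sq_eq_trace hA)
  have hB2 := congrArg Complex.re (hsNorm_sq_eq_trace hB)
  rw [Complex.ofReal_re] at h2 hA2 hB2
  rw [h2, hA2, hB2, Matrix.sub_mul, Matrix.mul_sub, Matrix.mul_sub, Matrix.trace_sub,
    Matrix.trace_sub, Matrix.trace_sub, Matrix.trace_mul_comm B A]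
  simp only [Complex.sub_re]
  ring

lemma trace_sum_smul_mul {β κ : Type*} [Fintype β] [Fintype κ] (w : β → ℝ)
    (M : β → Matrix κ κ ℂ) (G : Matrix κ κ ℂ) :
    ((∑ z, (w z : ℂ) • M z) * G).trace = ∑ z, w z * ∑ a, ∑ b, M z a b * G b a := by
  rw [Finset.sum_mul, Matrix.trace_sum]
  refine Finset.sum_congr rfl fun z _ => ?_
  rw [Matrix.smul_mul, Matrix.trace_smul, smul_eq_mul]
  rfl

lemma trace_sum_smul_mul_self {β κ : Type*} [Fintype β] [Fintype κ] (w : β → ℝ)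
    (M : β → Matrix κ κ ℂ) :
    ((∑ z, (w z : ℂ) • M z) * ∑ z, (w z : ℂ) • M z).trace
      = ∑ z, ∑ z', w z * w z' * ∑ a, ∑ b, M z a b * M z' b a := by
  rw [trace_sum_smul_mul]
  refine Finset.sum_congr rfl fun z _ => ?_
  simp only [Matrix.sum_apply, Matrix.smul_apply, smul_eq_mul, Finset.mul_sum]
  rw [Finset.sum_congr rfl fun a _ => Finset.sum_comm, Finset.sum_comm]
  refine Finset.sum_congr rfl fun z' _ => Finset.sum_congr rfl fun a _ =>
    Finset.sum_congr rfl fun b _ => ?_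
  ring

lemma isHermitian_sum_smul {β κ : Type*} [Fintype β] (w : β → ℝ)
    {M : β → Matrix κ κ ℂ} (hM : ∀ z, (M z).IsHermitian) :
    (∑ z, (w z : ℂ) • M z).IsHermitian := by
  rw [IsHermitian, conjTranspose_sum]
  refine Finset.sum_congr rfl fun z _ => ?_
  rw [conjTranspose_smul, (hM z).eq, Complex.star_def, Complex.conj_ofReal]

/-! ### Gaussian vectors on a bipartite system -/

section
variable {α β ι : Type*} [Fintype α] [Fintype β] [Fintype ι]

/-- The change of basis `I ⊗ e†` on the bipartite system, which maps a vector to its components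
in the basis `e` of the second factor. -/
noncomputable def basisChange (α : Type*) {β : Type*} [Fintype β] [DecidableEq α]
    (e : OrthonormalBasis β ℂ (EuclideanSpace ℂ β)) : Matrix (α × β) (α × β) ℂ :=
  Matrix.of fun p q => if p.1 = q.1 then star (e p.2 q.2) else 0

variable [DecidableEq α] [DecidableEq β] (e : OrthonormalBasis β ℂ (EuclideanSpace ℂ β))

lemma basisChange_mul_conjTranspose : basisChange α e * (basisChange α e)ᴴ = 1 := by
  ext p q
  have h := orthonormal_iff_ite.1 e.orthonormal p.2 q.2
  rw [PiLp.inner_apply] at h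
  simp only [RCLike.inner_apply] at h
  rw [Matrix.mul_apply, Fintype.sum_prod_type, Matrix.one_apply]
  simp only [basisChange, of_apply, conjTranspose_apply]
  rw [Finset.sum_eq_single p.1]
  · by_cases h1 : p.1 = q.1
    · simp only [if_true, h1]
      have : ∑ b, star (e p.2 b) * star (star (e q.2 b)) = if p.2 = q.2 then (1 : ℂ) else 0 := by
        rw [← h]
        refine Finset.sum_congr rfl fun b _ => ?_
        rw [star_star, mul_comm]
        rfl
      rw [this]
      simp [Prod.ext_iff, h1]
    · have : p ≠ q := fun h => h1 (by rw [h])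
      simp [this, Ne.symm h1]
  · intro a _ ha
    simp [Ne.symm ha]
  · simp

lemma basisChange_conjTranspose_mul : (basisChange α e)ᴴ * basisChange α e = 1 :=
  mul_eq_one_comm.1 (basisChange_mul_conjTranspose e)

omit [Fintype ι] [DecidableEq β] in
lemma basisChange_mul_apply (T : Matrix (α × β) ι ℂ) (a : α) (z : β) (i : ι) :
    (basisChange α e * T) (a, z) i = ∑ b, star (e z b) * T (a, b) i := by
  rw [Matrix.mul_apply, Fintype.sum_prod_type, Finset.sum_eq_single a]
  · simp [basisChange]
  · intro a' _ ha
    simp [basisChange, Ne.symm ha]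
  · simp

/-- The Gaussian factor of the conditional state of `σ = T Tᴴ` for the outcome `z`. -/
noncomputable def condFactor (T : Matrix (α × β) ι ℂ) (z : β) : Matrix α ι ℂ :=
  Matrix.of fun a i => (basisChange α e * T) (a, z) i

omit [DecidableEq β] in
lemma projVec_mulVec (T : Matrix (α × β) ι ℂ) (z : β) (g : EuclideanSpace ℂ ι) :
    projVec (e z) (WithLp.toLp 2 (T *ᵥ g.ofLp)) = WithLp.toLp 2 (condFactor e T z *ᵥ g.ofLp) := by
  rw [projVec]
  congr 1
  funext a
  simp only [mulVec, dotProduct, condFactor, of_apply, basisChange_mul_apply, Finset.mul_sum,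
    Finset.sum_mul]
  rw [Finset.sum_comm]
  simp only [mul_assoc]

omit [DecidableEq β] in
lemma condFactor_mul_conjTranspose_apply (T : Matrix (α × β) ι ℂ) (z : β) (a a' : α) :
    (condFactor e T z * (condFactor e T z)ᴴ) a a'
      = ((basisChange α e * T) * (basisChange α e * T)ᴴ) (a, z) (a', z) := rfl

omit [DecidableEq β] in
lemma condFactor_mul_conjTranspose (T : Matrix (α × β) ι ℂ) (z : β) :
    condFactor e T z * (condFactor e T z)ᴴ = condState (T * Tᴴ) (e z) := by
  ext a a'
  rw [condFactor_mul_conjTranspose_apply, condState, of_apply, conjTranspose_mul,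
    Matrix.mul_assoc, ← Matrix.mul_assoc T, basisChange_mul_apply]
  refine Finset.sum_congr rfl fun b _ => ?_
  rw [Matrix.mul_apply, Fintype.sum_prod_type, Finset.sum_eq_single a', Finset.mul_sum]
  · refine Finset.sum_congr rfl fun b' _ => ?_
    simp [basisChange, mul_assoc]
  · intro c _ hc
    simp [basisChange, Ne.symm hc]
  · simp

omit [DecidableEq α] [DecidableEq β] in
lemma trace_condState (σ : Matrix (α × β) (α × β) ℂ) (v : EuclideanSpace ℂ β) :
    (condState σ v).trace.re = expVal (reducedB σ) v := by
  rw [expVal]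
  congr 1
  simp only [Matrix.trace, Matrix.diag, condState, of_apply, reducedB, Finset.mul_sum,
    Finset.sum_mul]
  rw [Finset.sum_comm]
  refine Finset.sum_congr rfl fun b _ => ?_
  rw [Finset.sum_comm]

omit [DecidableEq β] in
lemma norm_projVec_sq (T : Matrix (α × β) ι ℂ) (z : β) (g : EuclideanSpace ℂ ι) :
    ‖projVec (e z) (WithLp.toLp 2 (T *ᵥ g.ofLp))‖ ^ 2 = imageNormSq (condFactor e T z) g := by
  rw [projVec_mulVec, norm_toLp_mulVec_sq]

lemma hsNorm_basisChange (T : Matrix (α × β) ι ℂ) :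
    hsNorm ((basisChange α e * T) * (basisChange α e * T)ᴴ) = hsNorm (T * Tᴴ) := by
  set E := basisChange α e
  have h : E * T * (E * T)ᴴ = E * (T * Tᴴ) * Eᴴ := by
    rw [conjTranspose_mul]; simp only [Matrix.mul_assoc]
  have h2 : (E * (T * Tᴴ) * Eᴴ)ᴴ * (E * (T * Tᴴ) * Eᴴ) = E * ((T * Tᴴ)ᴴ * (T * Tᴴ)) * Eᴴ := by
    calc _ = E * (T * Tᴴ)ᴴ * (Eᴴ * E) * (T * Tᴴ) * Eᴴ := by
          simp only [conjTranspose_mul, conjTranspose_conjTranspose, Matrix.mul_assoc]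
      _ = _ := by
          rw [basisChange_conjTranspose_mul, Matrix.mul_one]; simp only [Matrix.mul_assoc]
  rw [hsNorm, hsNorm, h, h2, Matrix.trace_mul_comm, ← Matrix.mul_assoc,
    basisChange_conjTranspose_mul, Matrix.one_mul]

lemma sum_expVal_reducedB (T : Matrix (α × β) ι ℂ) :
    ∑ z, expVal (reducedB (T * Tᴴ)) (e z) = (T * Tᴴ).trace.re := by
  have h : (T * Tᴴ).trace = ((basisChange α e * T) * (basisChange α e * T)ᴴ).trace := by
    rw [conjTranspose_mul, Matrix.mul_assoc, Matrix.trace_mul_comm (basisChange α e),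
      ← Matrix.mul_assoc, Matrix.mul_assoc, Matrix.mul_assoc, basisChange_conjTranspose_mul,
      Matrix.mul_one]
  rw [h]
  simp_rw [← trace_condState, ← condFactor_mul_conjTranspose]
  rw [Matrix.trace, Fintype.sum_prod_type_right, Complex.re_sum]
  rfl

/-- The weighted sum `∑_z w_z (|ψ_z⟩⟨ψ_z|)^⊗k` over the unnormalised projected states. For
`w_z = ⟨z|σ_B|z⟩^(1-k)` it is a polynomial approximation to the moment of the projected ensemble. -/
noncomputable def weightedMoment (k : ℕ) (w : β → ℝ) (Ψ : EuclideanSpace ℂ (α × β)) :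
    Matrix (Fin k → α) (Fin k → α) ℂ :=
  ∑ z, (w z : ℂ) • tensorPow k (ketBra (projVec (e z) Ψ))

omit [DecidableEq α] [DecidableEq β] [Fintype α] in
lemma weightedMoment_isHermitian (k : ℕ) (w : β → ℝ) (Ψ : EuclideanSpace ℂ (α × β)) :
    (weightedMoment e k w Ψ).IsHermitian :=
  isHermitian_sum_smul w fun _ => tensorPow_ketBra_isHermitian k _

/-- The Gaussian average of `weightedMoment`. -/
noncomputable def gaussianWeightedMoment (k : ℕ) (w : β → ℝ) (σ : Matrix (α × β) (α × β) ℂ) :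
    Matrix (Fin k → α) (Fin k → α) ℂ :=
  ∑ z, (w z : ℂ) • gaussianMoment k (condState σ (e z))

omit [DecidableEq β] in
lemma gaussianMoment_condState_posSemidef (T : Matrix (α × β) ι ℂ) (k : ℕ) (z : β) :
    (gaussianMoment k (condState (T * Tᴴ) (e z))).PosSemidef := by
  rw [← condFactor_mul_conjTranspose]
  exact gaussianMoment_posSemidef _ _

omit [DecidableEq β] in
lemma gaussianWeightedMoment_posSemidef (T : Matrix (α × β) ι ℂ) (k : ℕ) {w : β → ℝ}
    (hw : ∀ z, 0 ≤ w z) : (gaussianWeightedMoment e k w (T * Tᴴ)).PosSemidef :=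
  posSemidef_sum _ fun z _ => (gaussianMoment_condState_posSemidef e T k z).smul
    (by rw [Complex.zero_le_real]; exact hw z)

omit [DecidableEq β] in
/-- Cross term of the variance: the Gaussian average of `weightedMoment` is
`gaussianWeightedMoment`. -/
lemma integral_trace_weightedMoment_mul (T : Matrix (α × β) ι ℂ) (k : ℕ) {w : β → ℝ}
    (hw : ∀ z, 0 ≤ w z) :
    ∫ g : EuclideanSpace ℂ ι, (weightedMoment e k w (WithLp.toLp 2 (T *ᵥ g.ofLp))
        * gaussianWeightedMoment e k w (T * Tᴴ)).trace.re ∂stdGaussian ι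
      = hsNorm (gaussianWeightedMoment e k w (T * Tᴴ)) ^ 2 := by
  set G := gaussianWeightedMoment e k w (T * Tᴴ) with hG
  have hGh : G.IsHermitian := (gaussianWeightedMoment_posSemidef e T k hw).1
  have hint := fun z => integrable_tensorPow_ketBra_mulVec (condFactor e T z) k
  have h1 : ∀ g : EuclideanSpace ℂ ι, (weightedMoment e k w (WithLp.toLp 2 (T *ᵥ g.ofLp))
        * G).trace = ∑ z, w z * ∑ a, ∑ b,
          tensorPow k (ketBra (WithLp.toLp 2 (condFactor e T z *ᵥ g.ofLp))) a b * G b a := by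
    intro g
    rw [weightedMoment, trace_sum_smul_mul]
    simp_rw [projVec_mulVec]
  have hi : Integrable (fun g : EuclideanSpace ℂ ι =>
      (weightedMoment e k w (WithLp.toLp 2 (T *ᵥ g.ofLp)) * G).trace) (stdGaussian ι) := by
    simp_rw [h1]
    exact integrable_finsetSum _ fun z _ => (integrable_finsetSum _ fun a _ =>
      integrable_finsetSum _ fun b _ => (hint z a b).mul_const _).const_mul _
  have h2 : ∫ g : EuclideanSpace ℂ ι, (weightedMoment e k w (WithLp.toLp 2 (T *ᵥ g.ofLp))
        * G).trace ∂stdGaussian ι = (G * G).trace := by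
    simp_rw [h1]
    rw [integral_finsetSum _ fun z _ => (integrable_finsetSum _ fun a _ =>
      integrable_finsetSum _ fun b _ => (hint z a b).mul_const _).const_mul _]
    conv_rhs => rw [hG, gaussianWeightedMoment, trace_sum_smul_mul]
    refine Finset.sum_congr rfl fun z _ => ?_
    rw [integral_const_mul, integral_finsetSum _ fun a _ =>
      integrable_finsetSum _ fun b _ => (hint z a b).mul_const _]
    congr 1
    refine Finset.sum_congr rfl fun a _ => ?_
    rw [integral_finsetSum _ fun b _ => (hint z a b).mul_const _]
    refine Finset.sum_congr rfl fun b _ => ?_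
    rw [integral_mul_const, integral_tensorPow_ketBra_mulVec, condFactor_mul_conjTranspose]
    rfl
  refine (integral_re hi).trans ?_
  rw [h2, ← hsNorm_sq_eq_trace hGh]
  exact Complex.ofReal_re _

/-- Variance of `weightedMoment` under the Gaussian measure: by Wick's formula it consists of the
block-mixing pairings only, each of which is at most `D_A ^ k * ‖σ‖₂²`. -/
lemma integral_hsNorm_weightedMoment_sq_le (T : Matrix (α × β) ι ℂ) (k : ℕ) {w : β → ℝ}
    (hw : ∀ z, 0 ≤ w z)
    (hwq : ∀ z, w z * expVal (reducedB (T * Tᴴ)) (e z) ^ (k - 1) ≤ 1) :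
    ∫ g : EuclideanSpace ℂ ι, hsNorm (weightedMoment e k w (WithLp.toLp 2 (T *ᵥ g.ofLp))) ^ 2
        ∂stdGaussian ι
      ≤ hsNorm (gaussianWeightedMoment e k w (T * Tᴴ)) ^ 2
        + (k + k).factorial * Fintype.card α ^ k * hsNorm (T * Tᴴ) ^ 2 := by
  classical
  set S := basisChange α e * T with hS
  set τ := S * Sᴴ with hτ
  set q : β → ℝ := fun z => expVal (reducedB (T * Tᴴ)) (e z) with hq
  have hqτ : ∀ z, q z = ∑ x, (τ (x, z) (x, z)).re := fun z => by
    rw [hq]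
    simp only
    rw [← trace_condState, ← condFactor_mul_conjTranspose, Matrix.trace, Complex.re_sum]
    rfl
  have hq0 : ∀ z, 0 ≤ q z := fun z => by
    rw [hqτ]
    refine Finset.sum_nonneg fun x _ => ?_
    rw [hτ, mul_conjTranspose_self_apply_self, Complex.ofReal_re]
    positivity
  set G := gaussianWeightedMoment e k w (T * Tᴴ) with hG
  have hGh : G.IsHermitian := (gaussianWeightedMoment_posSemidef e T k hw).1
  have h1 : ∀ g : EuclideanSpace ℂ ι,
      ((hsNorm (weightedMoment e k w (WithLp.toLp 2 (T *ᵥ g.ofLp))) ^ 2 : ℝ) : ℂ)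
        = ∑ z, ∑ z', w z * w z' * ∑ a : Fin k → α, ∑ b, ∏ j,
          (S *ᵥ g.ofLp) (pairLabel a b z z' j) * star ((S *ᵥ g.ofLp) (pairLabel b a z z' j)) := by
    intro g
    rw [hsNorm_sq_eq_trace (weightedMoment_isHermitian e k w _), weightedMoment,
      trace_sum_smul_mul_self]
    refine Finset.sum_congr rfl fun z _ => Finset.sum_congr rfl fun z' _ => ?_
    congr 1
    refine Finset.sum_congr rfl fun a _ => Finset.sum_congr rfl fun b _ => ?_
    rw [projVec_mulVec, projVec_mulVec, Fintype.prod_sum_type]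
    rfl
  have hint := fun (z z' : β) (a b : Fin k → α) =>
    integrable_prod_linear S (pairLabel a b z z') (pairLabel b a z z')
  have h2 : ((∫ g : EuclideanSpace ℂ ι,
      hsNorm (weightedMoment e k w (WithLp.toLp 2 (T *ᵥ g.ofLp))) ^ 2 ∂stdGaussian ι : ℝ) : ℂ)
        = ∑ z, ∑ z', w z * w z' * ∑ a : Fin k → α, ∑ b, ∑ π : Equiv.Perm (Fin k ⊕ Fin k), ∏ j,
          τ (pairLabel a b z z' j) (pairLabel b a z z' (π j)) := by
    rw [← integral_complex_ofReal]
    simp_rw [h1]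
    rw [integral_finsetSum _ fun z _ => integrable_finsetSum _ fun z' _ =>
      (integrable_finsetSum _ fun a _ => integrable_finsetSum _ fun b _ =>
        hint z z' a b).const_mul _]
    refine Finset.sum_congr rfl fun z _ => ?_
    rw [integral_finsetSum _ fun z' _ =>
      (integrable_finsetSum _ fun a _ => integrable_finsetSum _ fun b _ =>
        hint z z' a b).const_mul _]
    refine Finset.sum_congr rfl fun z' _ => ?_
    rw [integral_const_mul, integral_finsetSum _ fun a _ => integrable_finsetSum _ fun b _ =>
        hint z z' a b]
    congr 1
    refine Finset.sum_congr rfl fun a _ => ?_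
    rw [integral_finsetSum _ fun b _ => hint z z' a b]
    exact Finset.sum_congr rfl fun b _ => wick S _ _
  have h3 : ((hsNorm G ^ 2 : ℝ) : ℂ) = ∑ z, ∑ z', w z * w z' * ∑ a, ∑ b,
      gaussianMoment k (Matrix.of fun x y => τ (x, z) (y, z)) a b
        * gaussianMoment k (Matrix.of fun x y => τ (x, z') (y, z')) b a := by
    rw [hsNorm_sq_eq_trace hGh, hG, gaussianWeightedMoment, trace_sum_smul_mul_self]
    simp_rw [← condFactor_mul_conjTranspose]
    rfl
  have h4 : ((∫ g : EuclideanSpace ℂ ι,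
      hsNorm (weightedMoment e k w (WithLp.toLp 2 (T *ᵥ g.ofLp))) ^ 2 ∂stdGaussian ι
        - hsNorm G ^ 2 : ℝ) : ℂ)
      = ∑ z, ∑ z', w z * w z' * ∑ a : Fin k → α, ∑ b, ∑ π ∈ Finset.univ.filter
        (fun π => π ∉ (Equiv.Perm.sumCongrHom (Fin k) (Fin k)).range),
        ∏ j, τ (pairLabel a b z z' j) (pairLabel b a z z' (π j)) := by
    rw [Complex.ofReal_sub, h2, h3]
    simp only [← Finset.sum_sub_distrib, ← mul_sub]
    refine Finset.sum_congr rfl fun z _ => Finset.sum_congr rfl fun z' _ => ?_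
    congr 1
    exact Finset.sum_congr rfl fun a _ => Finset.sum_congr rfl fun b _ =>
      sum_perm_sub_gaussianMoment_mul τ a b z z'
  have hblock : ∀ z z', w z * w z' * ‖∑ a : Fin k → α, ∑ b, ∑ π ∈ Finset.univ.filter
        (fun π => π ∉ (Equiv.Perm.sumCongrHom (Fin k) (Fin k)).range),
        ∏ j, τ (pairLabel a b z z' j) (pairLabel b a z z' (π j))‖
      ≤ (k + k).factorial * Fintype.card α ^ k * ∑ x, ∑ y, ‖τ (x, z) (y, z')‖ ^ 2 := by
    intro z z'
    set N := ∑ x, ∑ y, ‖τ (x, z) (y, z')‖ ^ 2 with hN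
    have hN0 : 0 ≤ N := by positivity
    have hcard : (Finset.univ.filter
        (fun π => π ∉ (Equiv.Perm.sumCongrHom (Fin k) (Fin k)).range)).card
        ≤ (k + k).factorial := by
      refine (Finset.card_filter_le _ _).trans_eq ?_
      rw [Finset.card_univ, Fintype.card_perm, Fintype.card_sum, Fintype.card_fin]
    have hb : ‖∑ a : Fin k → α, ∑ b, ∑ π ∈ Finset.univ.filter
        (fun π => π ∉ (Equiv.Perm.sumCongrHom (Fin k) (Fin k)).range),
        ∏ j, τ (pairLabel a b z z' j) (pairLabel b a z z' (π j))‖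
        ≤ (k + k).factorial * (Fintype.card α ^ k * N * (q z * q z') ^ (k - 1)) := by
      calc _ ≤ ∑ a : Fin k → α, ∑ b, ∑ π ∈ Finset.univ.filter
              (fun π => π ∉ (Equiv.Perm.sumCongrHom (Fin k) (Fin k)).range),
              ‖∏ j, τ (pairLabel a b z z' j) (pairLabel b a z z' (π j))‖ :=
            (norm_sum_le _ _).trans (Finset.sum_le_sum fun a _ =>
              (norm_sum_le _ _).trans (Finset.sum_le_sum fun b _ => norm_sum_le _ _))
        _ = ∑ π ∈ Finset.univ.filter
              (fun π => π ∉ (Equiv.Perm.sumCongrHom (Fin k) (Fin k)).range),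
              ∑ a : Fin k → α, ∑ b,
              ‖∏ j, τ (pairLabel a b z z' j) (pairLabel b a z z' (π j))‖ := by
            rw [Finset.sum_congr rfl fun a _ => Finset.sum_comm, Finset.sum_comm]
        _ ≤ ∑ π ∈ Finset.univ.filter
              (fun π => π ∉ (Equiv.Perm.sumCongrHom (Fin k) (Fin k)).range),
              (Fintype.card α ^ k * N * (q z * q z') ^ (k - 1)) := by
            refine Finset.sum_le_sum fun π hπ => ?_
            rw [hqτ z, hqτ z']
            exact sum_norm_prod_crossing_le S z z' (Finset.mem_filter.1 hπ).2
        _ ≤ _ := by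
            rw [Finset.sum_const, nsmul_eq_mul]
            refine mul_le_mul_of_nonneg_right (by exact_mod_cast hcard) ?_
            have := hq0 z
            have := hq0 z'
            positivity
    have hw1 : (w z * w z') * (q z * q z') ^ (k - 1) ≤ 1 := by
      calc (w z * w z') * (q z * q z') ^ (k - 1)
          = (w z * q z ^ (k - 1)) * (w z' * q z' ^ (k - 1)) := by rw [mul_pow]; ring
        _ ≤ 1 := mul_le_one₀ (hwq z) (mul_nonneg (hw z') (pow_nonneg (hq0 z') _)) (hwq z')
    calc _ ≤ w z * w z' * ((k + k).factorial
            * (Fintype.card α ^ k * N * (q z * q z') ^ (k - 1))) :=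
          mul_le_mul_of_nonneg_left hb (mul_nonneg (hw z) (hw z'))
      _ = (k + k).factorial * Fintype.card α ^ k * N
            * ((w z * w z') * (q z * q z') ^ (k - 1)) := by ring
      _ ≤ _ := mul_le_of_le_one_right (by positivity) hw1
  have h5 : ∫ g : EuclideanSpace ℂ ι,
      hsNorm (weightedMoment e k w (WithLp.toLp 2 (T *ᵥ g.ofLp))) ^ 2 ∂stdGaussian ι
        - hsNorm G ^ 2 ≤ (k + k).factorial * Fintype.card α ^ k * hsNorm (T * Tᴴ) ^ 2 := by
    have hsq : hsNorm (T * Tᴴ) ^ 2 = ∑ x, ∑ y, ‖τ x y‖ ^ 2 := by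
      rw [← hsNorm_basisChange e T, hsNorm_sq]
    rw [hsq]
    refine ((Complex.ofReal_re _).symm.le.trans (Complex.re_le_norm _)).trans ?_
    rw [h4]
    calc _ ≤ ∑ z, ∑ z', w z * w z' * ‖∑ a : Fin k → α, ∑ b, ∑ π ∈ Finset.univ.filter
              (fun π => π ∉ (Equiv.Perm.sumCongrHom (Fin k) (Fin k)).range),
              ∏ j, τ (pairLabel a b z z' j) (pairLabel b a z z' (π j))‖ := by
          refine (norm_sum_le _ _).trans (Finset.sum_le_sum fun z _ =>
              (norm_sum_le _ _).trans (Finset.sum_le_sum fun z' _ => ?_))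
          rw [norm_mul, norm_mul, Complex.norm_real, Complex.norm_real,
            Real.norm_of_nonneg (hw z), Real.norm_of_nonneg (hw z')]
      _ ≤ ∑ z, ∑ z', (k + k).factorial * Fintype.card α ^ k
            * ∑ x, ∑ y, ‖τ (x, z) (y, z')‖ ^ 2 :=
          Finset.sum_le_sum fun z _ => Finset.sum_le_sum fun z' _ => hblock z z'
      _ = _ := by
          simp only [← Finset.mul_sum]
          congr 1
          rw [Fintype.sum_prod_type_right]
          refine Finset.sum_congr rfl fun z _ => ?_
          rw [Finset.sum_comm]
          refine Finset.sum_congr rfl fun x _ => ?_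
          rw [Fintype.sum_prod_type_right]
  linarith

end

/-! ### Sums of squares built from the projected states -/

section
variable {α β : Type} [Fintype α] [Fintype β]

lemma isTensorForm_projVec (v : EuclideanSpace ℂ β) (a : α) :
    IsTensorForm 1 (fun Ψ : EuclideanSpace ℂ (α × β) => projVec v Ψ a) := by
  classical
  have h := IsTensorForm.linear (fun p : α × β => if p.1 = a then star (v p.2) else 0)
  convert h using 2 with Ψ
  rw [Fintype.sum_prod_type, Finset.sum_eq_single a]
  · simp [projVec]
  · intro a' _ ha
    simp [ha]
  · simp

lemma isTensorForm_prod_projVec (v : EuclideanSpace ℂ β) {k : ℕ} (c : Fin k → α) :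
    IsTensorForm k (fun Ψ : EuclideanSpace ℂ (α × β) => ∏ j, projVec v Ψ (c j)) :=
  IsTensorForm.prod fun j => isTensorForm_projVec v (c j)

lemma isSquareSum_norm_projVec_sq (v : EuclideanSpace ℂ β) :
    IsSquareSum 1 (fun Ψ : EuclideanSpace ℂ (α × β) => ‖projVec v Ψ‖ ^ 2) := by
  simp_rw [EuclideanSpace.norm_sq_eq]
  exact IsSquareSum.sum fun a => (isTensorForm_projVec v a).isSquareSum

/-- The weighted sum `∑_z w_z p_z^k`, the trace of `weightedMoment`. -/
noncomputable def totalWeight (e : OrthonormalBasis β ℂ (EuclideanSpace ℂ β)) (k : ℕ) (w : β → ℝ)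
    (Ψ : EuclideanSpace ℂ (α × β)) : ℝ :=
  ∑ z, w z * (‖projVec (e z) Ψ‖ ^ 2) ^ k

variable (e : OrthonormalBasis β ℂ (EuclideanSpace ℂ β))

lemma isSquareSum_totalWeight (k : ℕ) {w : β → ℝ} (hw : ∀ z, 0 ≤ w z) :
    IsSquareSum k (totalWeight e k w : EuclideanSpace ℂ (α × β) → ℝ) := by
  have h := IsSquareSum.sum fun z =>
    ((isSquareSum_norm_projVec_sq (α := α) (e z)).pow k).const_mul (hw z)
  rwa [one_mul] at h

/-- Lagrange's identity for complex vectors. -/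
lemma lagrange_identity {κ : Type*} [Fintype κ] (U V : κ → ℂ) :
    ((∑ a, ‖U a‖ ^ 2 : ℝ) : ℂ) * ((∑ a, ‖V a‖ ^ 2 : ℝ) : ℂ)
        - ∑ a, ∑ b, U a * star (U b) * (V b * star (V a))
      = ((2⁻¹ * ∑ a, ∑ b, ‖U a * V b - U b * V a‖ ^ 2 : ℝ) : ℂ) := by
  have h : ∀ a b, ((‖U a * V b - U b * V a‖ ^ 2 : ℝ) : ℂ)
      = (‖U a‖ ^ 2 : ℂ) * (‖V b‖ ^ 2 : ℂ) + (‖U b‖ ^ 2 : ℂ) * (‖V a‖ ^ 2 : ℂ)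
        - U a * star (U b) * (V b * star (V a)) - U b * star (U a) * (V a * star (V b)) := by
    intro a b
    push_cast
    simp only [← Complex.mul_conj', map_sub, map_mul, Complex.star_def]
    ring
  have h1 : ∑ a, ∑ b, U b * star (U a) * (V a * star (V b))
      = ∑ a, ∑ b, U a * star (U b) * (V b * star (V a)) := Finset.sum_comm
  have h2 : ∑ a, ∑ b, (‖U b‖ ^ 2 : ℂ) * (‖V a‖ ^ 2 : ℂ)
      = ∑ a, ∑ b, (‖U a‖ ^ 2 : ℂ) * (‖V b‖ ^ 2 : ℂ) := Finset.sum_comm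
  rw [Complex.ofReal_mul, Complex.ofReal_sum]
  simp_rw [Complex.ofReal_sum, h, Finset.sum_sub_distrib, Finset.sum_add_distrib, h1, h2]
  push_cast
  rw [Finset.sum_mul_sum]
  ring

lemma tensorPow_ketBra_apply {α : Type*} (k : ℕ) (v : EuclideanSpace ℂ α) (c c' : Fin k → α) :
    tensorPow k (ketBra v) c c' = (∏ j, v (c j)) * star (∏ j, v (c' j)) := by
  simp [tensorPow, ketBra, Finset.prod_mul_distrib]

lemma sum_norm_prod_sq {α : Type*} [Fintype α] (k : ℕ) (v : EuclideanSpace ℂ α) :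
    ∑ c : Fin k → α, ‖∏ j, v (c j)‖ ^ 2 = (‖v‖ ^ 2) ^ k := by
  rw [EuclideanSpace.norm_sq_eq, Fintype.sum_pow]
  simp [Finset.prod_pow]

/-- `(Tr R)² - Tr R²` is a sum of squares for `R = weightedMoment`: by Lagrange's identity each pair
of outcomes contributes the squared norm of an antisymmetrised product. -/
lemma isSquareSum_totalWeight_sq_sub (k : ℕ) {w : β → ℝ} (hw : ∀ z, 0 ≤ w z) :
    IsSquareSum (k + k) (fun Ψ : EuclideanSpace ℂ (α × β) =>
      totalWeight e k w Ψ ^ 2 - hsNorm (weightedMoment e k w Ψ) ^ 2) := by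
  have hsq : ∀ z z', IsSquareSum (k + k) (fun Ψ : EuclideanSpace ℂ (α × β) =>
      ∑ a : Fin k → α, ∑ b : Fin k → α,
        ‖(∏ j, projVec (e z) Ψ (a j)) * (∏ j, projVec (e z') Ψ (b j))
          - (∏ j, projVec (e z) Ψ (b j)) * (∏ j, projVec (e z') Ψ (a j))‖ ^ 2) := fun z z' =>
    IsSquareSum.sum fun a => IsSquareSum.sum fun b => IsTensorForm.isSquareSum <|
      ((isTensorForm_prod_projVec _ a).mul (isTensorForm_prod_projVec _ b)).sub
        ((isTensorForm_prod_projVec _ b).mul (isTensorForm_prod_projVec _ a))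
  have h := IsSquareSum.sum fun z => IsSquareSum.sum fun z' =>
    (hsq z z').const_mul (c := w z * w z' * 2⁻¹)
      (mul_nonneg (mul_nonneg (hw z) (hw z')) (by norm_num))
  convert h using 2 with Ψ
  apply Complex.ofReal_injective
  rw [Complex.ofReal_sub, hsNorm_sq_eq_trace (weightedMoment_isHermitian e k w Ψ), weightedMoment,
    trace_sum_smul_mul_self, sq, totalWeight, Finset.sum_mul_sum, Complex.ofReal_sum,
    Complex.ofReal_sum, ← Finset.sum_sub_distrib]
  refine Finset.sum_congr rfl fun z _ => ?_
  rw [Complex.ofReal_sum, Complex.ofReal_sum, ← Finset.sum_sub_distrib]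
  refine Finset.sum_congr rfl fun z' _ => ?_
  have hl := lagrange_identity (fun a : Fin k → α => ∏ j, projVec (e z) Ψ (a j))
    (fun a => ∏ j, projVec (e z') Ψ (a j))
  rw [sum_norm_prod_sq, sum_norm_prod_sq] at hl
  simp_rw [tensorPow_ketBra_apply]
  rw [mul_assoc (w z * w z'), Complex.ofReal_mul (w z * w z'), ← hl]
  push_cast
  ring

/-- A positive semidefinite `G = Bᴴ B` pairs with `(vv†)^⊗k` as the sum of squares `‖B v^⊗k‖²`. -/
lemma exists_trace_mul_eq_sum_norm_sq {α : Type*} [Fintype α] (k : ℕ)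
    {G : Matrix (Fin k → α) (Fin k → α) ℂ} (hG : G.PosSemidef) :
    ∃ B : Matrix (Fin k → α) (Fin k → α) ℂ, G = Bᴴ * B ∧ ∀ v : EuclideanSpace ℂ α,
      ∑ a, ∑ b, tensorPow k (ketBra v) a b * G b a
        = ((∑ l : Fin k → α, ‖∑ c : Fin k → α, B l c * ∏ j, v (c j)‖ ^ 2 : ℝ) : ℂ) := by
  classical
  obtain ⟨B, hB⟩ := CStarAlgebra.nonneg_iff_eq_star_mul_self.1 hG.nonneg
  rw [star_eq_conjTranspose] at hB
  subst hB
  refine ⟨B, rfl, fun v => ?_⟩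
  rw [Complex.ofReal_sum]
  have h1 : ∀ l : Fin k → α, ((‖∑ c : Fin k → α, B l c * ∏ j, v (c j)‖ ^ 2 : ℝ) : ℂ)
      = ∑ a, ∑ b, tensorPow k (ketBra v) a b * (star (B l b) * B l a) := by
    intro l
    rw [← Complex.normSq_eq_norm_sq, ← Complex.mul_conj, map_sum, Finset.sum_mul_sum]
    refine Finset.sum_congr rfl fun a _ => Finset.sum_congr rfl fun b _ => ?_
    rw [tensorPow_ketBra_apply]
    simp
    ring
  simp_rw [h1, Matrix.mul_apply, Finset.mul_sum, conjTranspose_apply]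
  rw [Finset.sum_congr rfl fun a _ => Finset.sum_comm, Finset.sum_comm]

/-- The pairing of `weightedMoment` with a positive semidefinite matrix is a sum of squares. -/
lemma isSquareSum_trace_weightedMoment_mul (k : ℕ) {w : β → ℝ} (hw : ∀ z, 0 ≤ w z)
    {G : Matrix (Fin k → α) (Fin k → α) ℂ} (hG : G.PosSemidef) :
    IsSquareSum k (fun Ψ : EuclideanSpace ℂ (α × β) => (weightedMoment e k w Ψ * G).trace.re) := by
  obtain ⟨B, -, hB⟩ := exists_trace_mul_eq_sum_norm_sq k hG
  have hsq : ∀ z, IsSquareSum k (fun Ψ : EuclideanSpace ℂ (α × β) =>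
      ∑ l : Fin k → α, ‖∑ c : Fin k → α, B l c * ∏ j, projVec (e z) Ψ (c j)‖ ^ 2) := fun z =>
    IsSquareSum.sum fun l => IsTensorForm.isSquareSum <|
      IsTensorForm.sum _ fun c => (isTensorForm_prod_projVec _ c).const_mul _
  have h := IsSquareSum.sum fun z => (hsq z).const_mul (hw z)
  convert h using 2 with Ψ
  rw [weightedMoment, trace_sum_smul_mul, Complex.re_sum]
  refine Finset.sum_congr rfl fun z _ => ?_
  rw [Complex.re_ofReal_mul, hB, Complex.ofReal_re]

/-- For positive semidefinite `G`, `Tr(R G) ≤ Tr R · Tr G`. -/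
lemma trace_weightedMoment_mul_le (k : ℕ) {w : β → ℝ} (hw : ∀ z, 0 ≤ w z)
    {G : Matrix (Fin k → α) (Fin k → α) ℂ} (hG : G.PosSemidef) (Ψ : EuclideanSpace ℂ (α × β)) :
    (weightedMoment e k w Ψ * G).trace.re ≤ totalWeight e k w Ψ * G.trace.re := by
  obtain ⟨B, rfl, hB⟩ := exists_trace_mul_eq_sum_norm_sq k hG
  rw [weightedMoment, trace_sum_smul_mul, totalWeight, Finset.sum_mul, Complex.re_sum]
  refine Finset.sum_le_sum fun z _ => ?_
  rw [Complex.re_ofReal_mul, mul_assoc]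
  refine mul_le_mul_of_nonneg_left ?_ (hw z)
  rw [hB, Complex.ofReal_re]
  have h2 : (Bᴴ * B).trace.re = ∑ l, ∑ c, ‖B l c‖ ^ 2 := by
    rw [← hsNorm_sq, hsNorm, Real.sq_sqrt]
    have := (posSemidef_conjTranspose_mul_self B).trace_nonneg
    exact (Complex.le_def.1 this).1
  rw [h2, Finset.mul_sum]
  refine Finset.sum_le_sum fun l _ => ?_
  rw [← sum_norm_prod_sq, mul_comm]
  have h3 : ‖∑ c : Fin k → α, B l c * ∏ j, projVec (e z) Ψ (c j)‖
      ≤ ∑ c : Fin k → α, ‖B l c‖ * ‖∏ j, projVec (e z) Ψ (c j)‖ :=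
    (norm_sum_le _ _).trans_eq (by simp)
  exact (pow_le_pow_left₀ (norm_nonneg _) h3 2).trans (Finset.sum_mul_sq_le_sq_mul_sq _ _ _)

end

/-! ### Averages over Scrooge designs -/

section
variable {ι : Type*} [Fintype ι] [DecidableEq ι] {σ S : Matrix ι ι ℂ} {lam : ι → ℝ}

/-- A relative-error `n`-design controls sums of squares of any degree `m ≤ n`, since the states are
normalised. -/
lemma IsScroogeDesign.integral_isSquareSum_of_le (hσ : IsDensityMatrix σ) {n : ℕ} {ε : ℝ}
    {μ : Measure (EuclideanSpace ℂ ι)} (hμ : IsScroogeDesign σ n ε μ) {m : ℕ} (hmn : m ≤ n)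
    {f : EuclideanSpace ℂ ι → ℝ} (hf : IsSquareSum m f) :
    (1 - ε) * ∫ ψ, f ψ ∂scroogeEnsemble σ ≤ ∫ ψ, f ψ ∂μ ∧
      ∫ ψ, f ψ ∂μ ≤ (1 + ε) * ∫ ψ, f ψ ∂scroogeEnsemble σ := by
  obtain ⟨S, lam, hS⟩ := exists_isGaussianFactor hσ
  have h := hμ.integral_isSquareSum hσ (hf.raise_degree hmn)
  have e1 : ∫ Ψ, f Ψ * (‖Ψ‖ ^ 2) ^ (n - m) ∂μ = ∫ Ψ, f Ψ ∂μ :=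
    integral_congr_ae <| hμ.1.2.mono fun Ψ hΨ => by simp only [hΨ, one_pow, mul_one]
  have e2 : ∫ Ψ, f Ψ * (‖Ψ‖ ^ 2) ^ (n - m) ∂scroogeEnsemble σ = ∫ Ψ, f Ψ ∂scroogeEnsemble σ :=
    integral_congr_ae <| hS.ae_norm_eq_one.mono fun Ψ hΨ => by simp only [hΨ, one_pow, mul_one]
  rwa [e1, e2] at h

/-- The Scrooge average of a form is its Gaussian average up to an error of the order of the
purity `‖σ‖₂`. -/
lemma IsGaussianFactor.abs_integral_isSquareSum_sub_le (h : IsGaussianFactor σ S lam) {m : ℕ}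
    (hm1 : 1 ≤ m) (hm : 4 * m * hsNorm σ ≤ 1 / 2) {f : EuclideanSpace ℂ ι → ℝ}
    (hf : IsSquareSum m f) {b : EuclideanSpace ℂ ι → ℝ}
    (hb : Integrable (fun g => b g ^ 4) (stdGaussian ι))
    (hfb : ∀ g : EuclideanSpace ℂ ι, f (WithLp.toLp 2 (S *ᵥ g.ofLp)) ≤ b g) {K : ℝ}
    (hK : ∫ g, b g ^ 4 ∂stdGaussian ι ≤ K) :
    Integrable (fun g : EuclideanSpace ℂ ι => f (WithLp.toLp 2 (S *ᵥ g.ofLp))) (stdGaussian ι) ∧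
    |∫ ψ, f ψ ∂scroogeEnsemble σ
        - ∫ g : EuclideanSpace ℂ ι, f (WithLp.toLp 2 (S *ᵥ g.ofLp)) ∂stdGaussian ι|
      ≤ m * Real.sqrt (Real.pi ^ (4 * m) + K) * hsNorm σ := by
  obtain ⟨n, rfl⟩ := Nat.exists_eq_add_of_le' hm1
  set F : EuclideanSpace ℂ ι → ℝ := fun g => f (WithLp.toLp 2 (S *ᵥ g.ofLp)) with hF
  have hFc : Continuous F := hf.continuous.comp (by fun_prop)
  have hF0 : ∀ g, 0 ≤ F g := fun g => hf.nonneg _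
  have hle : ∀ g, F g ^ 4 ≤ b g ^ 4 := fun g => pow_le_pow_left₀ (hF0 g) (hfb g) 4
  have hFi : Integrable (fun g => F g ^ 4) (stdGaussian ι) := by
    refine hb.mono' (by fun_prop) (.of_forall fun g => ?_)
    rw [Real.norm_of_nonneg (by positivity)]
    exact hle g
  have hFK : ∫ g, F g ^ 4 ∂stdGaussian ι ≤ K := (integral_mono hFi hb hle).trans hK
  have hs := hsNorm_nonneg σ
  have hF1 : Integrable F (stdGaussian ι) := by
    refine ((integrable_const 1).add hFi).mono' hFc.aestronglyMeasurable (.of_forall fun g => ?_)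
    rw [Real.norm_of_nonneg (hF0 g)]
    simp only [Pi.add_apply]
    nlinarith [sq_nonneg (F g ^ 2 - F g), sq_nonneg (F g - 1), hF0 g, sq_nonneg (F g ^ 2 - 1)]
  have key := (abs_integral_inv_pow_mul_sub_le S lam h.nonneg h.normSq_eq h.sum_eq_one h.trace n
    (fun i => by
      have := h.le_hsNorm i
      have := h.nonneg i
      push_cast at hm
      nlinarith [mul_nonneg (Nat.cast_nonneg (α := ℝ) n) (sub_nonneg.2 (h.le_hsNorm i))])
    F hFc.measurable hF0 K hFi hFK).2
  refine ⟨hF1, ?_⟩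
  rw [h.integral_isSquareSum hf]
  refine key.trans ?_
  rw [h.cov]
  gcongr
  · simp
  · linarith [Real.pi_gt_three]
  · simp

end

lemma abs_sub_pow_le {r : ℝ} (hr : 0 ≤ r) {k : ℕ} (hk : 1 ≤ k) :
    |r - r ^ k| ≤ ((k : ℝ) - 1) * (|1 - r| * (1 + r ^ k)) := by
  obtain ⟨m, rfl⟩ := Nat.exists_eq_add_of_le' hk
  have e : r - r ^ (m + 1) = (1 - r) * ∑ i ∈ Finset.range m, r ^ (i + 1) := by
    have := mul_neg_geom_sum r m
    simp_rw [pow_succ r, ← Finset.sum_mul]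
    rw [← mul_assoc, this]
    ring
  have h2 : ∑ i ∈ Finset.range m, r ^ (i + 1) ≤ m * (1 + r ^ (m + 1)) := by
    rw [← nsmul_eq_mul]
    refine (Finset.sum_le_card_nsmul _ _ _ fun i hi => ?_).trans_eq (by rw [Finset.card_range])
    rcases le_total r 1 with h | h
    · have := pow_le_one₀ hr h (n := i + 1)
      have := pow_nonneg hr (m + 1)
      linarith
    · have : r ^ (i + 1) ≤ r ^ (m + 1) :=
        pow_le_pow_right₀ h (by have := Finset.mem_range.1 hi; omega)
      linarith
  have h3 : 0 ≤ ∑ i ∈ Finset.range m, r ^ (i + 1) := by positivity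
  rw [e, abs_mul, abs_of_nonneg h3]
  push_cast
  rw [add_sub_cancel_right, mul_left_comm]
  gcongr

section
variable {X ι : Type*} [Fintype ι] [Fintype X]

/-- If `r` concentrates around `1`, then `r` and `r ^ k` are close in mean, by Cauchy-Schwarz. -/
lemma integral_abs_sub_pow_le {Ω : Type*} [MeasurableSpace Ω] {μ : Measure Ω}
    [IsProbabilityMeasure μ] {r : Ω → ℝ} (hr0 : ∀ x, 0 ≤ r x) (hrm : AEStronglyMeasurable r μ)
    {k : ℕ} (hk : 1 ≤ k) {V B : ℝ}
    (h1 : Integrable (fun x => (1 - r x) ^ 2) μ) (hV : ∫ x, (1 - r x) ^ 2 ∂μ ≤ V)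
    (h2 : Integrable (fun x => r x ^ (2 * k)) μ) (hB : ∫ x, r x ^ (2 * k) ∂μ ≤ B) :
    Integrable (fun x => |r x - r x ^ k|) μ ∧
    ∫ x, |r x - r x ^ k| ∂μ ≤ ((k : ℝ) - 1) * (Real.sqrt V * Real.sqrt (2 + 2 * B)) := by
  have hkk : (0 : ℝ) ≤ (k : ℝ) - 1 := by
    have : (1 : ℝ) ≤ k := by exact_mod_cast hk
    linarith
  have hle : ∀ x, (1 + r x ^ k) ^ 2 ≤ 2 + 2 * r x ^ (2 * k) := fun x => by
    rw [mul_comm 2 k, pow_mul]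
    nlinarith [sq_nonneg (r x ^ k - 1)]
  have hbi : Integrable (fun x => 2 + 2 * r x ^ (2 * k)) μ :=
    (integrable_const _).add (h2.const_mul 2)
  have h3 : Integrable (fun x => (1 + r x ^ k) ^ 2) μ := by
    refine hbi.mono' (by fun_prop) (.of_forall fun x => ?_)
    rw [Real.norm_of_nonneg (sq_nonneg _)]
    exact hle x
  have h4 : ∫ x, (1 + r x ^ k) ^ 2 ∂μ ≤ 2 + 2 * B := by
    refine (integral_mono h3 hbi hle).trans ?_
    rw [integral_add (integrable_const _) (h2.const_mul 2), integral_const_mul]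
    simp only [integral_const, probReal_univ, one_smul]
    linarith
  have hcs := integral_mul_le_sqrt_mul_sqrt (f := fun x => 1 - r x) (g := fun x => 1 + r x ^ k)
    (by fun_prop) (by fun_prop) h1 h3
  have hp : ∀ x, |r x - r x ^ k| ≤ ((k : ℝ) - 1) * (|1 - r x| * |1 + r x ^ k|) := fun x => by
    rw [abs_of_nonneg (by have := hr0 x; positivity : (0 : ℝ) ≤ 1 + r x ^ k)]
    exact abs_sub_pow_le (hr0 x) hk
  have hI : Integrable (fun x => |r x - r x ^ k|) μ := by
    refine (hcs.1.const_mul ((k : ℝ) - 1)).mono' (by fun_prop) (.of_forall fun x => ?_)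
    rw [Real.norm_of_nonneg (abs_nonneg _)]
    exact hp x
  refine ⟨hI, (integral_mono hI (hcs.1.const_mul _) hp).trans ?_⟩
  rw [integral_const_mul]
  refine mul_le_mul_of_nonneg_left (hcs.2.trans ?_) hkk
  gcongr

lemma tensorPow_ketBra_normalized {α : Type*} [Fintype α] {k : ℕ} (hk : 1 ≤ k)
    (v : EuclideanSpace ℂ α) :
    tensorPow k (ketBra v)
      = (((‖v‖ ^ 2) ^ k : ℝ) : ℂ) • tensorPow k (ketBra (((‖v‖⁻¹ : ℝ) : ℂ) • v)) := by
  ext c c'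
  by_cases h : v = 0
  · subst h
    -- both sides vanish at `0`, as `k ≥ 1`
    have : k ≠ 0 := by omega
    simp [tensorPow, ketBra, this]
  · have hn : (‖v‖ : ℂ) ≠ 0 := by simpa using h
    rw [Matrix.smul_apply, tensorPow_ketBra_apply, tensorPow_ketBra_apply]
    simp only [PiLp.smul_apply, smul_eq_mul, Finset.prod_mul_distrib, Finset.prod_const,
      Finset.card_univ, Fintype.card_fin, star_mul', star_pow, Complex.star_def,
      Complex.conj_ofReal]
    have h1 : ((‖v‖ : ℂ) ^ 2) ^ k * ((‖v‖ : ℂ)⁻¹ ^ k * (‖v‖ : ℂ)⁻¹ ^ k) = 1 := by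
      rw [← mul_pow, ← mul_pow, show (‖v‖ : ℂ) ^ 2 * ((‖v‖ : ℂ)⁻¹ * (‖v‖ : ℂ)⁻¹) = 1 by
        field_simp, one_pow]
    push_cast
    linear_combination (-(∏ j, v (c j)) * (starRingEnd ℂ) (∏ j, v (c' j))) * h1

end

/-! ### Gaussian moments compared with Scrooge moments -/

section
variable {α : Type*} [Fintype α]

lemma continuous_trace_mul_tensorPow {k : ℕ} (W : Matrix (Fin k → α) (Fin k → α) ℂ) :
    Continuous fun v : EuclideanSpace ℂ α => (W * tensorPow k (ketBra v)).trace := by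
  have := continuous_tensorPow_ketBra (ι := α) k
  simp only [Matrix.trace, Matrix.diag, Matrix.mul_apply]
  fun_prop

variable [DecidableEq α]

/-- Unit vectors have tensor powers of trace norm at most one. -/
lemma norm_tensorPow_pairing_le {k : ℕ} {W : Matrix (Fin k → α) (Fin k → α) ℂ} (hW : Wᴴ * W = 1)
    {v : EuclideanSpace ℂ α} (hv : ‖v‖ ≤ 1) : ‖(W * tensorPow k (ketBra v)).trace‖ ≤ 1 :=
  (norm_trace_mul_tensorPow_ketBra_le hW v).trans
    (pow_le_one₀ (sq_nonneg _) (pow_le_one₀ (norm_nonneg _) hv))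

lemma trace_mul_integral {Ω κ : Type*} [MeasurableSpace Ω] {μ : Measure Ω} [Fintype κ]
    (W : Matrix κ κ ℂ) {M : Ω → Matrix κ κ ℂ} (hM : ∀ c c', Integrable (fun x => M x c c') μ) :
    (W * Matrix.of fun c c' => ∫ x, M x c c' ∂μ).trace = ∫ x, (W * M x).trace ∂μ := by
  simp only [Matrix.trace, Matrix.diag, Matrix.mul_apply, of_apply]
  rw [integral_finsetSum _ fun c _ => integrable_finsetSum _ fun c' _ =>
    (hM c' c).const_mul (W c c')]
  refine Finset.sum_congr rfl fun c _ => ?_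
  rw [integral_finsetSum _ fun c' _ => (hM c' c).const_mul (W c c')]
  refine Finset.sum_congr rfl fun c' _ => ?_
  rw [integral_const_mul]

variable {σ : Matrix α α ℂ}

lemma trace_mul_scroogeMoment (hσ : IsDensityMatrix σ) {k : ℕ}
    (W : Matrix (Fin k → α) (Fin k → α) ℂ) :
    (W * scroogeMoment k σ).trace
      = ∫ ψ, (W * tensorPow k (ketBra ψ)).trace ∂scroogeEnsemble σ := by
  obtain ⟨S, lam, h⟩ := exists_isGaussianFactor hσ
  have := h.isProbabilityMeasure
  exact trace_mul_integral W fun c c' =>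
    integrable_of_ae_norm_le_one h.ae_norm_le_one (continuous_tensorPow_ketBra k c c')

lemma norm_trace_mul_scroogeMoment_le (hσ : IsDensityMatrix σ) {k : ℕ}
    {W : Matrix (Fin k → α) (Fin k → α) ℂ} (hW : Wᴴ * W = 1) :
    ‖(W * scroogeMoment k σ).trace‖ ≤ 1 := by
  obtain ⟨S, lam, h⟩ := exists_isGaussianFactor hσ
  have := h.isProbabilityMeasure
  rw [trace_mul_scroogeMoment hσ]
  refine (norm_integral_le_of_norm_le_const (C := 1)
    (h.ae_norm_le_one.mono fun ψ hψ => norm_tensorPow_pairing_le hW hψ)).trans_eq ?_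
  simp

/-- The Gaussian moment and the Scrooge moment of the same density matrix differ, in trace norm,
by at most `O(‖σ‖₂)`: the two averages differ by the factors `n ^ k` and `n`, where `n` is the
squared norm of the Gaussian vector. -/
lemma norm_trace_mul_gaussianMoment_sub_le (hσ : IsDensityMatrix σ) {k : ℕ} (hk : 1 ≤ k)
    {W : Matrix (Fin k → α) (Fin k → α) ℂ} (hW : Wᴴ * W = 1) :
    ‖(W * (gaussianMoment k σ - scroogeMoment k σ)).trace‖
      ≤ ((k : ℝ) - 1) * (hsNorm σ * Real.sqrt (2 + 2 * (2 * k).factorial)) := by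
  obtain ⟨S, lam, h⟩ := exists_isGaussianFactor hσ
  have hg : (W * gaussianMoment k σ).trace = ∫ g : EuclideanSpace ℂ α,
      (W * tensorPow k (ketBra (WithLp.toLp 2 (S *ᵥ g.ofLp)))).trace ∂stdGaussian α := by
    rw [← trace_mul_integral W fun c c' => integrable_tensorPow_ketBra_mulVec S k c c']
    simp_rw [integral_tensorPow_ketBra_mulVec, h.cov]
    rfl
  let P : EuclideanSpace ℂ α → ℂ := fun g => (W * tensorPow k (ketBra (normalizedImage S g))).trace
  have hPm : StronglyMeasurable P :=
    (continuous_trace_mul_tensorPow W).stronglyMeasurable.comp_measurable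
      (measurable_normalizedImage S)
  have hP1 : ∀ g, ‖P g‖ ≤ 1 := fun g => norm_tensorPow_pairing_le hW (norm_normalizedImage_le S g)
  have hg2 : ∀ g : EuclideanSpace ℂ α,
      (W * tensorPow k (ketBra (WithLp.toLp 2 (S *ᵥ g.ofLp)))).trace
        = (imageNormSq S g ^ k) • P g := fun g => by
    rw [tensorPow_ketBra_normalized hk, norm_toLp_mulVec_sq, Matrix.mul_smul, Matrix.trace_smul]
    rfl
  have hmul : ∀ m, Integrable (fun g => (imageNormSq S g ^ m) • P g) (stdGaussian α) := fun m => by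
    refine (integrable_imageNormSq_pow S m).mono'
      (((continuous_imageNormSq S).pow m).aestronglyMeasurable.smul hPm.aestronglyMeasurable)
      (.of_forall fun g => ?_)
    have h0 := pow_nonneg (imageNormSq_nonneg S g) m
    rw [norm_smul, Real.norm_of_nonneg h0]
    exact mul_le_of_le_one_right h0 (hP1 g)
  have h1 := hmul 1
  simp only [pow_one] at h1
  rw [Matrix.mul_sub, Matrix.trace_sub, hg, trace_mul_scroogeMoment hσ,
    h.integral_scrooge (continuous_trace_mul_tensorPow W).stronglyMeasurable]
  simp_rw [hg2]
  change ‖_ - ∫ g, imageNormSq S g • P g ∂stdGaussian α‖ ≤ _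
  rw [← integral_sub (hmul k) h1]
  obtain ⟨hv1, hv2⟩ := integral_imageNormSq_sub_sq S h.trace
  have hB := integral_imageNormSq_pow_le S (2 * k)
  rw [h.trace, one_pow, mul_one] at hB
  have hmain := integral_abs_sub_pow_le (imageNormSq_nonneg S)
    (continuous_imageNormSq S).aestronglyMeasurable hk hv1 hv2.le
    (integrable_imageNormSq_pow S (2 * k)) hB
  rw [h.cov, Real.sqrt_sq (hsNorm_nonneg σ)] at hmain
  refine (norm_integral_le_of_norm_le hmain.1 (.of_forall fun g => ?_)).trans hmain.2
  rw [← sub_smul, norm_smul, Real.norm_eq_abs, abs_sub_comm]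
  exact mul_le_of_le_one_right (abs_nonneg _) (hP1 g)

lemma gaussianMoment_smul {α : Type*} (k : ℕ) (r : ℂ) (M : Matrix α α ℂ) :
    gaussianMoment k (r • M) = r ^ k • gaussianMoment k M := by
  ext c c'
  simp [gaussianMoment, Finset.prod_mul_distrib, Finset.mul_sum]

end

/-! ### Normalised outcome weights -/

section
variable {α β : Type} [Fintype α] [Fintype β]

/-- The weight `⟨z|σ_B|z⟩ ^ (1 - k)` of the outcome `z`, written as `q * q⁻¹ ^ k` so that it is `0`
when `q = ⟨z|σ_B|z⟩ = 0`, also for `k = 1`. -/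
noncomputable def outcomeWeight (e : OrthonormalBasis β ℂ (EuclideanSpace ℂ β)) (k : ℕ)
    (σ : Matrix (α × β) (α × β) ℂ) (z : β) : ℝ :=
  expVal (reducedB σ) (e z) * (expVal (reducedB σ) (e z))⁻¹ ^ k

variable (e : OrthonormalBasis β ℂ (EuclideanSpace ℂ β))

lemma sum_norm_projVec_sq (Ψ : EuclideanSpace ℂ (α × β)) :
    ∑ z, ‖projVec (e z) Ψ‖ ^ 2 = ‖Ψ‖ ^ 2 := by
  simp_rw [EuclideanSpace.norm_sq_eq]
  rw [Finset.sum_comm, Fintype.sum_prod_type]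
  refine Finset.sum_congr rfl fun a _ => ?_
  let v : EuclideanSpace ℂ β := WithLp.toLp 2 fun b => Ψ (a, b)
  have h := e.sum_sq_norm_inner_right v
  rw [EuclideanSpace.norm_sq_eq] at h
  rw [← h]
  refine Finset.sum_congr rfl fun z _ => ?_
  rw [PiLp.inner_apply]
  simp [projVec, v, mul_comm]

lemma totalWeight_outcomeWeight (k : ℕ) (σ : Matrix (α × β) (α × β) ℂ)
    (Ψ : EuclideanSpace ℂ (α × β)) :
    totalWeight e k (outcomeWeight e k σ) Ψ = ∑ z, expVal (reducedB σ) (e z)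
      * ((expVal (reducedB σ) (e z))⁻¹ * ‖projVec (e z) Ψ‖ ^ 2) ^ k := by
  refine Finset.sum_congr rfl fun z _ => ?_
  rw [outcomeWeight, mul_pow, mul_assoc]

variable [DecidableEq α] {σ : Matrix (α × β) (α × β) ℂ}

section
variable {ι : Type*} [Fintype ι] (T : Matrix (α × β) ι ℂ) (z : β)

lemma trace_condFactor :
    (condFactor e T z * (condFactor e T z)ᴴ).trace.re = expVal (reducedB (T * Tᴴ)) (e z) := by
  rw [condFactor_mul_conjTranspose, trace_condState]

lemma expVal_reducedB_nonneg : 0 ≤ expVal (reducedB (T * Tᴴ)) (e z) := by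
  rw [← trace_condFactor]
  exact (Complex.le_def.1 (posSemidef_self_mul_conjTranspose (condFactor e T z)).trace_nonneg).1

lemma integrable_outcomeRatio_pow (m : ℕ) :
    Integrable (fun g : EuclideanSpace ℂ ι => ((expVal (reducedB (T * Tᴴ)) (e z))⁻¹
      * ‖projVec (e z) (WithLp.toLp 2 (T *ᵥ g.ofLp))‖ ^ 2) ^ m) (stdGaussian ι) := by
  simp_rw [norm_projVec_sq, mul_pow]
  exact (integrable_imageNormSq_pow _ m).const_mul _

lemma integral_outcomeRatio_pow_le (m : ℕ) :
    ∫ g : EuclideanSpace ℂ ι, ((expVal (reducedB (T * Tᴴ)) (e z))⁻¹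
      * ‖projVec (e z) (WithLp.toLp 2 (T *ᵥ g.ofLp))‖ ^ 2) ^ m ∂stdGaussian ι ≤ m.factorial := by
  simp_rw [norm_projVec_sq, mul_pow]
  have h0 := expVal_reducedB_nonneg e T z
  rw [integral_const_mul]
  refine (mul_le_mul_of_nonneg_left (integral_imageNormSq_pow_le _ m) (by positivity)).trans ?_
  rw [trace_condFactor, mul_left_comm, ← mul_pow]
  refine mul_le_of_le_one_right (by positivity) (pow_le_one₀ (by positivity) inv_mul_le_one)

lemma outcomeWeight_nonneg (k : ℕ) : 0 ≤ outcomeWeight e k (T * Tᴴ) z := by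
  have := expVal_reducedB_nonneg e T z
  rw [outcomeWeight]
  positivity

lemma totalWeight_nonneg (k : ℕ) (Ψ : EuclideanSpace ℂ (α × β)) :
    0 ≤ totalWeight e k (outcomeWeight e k (T * Tᴴ)) Ψ :=
  Finset.sum_nonneg fun z _ => mul_nonneg (outcomeWeight_nonneg e T z k) (by positivity)

variable [DecidableEq β]

/-- By convexity the powers of `totalWeight` are dominated by those of the single ratios. -/
lemma totalWeight_pow_le (htr : (T * Tᴴ).trace.re = 1) (k m : ℕ) (Ψ : EuclideanSpace ℂ (α × β)) :
    totalWeight e k (outcomeWeight e k (T * Tᴴ)) Ψ ^ m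
      ≤ ∑ z, expVal (reducedB (T * Tᴴ)) (e z)
        * ((expVal (reducedB (T * Tᴴ)) (e z))⁻¹ * ‖projVec (e z) Ψ‖ ^ 2) ^ (k * m) := by
  rw [totalWeight_outcomeWeight]
  refine (Real.pow_arith_mean_le_arith_mean_pow Finset.univ _ _
    (fun z _ => expVal_reducedB_nonneg e T z) ((sum_expVal_reducedB e T).trans htr)
    (fun z _ => ?_) m).trans_eq ?_
  · have := expVal_reducedB_nonneg e T z
    positivity
  · simp_rw [← pow_mul]

lemma integrable_totalWeight_pow (htr : (T * Tᴴ).trace.re = 1) (k m : ℕ) :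
    Integrable (fun g : EuclideanSpace ℂ ι => totalWeight e k (outcomeWeight e k (T * Tᴴ))
      (WithLp.toLp 2 (T *ᵥ g.ofLp)) ^ m) (stdGaussian ι) := by
  have hc : Continuous fun g : EuclideanSpace ℂ ι => totalWeight e k (outcomeWeight e k (T * Tᴴ))
      (WithLp.toLp 2 (T *ᵥ g.ofLp)) ^ m :=
    ((isSquareSum_totalWeight e k fun z => outcomeWeight_nonneg e T z k).continuous.comp
      (by fun_prop)).pow m
  refine (integrable_finsetSum Finset.univ fun z _ =>
    (integrable_outcomeRatio_pow e T z (k * m)).const_mul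
      (expVal (reducedB (T * Tᴴ)) (e z))).mono' hc.aestronglyMeasurable (.of_forall fun g => ?_)
  rw [Real.norm_of_nonneg (pow_nonneg (totalWeight_nonneg e T k _) m)]
  exact totalWeight_pow_le e T htr k m _

lemma integral_totalWeight_pow_le (htr : (T * Tᴴ).trace.re = 1) (k m : ℕ) :
    ∫ g : EuclideanSpace ℂ ι, totalWeight e k (outcomeWeight e k (T * Tᴴ))
      (WithLp.toLp 2 (T *ᵥ g.ofLp)) ^ m ∂stdGaussian ι ≤ (k * m).factorial := by
  have hi := fun z => (integrable_outcomeRatio_pow e T z (k * m)).const_mul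
      (expVal (reducedB (T * Tᴴ)) (e z))
  refine (integral_mono (integrable_totalWeight_pow e T htr k m)
    (integrable_finsetSum _ fun z _ => hi z)
    fun g => totalWeight_pow_le e T htr k m _).trans ?_
  rw [integral_finsetSum _ fun z _ => hi z]
  calc _ ≤ ∑ z, expVal (reducedB (T * Tᴴ)) (e z) * (k * m).factorial := by
        refine Finset.sum_le_sum fun z _ => ?_
        rw [integral_const_mul]
        exact mul_le_mul_of_nonneg_left (integral_outcomeRatio_pow_le e T z _)
          (expVal_reducedB_nonneg e T z)
    _ = _ := by rw [← Finset.sum_mul, sum_expVal_reducedB, htr, one_mul]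

end

lemma trace_gaussianWeightedMoment_re {ι : Type*} [Fintype ι] (T : Matrix (α × β) ι ℂ) (k : ℕ)
    (w : β → ℝ) :
    (gaussianWeightedMoment e k w (T * Tᴴ)).trace.re
      = ∫ g : EuclideanSpace ℂ ι, totalWeight e k w (WithLp.toLp 2 (T *ᵥ g.ofLp))
        ∂stdGaussian ι := by
  have hi := fun z => (integrable_imageNormSq_pow (condFactor e T z) k).const_mul (w z)
  simp_rw [totalWeight, norm_projVec_sq]
  rw [integral_finsetSum _ fun z _ => hi z, gaussianWeightedMoment, Matrix.trace_sum,
    Complex.re_sum]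
  refine Finset.sum_congr rfl fun z _ => ?_
  rw [integral_const_mul, Matrix.trace_smul, smul_eq_mul, Complex.re_ofReal_mul,
    ← condFactor_mul_conjTranspose]
  congr 1
  have h := trace_mul_integral (1 : Matrix (Fin k → α) (Fin k → α) ℂ)
    fun c c' => integrable_tensorPow_ketBra_mulVec (condFactor e T z) k c c'
  simp_rw [integral_tensorPow_ketBra_mulVec, Matrix.one_mul] at h
  have h2 : ∀ g : EuclideanSpace ℂ ι,
      (tensorPow k (ketBra (WithLp.toLp 2 (condFactor e T z *ᵥ g.ofLp) : EuclideanSpace ℂ α))).trace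
        = ((imageNormSq (condFactor e T z) g ^ k : ℝ) : ℂ) := fun g => by
    rw [← norm_toLp_mulVec_sq, ← sum_norm_prod_sq, Complex.ofReal_sum]
    refine Finset.sum_congr rfl fun c _ => ?_
    rw [Matrix.diag, tensorPow_ketBra_apply, Complex.star_def, Complex.mul_conj',
      Complex.ofReal_pow]
  simp_rw [h2, integral_complex_ofReal] at h
  exact (congrArg Complex.re h).trans (Complex.ofReal_re _)

end

/-! ### Concentration of the weighted moment -/

section
variable {α β : Type} [Fintype β] (e : OrthonormalBasis β ℂ (EuclideanSpace ℂ β))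

lemma outcomeWeight_mul_pow_le [Fintype α] [DecidableEq α] {ι : Type*} [Fintype ι]
    (T : Matrix (α × β) ι ℂ) {k : ℕ} (hk : 1 ≤ k) (z : β) :
    outcomeWeight e k (T * Tᴴ) z * expVal (reducedB (T * Tᴴ)) (e z) ^ (k - 1) ≤ 1 := by
  have h0 := expVal_reducedB_nonneg e T z
  rw [outcomeWeight, mul_right_comm, mul_pow_sub_one (by omega), ← mul_pow]
  exact pow_le_one₀ (by positivity) mul_inv_le_one

lemma continuous_weightedMoment (k : ℕ) (w : β → ℝ) :
    Continuous (weightedMoment e k w : EuclideanSpace ℂ (α × β) → _) := by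
  have h : ∀ z, Continuous fun Ψ : EuclideanSpace ℂ (α × β) => projVec (e z) Ψ := fun z => by
    unfold projVec
    fun_prop
  refine continuous_matrix fun c c' => ?_
  simp only [weightedMoment, Matrix.sum_apply, Matrix.smul_apply]
  have := fun z => (continuous_tensorPow_ketBra k c c').comp (h z)
  exact continuous_finsetSum _ fun z _ => (this z).const_smul (w z : ℂ)

lemma continuous_hsNorm {κ : Type*} [Fintype κ] : Continuous fun M : Matrix κ κ ℂ => hsNorm M := by
  unfold hsNorm
  fun_prop

/-- The polynomial approximation `weightedMoment` concentrates, in Hilbert-Schmidt norm, around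
its Gaussian average for every Scrooge design of order `2k`: the expansion of `‖R - G‖₂²`
is a linear combination of sums of squares, so it may be averaged over the Scrooge ensemble and then
over the Gaussian vector, where Wick's formula bounds the variance. -/
theorem exists_integral_hsNorm_weightedMoment_sub_sq_le (k : ℕ) (hk : 1 ≤ k) :
    ∃ C : ℝ, 0 ≤ C ∧ ∀ {α β : Type} [Fintype α] [Fintype β] [DecidableEq α] [DecidableEq β]
      (e : OrthonormalBasis β ℂ (EuclideanSpace ℂ β)) {σ : Matrix (α × β) (α × β) ℂ},
      IsDensityMatrix σ → 16 * k * hsNorm σ ≤ 1 → ∀ {ε : ℝ}, 0 ≤ ε →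
      ∀ {μ : Measure (EuclideanSpace ℂ (α × β))}, IsScroogeDesign σ (2 * k) ε μ →
      ∫ Ψ, hsNorm (weightedMoment e k (outcomeWeight e k σ) Ψ
          - gaussianWeightedMoment e k (outcomeWeight e k σ) σ) ^ 2 ∂μ
        ≤ C * (ε + hsNorm σ)
          + (k + k).factorial * Fintype.card α ^ k * hsNorm σ ^ 2 := by
  set cT : ℝ := (k + k : ℕ) * Real.sqrt (Real.pi ^ (4 * (k + k)) + (k * 8).factorial) with hcT
  set cv : ℝ := k * Real.sqrt (Real.pi ^ (4 * k)
    + (k * 4).factorial * (k.factorial : ℝ) ^ 4) with hcv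
  have hcT0 : 0 ≤ cT := by positivity
  have hcv0 : 0 ≤ cv := by positivity
  refine ⟨2 * cT + 2 * ((k * 2).factorial + cT) + 2 * cv + 2 * (k.factorial * k.factorial + cv),
    by positivity, ?_⟩
  intro α β _ _ _ _ e σ hσ hs ε hε μ hμ
  have hμp : IsProbabilityMeasure μ := hμ.1.1
  have hμ1 : ∀ᵐ Ψ ∂μ, ‖Ψ‖ ≤ 1 := hμ.1.2.mono fun _ h => h.le
  obtain ⟨T, lam, h⟩ := exists_isGaussianFactor hσ
  have hcov := h.cov
  have htr := h.trace
  have hs0 := hsNorm_nonneg σ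
  have hk1 : (1 : ℝ) ≤ k := by exact_mod_cast hk
  have hs1 : hsNorm σ ≤ 1 := by nlinarith
  set w := outcomeWeight e k σ with hw
  set G := gaussianWeightedMoment e k w σ with hG
  have hw0 : ∀ z, 0 ≤ w z := fun z => by
    rw [hw, ← hcov]; exact outcomeWeight_nonneg e T z k
  have hGpos : G.PosSemidef := by
    rw [hG, ← hcov]; exact gaussianWeightedMoment_posSemidef e T k hw0
  have ht0 : ∀ Ψ : EuclideanSpace ℂ (α × β), 0 ≤ totalWeight e k w Ψ := fun Ψ =>
    (isSquareSum_totalWeight e k hw0).nonneg Ψ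
  have hti : ∀ m, Integrable (fun g : EuclideanSpace ℂ (α × β) =>
      totalWeight e k w (WithLp.toLp 2 (T *ᵥ g.ofLp)) ^ m) (stdGaussian (α × β)) := fun m => by
    have := integrable_totalWeight_pow e T htr k m
    rwa [hcov] at this
  have htm : ∀ m, ∫ g : EuclideanSpace ℂ (α × β),
      totalWeight e k w (WithLp.toLp 2 (T *ᵥ g.ofLp)) ^ m ∂stdGaussian (α × β)
        ≤ (k * m).factorial := fun m => by
    have := integral_totalWeight_pow_le e T htr k m
    rwa [hcov] at this
  -- the three sums of squares: `(Tr R)²`, `(Tr R)² - Tr R²` and `Tr (R G)`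
  have hT := (isSquareSum_totalWeight (α := α) e k hw0).mul (isSquareSum_totalWeight e k hw0)
  have hD := isSquareSum_totalWeight_sq_sub (α := α) e k hw0
  have hv := isSquareSum_trace_weightedMoment_mul e k hw0 hGpos
  have hGtr : G.trace.re ≤ k.factorial := by
    have h1 := trace_gaussianWeightedMoment_re e T k w
    have h2 := htm 1
    simp only [pow_one, mul_one] at h2
    rw [hcov] at h1
    rw [hG, h1]
    exact h2
  have hGtr0 : 0 ≤ G.trace.re := (Complex.le_def.1 hGpos.trace_nonneg).1
  have hT8 : ∀ x : ℝ, (x * x) ^ 4 = x ^ 8 := fun x => by ring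
  have hbT : Integrable (fun g : EuclideanSpace ℂ (α × β) =>
      (totalWeight e k w (WithLp.toLp 2 (T *ᵥ g.ofLp))
        * totalWeight e k w (WithLp.toLp 2 (T *ᵥ g.ofLp))) ^ 4) (stdGaussian (α × β)) := by
    simp_rw [hT8]; exact hti 8
  have hbTK : ∫ g : EuclideanSpace ℂ (α × β),
      (totalWeight e k w (WithLp.toLp 2 (T *ᵥ g.ofLp))
        * totalWeight e k w (WithLp.toLp 2 (T *ᵥ g.ofLp))) ^ 4 ∂stdGaussian (α × β)
        ≤ (k * 8).factorial := by
    simp_rw [hT8]; exact htm 8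
  have hm : 4 * ((k + k : ℕ) : ℝ) * hsNorm σ ≤ 1 / 2 := by push_cast; linarith
  obtain ⟨iT, aT⟩ := h.abs_integral_isSquareSum_sub_le (by omega) hm hT hbT (fun g => le_rfl) hbTK
  obtain ⟨iD, aD⟩ := h.abs_integral_isSquareSum_sub_le (by omega) hm hD hbT (fun g => by
    rw [sq]; linarith [sq_nonneg (hsNorm (weightedMoment e k w (WithLp.toLp 2 (T *ᵥ g.ofLp))))])
    hbTK
  obtain ⟨iv, av⟩ := h.abs_integral_isSquareSum_sub_le (m := k) hk (by nlinarith) hv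
    (b := fun g => totalWeight e k w (WithLp.toLp 2 (T *ᵥ g.ofLp)) * k.factorial)
    (K := (k * 4).factorial * (k.factorial : ℝ) ^ 4)
    (by simp_rw [mul_pow]; exact (hti 4).mul_const _)
    (fun g => (trace_weightedMoment_mul_le e k hw0 hGpos _).trans
      (mul_le_mul_of_nonneg_left hGtr (ht0 _)))
    (by
      simp_rw [mul_pow]
      rw [integral_mul_const]
      exact mul_le_mul_of_nonneg_right (htm 4) (by positivity))
  rw [← hcT] at aT aD
  rw [← hcv] at av
  have gT : ∫ g : EuclideanSpace ℂ (α × β), totalWeight e k w (WithLp.toLp 2 (T *ᵥ g.ofLp))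
      * totalWeight e k w (WithLp.toLp 2 (T *ᵥ g.ofLp)) ∂stdGaussian (α × β)
      ≤ (k * 2).factorial := by simp_rw [← sq]; exact htm 2
  have gv : ∫ g : EuclideanSpace ℂ (α × β),
      (weightedMoment e k w (WithLp.toLp 2 (T *ᵥ g.ofLp)) * G).trace.re ∂stdGaussian (α × β)
      = hsNorm G ^ 2 := by
    have := integral_trace_weightedMoment_mul e T k hw0
    rwa [hcov] at this
  have gv' : hsNorm G ^ 2 ≤ k.factorial * k.factorial := by
    rw [← gv]
    have h1 := htm 1
    have h2 := hti 1
    simp only [pow_one, mul_one] at h1 h2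
    refine (integral_mono iv (h2.mul_const (k.factorial : ℝ)) fun g =>
      (trace_weightedMoment_mul_le e k hw0 hGpos _).trans
        (mul_le_mul_of_nonneg_left hGtr (ht0 _))).trans ?_
    rw [integral_mul_const]
    exact mul_le_mul_of_nonneg_right h1 (by positivity)
  have gu : ∫ g : EuclideanSpace ℂ (α × β),
      hsNorm (weightedMoment e k w (WithLp.toLp 2 (T *ᵥ g.ofLp))) ^ 2 ∂stdGaussian (α × β)
      ≤ hsNorm G ^ 2 + (k + k).factorial * Fintype.card α ^ k * hsNorm σ ^ 2 := by
    have := integral_hsNorm_weightedMoment_sq_le e T k hw0 (fun z => by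
      rw [hw, ← hcov]; exact outcomeWeight_mul_pow_le e T hk z)
    rwa [hcov] at this
  have gu0 : 0 ≤ ∫ g : EuclideanSpace ℂ (α × β),
      hsNorm (weightedMoment e k w (WithLp.toLp 2 (T *ᵥ g.ofLp))) ^ 2 ∂stdGaussian (α × β) :=
    integral_nonneg fun g => sq_nonneg _
  have gsub : ∫ g : EuclideanSpace ℂ (α × β),
      hsNorm (weightedMoment e k w (WithLp.toLp 2 (T *ᵥ g.ofLp))) ^ 2 ∂stdGaussian (α × β)
      = ∫ g : EuclideanSpace ℂ (α × β), totalWeight e k w (WithLp.toLp 2 (T *ᵥ g.ofLp))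
          * totalWeight e k w (WithLp.toLp 2 (T *ᵥ g.ofLp)) ∂stdGaussian (α × β)
        - ∫ g : EuclideanSpace ℂ (α × β), (totalWeight e k w (WithLp.toLp 2 (T *ᵥ g.ofLp)) ^ 2
          - hsNorm (weightedMoment e k w (WithLp.toLp 2 (T *ᵥ g.ofLp))) ^ 2)
            ∂stdGaussian (α × β) := by
    rw [← integral_sub iT iD]
    refine integral_congr_ae (.of_forall fun g => ?_)
    simp only
    ring
  have dT := (hμ.integral_isSquareSum_of_le hσ (by omega) hT).2
  have dD := (hμ.integral_isSquareSum_of_le hσ (by omega) hD).1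
  have dv := (hμ.integral_isSquareSum_of_le hσ (by omega) hv).1
  have jT := integrable_of_ae_norm_le_one hμ1 hT.continuous
  have jD := integrable_of_ae_norm_le_one hμ1 hD.continuous
  have jv := integrable_of_ae_norm_le_one hμ1 hv.continuous
  have hexp : ∀ Ψ : EuclideanSpace ℂ (α × β), hsNorm (weightedMoment e k w Ψ - G) ^ 2
      = totalWeight e k w Ψ * totalWeight e k w Ψ
        - (totalWeight e k w Ψ ^ 2 - hsNorm (weightedMoment e k w Ψ) ^ 2)
        - 2 * (weightedMoment e k w Ψ * G).trace.re + hsNorm G ^ 2 := fun Ψ => by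
    rw [hsNorm_sub_sq (weightedMoment_isHermitian e k w Ψ) hGpos.1]
    ring
  simp_rw [hexp]
  have j1 : Integrable (fun Ψ => totalWeight e k w Ψ * totalWeight e k w Ψ
      - (totalWeight e k w Ψ ^ 2 - hsNorm (weightedMoment e k w Ψ) ^ 2)) μ := jT.sub jD
  have j2 : Integrable (fun Ψ => totalWeight e k w Ψ * totalWeight e k w Ψ
      - (totalWeight e k w Ψ ^ 2 - hsNorm (weightedMoment e k w Ψ) ^ 2)
      - 2 * (weightedMoment e k w Ψ * G).trace.re) μ := j1.sub (jv.const_mul 2)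
  rw [integral_add j2 (integrable_const _), integral_sub j1 (jv.const_mul 2),
    integral_sub jT jD, integral_const_mul]
  simp only [integral_const, probReal_univ, one_smul]
  rw [gv] at av
  rw [gsub] at gu gu0
  have bT := abs_le.1 aT
  have bD := abs_le.1 aD
  have bv := abs_le.1 av
  have hcTs : cT * hsNorm σ ≤ cT := mul_le_of_le_one_right hcT0 hs1
  have hcvs : cv * hsNorm σ ≤ cv := mul_le_of_le_one_right hcv0 hs1
  have x1 : ε * ∫ Ψ, totalWeight e k w Ψ * totalWeight e k w Ψ ∂scroogeEnsemble σ
      ≤ ε * ((k * 2).factorial + cT) := mul_le_mul_of_nonneg_left (by linarith [bT.2]) hε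
  have x2 : ε * ∫ Ψ, (totalWeight e k w Ψ ^ 2 - hsNorm (weightedMoment e k w Ψ) ^ 2)
      ∂scroogeEnsemble σ ≤ ε * ((k * 2).factorial + cT) :=
    mul_le_mul_of_nonneg_left (by linarith [bD.2]) hε
  have x3 : ε * ∫ Ψ, (weightedMoment e k w Ψ * G).trace.re ∂scroogeEnsemble σ
      ≤ ε * (k.factorial * k.factorial + cv) := mul_le_mul_of_nonneg_left (by linarith [bv.2]) hε
  have y1 : 0 ≤ cT * ε := by positivity
  have y2 : 0 ≤ cv * ε := by positivity
  have y3 : 0 ≤ cT * hsNorm σ := by positivity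
  have y4 : 0 ≤ cv * hsNorm σ := by positivity
  have y5 : 0 ≤ ((k * 2).factorial : ℝ) * hsNorm σ := by positivity
  have y6 : 0 ≤ (k.factorial * k.factorial : ℝ) * hsNorm σ := by positivity
  linarith [bT.1, bT.2, bD.1, bD.2, bv.1, bv.2]

end

/-! ### Concentration of the outcome probabilities -/

section
variable {α β : Type} [Fintype α] [Fintype β]
  (e : OrthonormalBasis β ℂ (EuclideanSpace ℂ β)) {σ : Matrix (α × β) (α × β) ℂ}

lemma isSquareSum_outcomeRatio_pow {q : ℝ} (hq : 0 ≤ q) (z : β) (m : ℕ) :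
    IsSquareSum m (fun Ψ : EuclideanSpace ℂ (α × β) => (q⁻¹ * ‖projVec (e z) Ψ‖ ^ 2) ^ m) := by
  have := ((isSquareSum_norm_projVec_sq (α := α) (e z)).const_mul (inv_nonneg.2 hq)).pow m
  rwa [one_mul] at this

lemma hsNorm_smul_sq {κ : Type*} [Fintype κ] (r : ℝ) (M : Matrix κ κ ℂ) :
    hsNorm ((r : ℂ) • M) ^ 2 = r ^ 2 * hsNorm M ^ 2 := by
  simp_rw [hsNorm_sq, Finset.mul_sum, Matrix.smul_apply, norm_smul, mul_pow, Complex.norm_real,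
    Real.norm_eq_abs, sq_abs]

variable [DecidableEq α] [DecidableEq β]

section
variable {T : Matrix (α × β) (α × β) ℂ} {lam : α × β → ℝ}

lemma IsGaussianFactor.expVal_reducedB_nonneg (h : IsGaussianFactor σ T lam) (z : β) :
    0 ≤ expVal (reducedB σ) (e z) := by
  rw [← h.cov]; exact _root_.expVal_reducedB_nonneg e T z

lemma IsGaussianFactor.sum_expVal_reducedB (h : IsGaussianFactor σ T lam) :
    ∑ z, expVal (reducedB σ) (e z) = 1 := by
  rw [← h.trace, ← _root_.sum_expVal_reducedB e T, h.cov]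

lemma IsGaussianFactor.isDensityMatrix_normCondState (h : IsGaussianFactor σ T lam) {z : β}
    (hz : expVal (reducedB σ) (e z) ≠ 0) : IsDensityMatrix (normCondState σ (e z)) := by
  have hpos : (condState σ (e z)).PosSemidef := by
    rw [← h.cov, ← condFactor_mul_conjTranspose]
    exact posSemidef_self_mul_conjTranspose _
  have hq := h.expVal_reducedB_nonneg e z
  refine ⟨hpos.smul (by rw [Complex.zero_le_real]; positivity), ?_⟩
  have htr : (condState σ (e z)).trace = (expVal (reducedB σ) (e z) : ℂ) := by
    apply Complex.ext
    · rw [trace_condState, Complex.ofReal_re]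
    · rw [Complex.ofReal_im]
      exact (Complex.le_def.1 hpos.trace_nonneg).2.symm
  rw [normCondState, Matrix.trace_smul, htr, smul_eq_mul, ← Complex.ofReal_mul,
    inv_mul_cancel₀ hz, Complex.ofReal_one]

/-- The probabilities of the outcomes are on average those of `σ_B`, exactly. -/
lemma IsGaussianFactor.integral_norm_projVec_sq (h : IsGaussianFactor σ T lam) (z : β) :
    ∫ Ψ, ‖projVec (e z) Ψ‖ ^ 2 ∂scroogeEnsemble σ = expVal (reducedB σ) (e z) := by
  have := h.integral_isSquareSum (n := 0) (isSquareSum_norm_projVec_sq (α := α) (e z))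
  rw [this]
  simp_rw [pow_zero, one_mul, norm_projVec_sq]
  rw [integral_imageNormSq, trace_condFactor, h.cov]

lemma IsGaussianFactor.integral_outcomeRatio_pow_le (h : IsGaussianFactor σ T lam) (z : β) {m : ℕ}
    (hm1 : 1 ≤ m) (hm : 4 * m * hsNorm σ ≤ 1 / 2) :
    ∫ Ψ, ((expVal (reducedB σ) (e z))⁻¹ * ‖projVec (e z) Ψ‖ ^ 2) ^ m ∂scroogeEnsemble σ
      ≤ (∫ g : EuclideanSpace ℂ (α × β), ((expVal (reducedB σ) (e z))⁻¹
          * ‖projVec (e z) (WithLp.toLp 2 (T *ᵥ g.ofLp))‖ ^ 2) ^ m ∂stdGaussian (α × β))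
        + m * Real.sqrt (Real.pi ^ (4 * m) + (m * 4).factorial) * hsNorm σ := by
  have hi := integrable_outcomeRatio_pow e T z (m * 4)
  have hb := _root_.integral_outcomeRatio_pow_le e T z (m * 4)
  simp_rw [h.cov, pow_mul] at hi hb
  have := (h.abs_integral_isSquareSum_sub_le hm1 hm
    (isSquareSum_outcomeRatio_pow e (h.expVal_reducedB_nonneg e z) z m) hi (fun g => le_rfl) hb).2
  linarith [(abs_le.1 this).2]

lemma IsGaussianFactor.integral_outcomeRatio_sq (h : IsGaussianFactor σ T lam) {z : β}
    (hz : expVal (reducedB σ) (e z) ≠ 0) :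
    ∫ g : EuclideanSpace ℂ (α × β), ((expVal (reducedB σ) (e z))⁻¹
      * ‖projVec (e z) (WithLp.toLp 2 (T *ᵥ g.ofLp))‖ ^ 2) ^ 2 ∂stdGaussian (α × β)
      = 1 + hsNorm (normCondState σ (e z)) ^ 2 := by
  simp_rw [norm_projVec_sq, mul_pow]
  rw [integral_const_mul, integral_imageNormSq_sq, trace_condFactor, condFactor_mul_conjTranspose,
    h.cov, normCondState, hsNorm_smul_sq, mul_add]
  congr 1
  rw [← mul_pow, inv_mul_cancel₀ hz, one_pow]

end

/-- Replacing the weights `p_z` of the projected ensemble by `⟨z|σ_B|z⟩ ^ (1 - k) p_z ^ k` costs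
little, since the ratio `p_z / ⟨z|σ_B|z⟩` has mean close to `1` and variance close to
`‖σ_{A|z}‖₂² / ⟨z|σ_B|z⟩²`. -/
theorem exists_integral_abs_sub_outcomeWeight_le (k : ℕ) (hk : 1 ≤ k) :
    ∃ C : ℝ, 0 ≤ C ∧ ∀ {α β : Type} [Fintype α] [Fintype β] [DecidableEq α] [DecidableEq β]
      (e : OrthonormalBasis β ℂ (EuclideanSpace ℂ β)) {σ : Matrix (α × β) (α × β) ℂ},
      IsDensityMatrix σ → 16 * k * hsNorm σ ≤ 1 → ∀ {ε : ℝ}, 0 ≤ ε → ε ≤ 1 →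
      ∀ {μ : Measure (EuclideanSpace ℂ (α × β))}, IsScroogeDesign σ (2 * k) ε μ → ∀ z,
      ∫ Ψ, |‖projVec (e z) Ψ‖ ^ 2 - outcomeWeight e k σ z * (‖projVec (e z) Ψ‖ ^ 2) ^ k| ∂μ
        ≤ ((k : ℝ) - 1) * (expVal (reducedB σ) (e z)
          * (C * (Real.sqrt (ε + hsNorm σ) + hsNorm (normCondState σ (e z))))) := by
  set c₁ : ℝ := (2 : ℕ) * Real.sqrt (Real.pi ^ (4 * 2) + (2 * 4).factorial) with hc₁
  set c₂ : ℝ := (2 * k : ℕ) * Real.sqrt (Real.pi ^ (4 * (2 * k)) + (2 * k * 4).factorial) with hc₂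
  have hc₁0 : 0 ≤ c₁ := by positivity
  have hc₂0 : 0 ≤ c₂ := by positivity
  set B : ℝ := 2 * ((2 * k).factorial + c₂) with hB
  refine ⟨Real.sqrt (4 + c₁) * Real.sqrt (2 + 2 * B), by positivity, ?_⟩
  intro α β _ _ _ _ e σ hσ hs ε hε hε1 μ hμ z
  have hμp : IsProbabilityMeasure μ := hμ.1.1
  have hμ1 : ∀ᵐ Ψ ∂μ, ‖Ψ‖ ≤ 1 := hμ.1.2.mono fun _ h => h.le
  obtain ⟨T, lam, h⟩ := exists_isGaussianFactor hσ
  have hs0 := hsNorm_nonneg σ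
  have hk1 : (1 : ℝ) ≤ k := by exact_mod_cast hk
  have hs1 : hsNorm σ ≤ 1 := by nlinarith
  set q := expVal (reducedB σ) (e z) with hq
  have hq0 : 0 ≤ q := h.expVal_reducedB_nonneg e z
  set h₂ := hsNorm (normCondState σ (e z)) with hh₂
  have hh0 : 0 ≤ h₂ := hsNorm_nonneg _
  rcases eq_or_ne q 0 with hz | hz
  · -- an outcome of probability zero also has probability zero for the design
    have hw : outcomeWeight e k σ z = 0 := by rw [outcomeWeight, ← hq, hz, zero_mul]
    have hd := (hμ.integral_isSquareSum_of_le hσ (by omega)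
      (isSquareSum_norm_projVec_sq (α := α) (e z))).2
    rw [h.integral_norm_projVec_sq, ← hq, hz, mul_zero] at hd
    rw [hw, hz]
    simp only [zero_mul, sub_zero, mul_zero, abs_of_nonneg (sq_nonneg ‖projVec (e z) _‖)]
    exact hd
  set r : EuclideanSpace ℂ (α × β) → ℝ := fun Ψ => q⁻¹ * ‖projVec (e z) Ψ‖ ^ 2 with hr
  have hrs : ∀ m, IsSquareSum m (fun Ψ => r Ψ ^ m) := isSquareSum_outcomeRatio_pow e hq0 z
  have hr1 : IsSquareSum 1 r := by simpa using hrs 1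
  have hri : ∀ m, Integrable (fun Ψ => r Ψ ^ m) μ := fun m =>
    integrable_of_ae_norm_le_one hμ1 (hrs m).continuous
  have hri1 : Integrable r μ := integrable_of_ae_norm_le_one hμ1 hr1.continuous
  have s1 : ∫ Ψ, r Ψ ∂scroogeEnsemble σ = 1 := by
    rw [integral_const_mul, h.integral_norm_projVec_sq, ← hq, inv_mul_cancel₀ hz]
  have s2 := h.integral_outcomeRatio_pow_le e z (m := 2) (by norm_num) (by push_cast; nlinarith)
  have s2' := integral_outcomeRatio_pow_le e T z 2
  have s3 := h.integral_outcomeRatio_pow_le e z (m := 2 * k) (by omega) (by push_cast; nlinarith)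
  have s3' := integral_outcomeRatio_pow_le e T z (2 * k)
  rw [← hc₁] at s2
  rw [← hc₂] at s3
  have s2'' := h.integral_outcomeRatio_sq e hz
  rw [h.cov] at s2' s3'
  simp only [← hq, ← hh₂] at s2 s2' s2'' s3 s3'
  have d1 := (hμ.integral_isSquareSum_of_le hσ (by omega) hr1).1
  have d2 := (hμ.integral_isSquareSum_of_le hσ (by omega) (hrs 2)).2
  have d3 := (hμ.integral_isSquareSum_of_le hσ le_rfl (hrs (2 * k))).2
  rw [s1] at d1
  have hcs1 : c₁ * hsNorm σ ≤ c₁ := mul_le_of_le_one_right hc₁0 hs1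
  have hcs2 : c₂ * hsNorm σ ≤ c₂ := mul_le_of_le_one_right hc₂0 hs1
  have e2 : ∀ Ψ, (1 - r Ψ) ^ 2 = 1 - 2 * r Ψ + r Ψ ^ 2 := fun Ψ => by ring
  have i1 : Integrable (fun Ψ => 1 - 2 * r Ψ) μ := (integrable_const _).sub (hri1.const_mul 2)
  have hV1 : Integrable (fun Ψ => (1 - r Ψ) ^ 2) μ := by
    simp_rw [e2]
    exact i1.add (hri 2)
  have hV : ∫ Ψ, (1 - r Ψ) ^ 2 ∂μ ≤ (4 + c₁) * (ε + hsNorm σ) + h₂ ^ 2 := by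
    simp_rw [e2]
    rw [integral_add i1 (hri 2), integral_sub (integrable_const _) (hri1.const_mul 2),
      integral_const_mul]
    simp only [integral_const, probReal_univ, one_smul]
    have x1 : ε * ∫ Ψ, r Ψ ^ 2 ∂scroogeEnsemble σ ≤ ε * (2 + c₁) := by
      refine mul_le_mul_of_nonneg_left ?_ hε
      have : ((2 : ℕ).factorial : ℝ) = 2 := by norm_num
      linarith
    have y1 : 0 ≤ c₁ * ε := by positivity
    linarith
  have hBd : ∫ Ψ, r Ψ ^ (2 * k) ∂μ ≤ B := by
    have hnn : 0 ≤ ∫ Ψ, r Ψ ^ (2 * k) ∂scroogeEnsemble σ :=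
      integral_nonneg fun Ψ => (hrs (2 * k)).nonneg Ψ
    have x1 : ε * ∫ Ψ, r Ψ ^ (2 * k) ∂scroogeEnsemble σ
        ≤ 1 * ∫ Ψ, r Ψ ^ (2 * k) ∂scroogeEnsemble σ := mul_le_mul_of_nonneg_right hε1 hnn
    linarith
  have hmain := (integral_abs_sub_pow_le (fun Ψ => hr1.nonneg Ψ)
    hr1.continuous.aestronglyMeasurable hk hV1 hV (hri (2 * k)) hBd).2
  have hqr : ∀ Ψ : EuclideanSpace ℂ (α × β), |‖projVec (e z) Ψ‖ ^ 2
      - outcomeWeight e k σ z * (‖projVec (e z) Ψ‖ ^ 2) ^ k| = q * |r Ψ - r Ψ ^ k| := fun Ψ => by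
    conv_rhs => rw [← abs_of_nonneg hq0, ← abs_mul]
    congr 1
    rw [outcomeWeight, hr, ← hq]
    simp only
    rw [mul_pow, mul_sub, mul_inv_cancel_left₀ hz, mul_assoc]
  simp_rw [hqr]
  rw [integral_const_mul, mul_left_comm]
  refine mul_le_mul_of_nonneg_left (hmain.trans ?_) hq0
  refine mul_le_mul_of_nonneg_left ?_ (by linarith)
  have hsq : Real.sqrt ((4 + c₁) * (ε + hsNorm σ) + h₂ ^ 2)
      ≤ Real.sqrt (4 + c₁) * (Real.sqrt (ε + hsNorm σ) + h₂) := by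
    have h4 : 1 ≤ Real.sqrt (4 + c₁) := Real.one_le_sqrt.2 (by linarith)
    have h5 : Real.sqrt ((4 + c₁) * (ε + hsNorm σ) + h₂ ^ 2)
        ≤ Real.sqrt ((4 + c₁) * (ε + hsNorm σ)) + h₂ := by
      refine Real.sqrt_le_iff.2 ⟨by positivity, ?_⟩
      rw [add_sq, Real.sq_sqrt (by positivity)]
      have : 0 ≤ 2 * Real.sqrt ((4 + c₁) * (ε + hsNorm σ)) * h₂ := by positivity
      linarith
    refine h5.trans ?_
    rw [Real.sqrt_mul (by positivity), mul_add]
    nlinarith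
  calc _ ≤ Real.sqrt (4 + c₁) * (Real.sqrt (ε + hsNorm σ) + h₂) * Real.sqrt (2 + 2 * B) := by
        gcongr
    _ = _ := by ring

end

/-! ### Splitting of the trace-norm distance -/

lemma norm_normalize_le {α : Type*} [Fintype α] (v : EuclideanSpace ℂ α) :
    ‖((‖v‖⁻¹ : ℝ) : ℂ) • v‖ ≤ 1 := by
  rw [norm_smul, Complex.norm_real, norm_inv, norm_norm]
  exact inv_mul_le_one

section
variable {α β : Type} [Fintype α] [Fintype β] [DecidableEq α]
  (e : OrthonormalBasis β ℂ (EuclideanSpace ℂ β)) {σ : Matrix (α × β) (α × β) ℂ}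

lemma scroogeMoment_isHermitian {α : Type*} [Fintype α] [DecidableEq α] (k : ℕ)
    (σ : Matrix α α ℂ) : (scroogeMoment k σ).IsHermitian := by
  ext c c'
  rw [conjTranspose_apply, scroogeMoment, ensembleMoment, of_apply, of_apply, Complex.star_def,
    ← integral_conj]
  refine integral_congr_ae (.of_forall fun ψ => ?_)
  exact (tensorPow_ketBra_isHermitian k ψ).apply c c'

lemma projectedMoment_sub_isHermitian (k : ℕ) (Ψ : EuclideanSpace ℂ (α × β)) :
    (projectedMoment k e Ψ - scroogeMixtureMoment k σ e).IsHermitian :=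
  (isHermitian_sum_smul _ fun _ => tensorPow_ketBra_isHermitian k _).sub
    (isHermitian_sum_smul _ fun _ => scroogeMoment_isHermitian k _)

lemma norm_trace_mul_sum_smul_le {κ : Type*} [Fintype κ] (W : Matrix κ κ ℂ) (w : β → ℝ)
    (M : β → Matrix κ κ ℂ) :
    ‖(W * ∑ z, (w z : ℂ) • M z).trace‖ ≤ ∑ z, |w z| * ‖(W * M z).trace‖ := by
  rw [Matrix.mul_sum, Matrix.trace_sum]
  refine norm_sum_le_of_le _ fun z _ => ?_
  rw [Matrix.mul_smul, Matrix.trace_smul, norm_smul, Complex.norm_real, Real.norm_eq_abs]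

lemma stronglyMeasurable_traceNorm_projectedMoment_sub (k : ℕ) :
    StronglyMeasurable fun Ψ : EuclideanSpace ℂ (α × β) =>
      traceNorm (projectedMoment k e Ψ - scroogeMixtureMoment k σ e) := by
  have hp : ∀ z, Measurable fun Ψ : EuclideanSpace ℂ (α × β) => projVec (e z) Ψ := fun z => by
    have : Continuous fun Ψ : EuclideanSpace ℂ (α × β) => projVec (e z) Ψ := by
      unfold projVec
      fun_prop
    exact this.measurable
  have ht : Continuous fun v : EuclideanSpace ℂ α => tensorPow k (ketBra v) :=
    continuous_matrix fun c c' => continuous_tensorPow_ketBra k c c'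
  refine continuous_traceNorm.comp_stronglyMeasurable
    (StronglyMeasurable.sub ?_ stronglyMeasurable_const)
  refine Finset.stronglyMeasurable_fun_sum _ fun z _ => ?_
  have h1 : Measurable fun Ψ : EuclideanSpace ℂ (α × β) =>
      ((‖projVec (e z) Ψ‖ ^ 2 : ℝ) : ℂ) := by
    have := hp z
    fun_prop
  have h2 : Measurable fun Ψ : EuclideanSpace ℂ (α × β) =>
      ((‖projVec (e z) Ψ‖⁻¹ : ℝ) : ℂ) • projVec (e z) Ψ := by
    have := hp z
    fun_prop
  exact h1.stronglyMeasurable.smul (ht.comp_stronglyMeasurable h2.stronglyMeasurable)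

variable [DecidableEq β]

/-- Both moments are density matrices, so their trace-norm distance is at most `2`. -/
lemma traceNorm_projectedMoment_sub_le_two (hσ : IsDensityMatrix σ) (k : ℕ)
    {Ψ : EuclideanSpace ℂ (α × β)} (hΨ : ‖Ψ‖ = 1) :
    traceNorm (projectedMoment k e Ψ - scroogeMixtureMoment k σ e) ≤ 2 := by
  obtain ⟨T, lam, h⟩ := exists_isGaussianFactor hσ
  obtain ⟨W, hW, hX⟩ := exists_unitary_traceNorm_eq
    (projectedMoment_sub_isHermitian (σ := σ) e k Ψ)
  rw [hX, Matrix.mul_sub, Matrix.trace_sub]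
  refine (Complex.re_le_norm _).trans ((norm_sub_le _ _).trans ?_)
  have h1 : ‖(W * projectedMoment k e Ψ).trace‖ ≤ 1 := by
    refine (norm_trace_mul_sum_smul_le W _ _).trans ?_
    have e1 : ∑ z, ‖projVec (e z) Ψ‖ ^ 2 = 1 := by rw [sum_norm_projVec_sq, hΨ, one_pow]
    rw [← e1]
    refine Finset.sum_le_sum fun z _ => ?_
    rw [abs_of_nonneg (sq_nonneg _)]
    exact mul_le_of_le_one_right (sq_nonneg _) (norm_tensorPow_pairing_le hW (norm_normalize_le _))
  have h2 : ‖(W * scroogeMixtureMoment k σ e).trace‖ ≤ 1 := by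
    refine (norm_trace_mul_sum_smul_le W _ _).trans ?_
    rw [← h.sum_expVal_reducedB e]
    refine Finset.sum_le_sum fun z _ => ?_
    have hq := h.expVal_reducedB_nonneg e z
    rw [abs_of_nonneg hq]
    rcases eq_or_ne (expVal (reducedB σ) (e z)) 0 with hz | hz
    · rw [hz, zero_mul]
    · exact mul_le_of_le_one_right hq
        (norm_trace_mul_scroogeMoment_le (h.isDensityMatrix_normCondState e hz) hW)
  linarith

/-- The splitting of the trace-norm distance into the error of the polynomial approximation, its
fluctuation, and the distance of the Gaussian from the Scrooge moments. -/
lemma traceNorm_projectedMoment_sub_le (hσ : IsDensityMatrix σ) {k : ℕ} (hk : 1 ≤ k)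
    (Ψ : EuclideanSpace ℂ (α × β)) :
    traceNorm (projectedMoment k e Ψ - scroogeMixtureMoment k σ e)
      ≤ ∑ z, |‖projVec (e z) Ψ‖ ^ 2 - outcomeWeight e k σ z * (‖projVec (e z) Ψ‖ ^ 2) ^ k|
        + Real.sqrt (Fintype.card α ^ k) * hsNorm (weightedMoment e k (outcomeWeight e k σ) Ψ
          - gaussianWeightedMoment e k (outcomeWeight e k σ) σ)
        + ∑ z, expVal (reducedB σ) (e z) * (((k : ℝ) - 1)
          * (hsNorm (normCondState σ (e z)) * Real.sqrt (2 + 2 * (2 * k).factorial))) := by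
  obtain ⟨T, lam, h⟩ := exists_isGaussianFactor hσ
  obtain ⟨W, hW, hX⟩ := exists_unitary_traceNorm_eq
    (projectedMoment_sub_isHermitian (σ := σ) e k Ψ)
  set R := weightedMoment e k (outcomeWeight e k σ) Ψ with hR
  set G := gaussianWeightedMoment e k (outcomeWeight e k σ) σ with hG
  have hsplit : W * (projectedMoment k e Ψ - scroogeMixtureMoment k σ e)
      = W * (projectedMoment k e Ψ - R) + W * (R - G) + W * (G - scroogeMixtureMoment k σ e) := by
    rw [← Matrix.mul_add, ← Matrix.mul_add]
    congr 1
    abel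
  rw [hX, hsplit, Matrix.trace_add, Matrix.trace_add]
  refine (Complex.re_le_norm _).trans ((norm_add₃_le).trans ?_)
  refine add_le_add (add_le_add ?_ ?_) ?_
  · have e1 : projectedMoment k e Ψ - R = ∑ z, ((‖projVec (e z) Ψ‖ ^ 2
        - outcomeWeight e k σ z * (‖projVec (e z) Ψ‖ ^ 2) ^ k : ℝ) : ℂ)
          • tensorPow k (ketBra (((‖projVec (e z) Ψ‖⁻¹ : ℝ) : ℂ) • projVec (e z) Ψ)) := by
      rw [projectedMoment, hR, weightedMoment, ← Finset.sum_sub_distrib]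
      refine Finset.sum_congr rfl fun z _ => ?_
      rw [tensorPow_ketBra_normalized hk (projVec (e z) Ψ), smul_smul, ← sub_smul,
        ← Complex.ofReal_mul, ← Complex.ofReal_sub]
    rw [e1]
    refine (norm_trace_mul_sum_smul_le W _ _).trans (Finset.sum_le_sum fun z _ => ?_)
    exact mul_le_of_le_one_right (abs_nonneg _)
      (norm_tensorPow_pairing_le hW (norm_normalize_le _))
  · refine (norm_trace_mul_le_of_unitary hW _).trans_eq ?_
    rw [Fintype.card_fun, Fintype.card_fin]
    push_cast
    rfl
  · have e1 : G - scroogeMixtureMoment k σ e = ∑ z, (expVal (reducedB σ) (e z) : ℂ)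
        • (gaussianMoment k (normCondState σ (e z)) - scroogeMoment k (normCondState σ (e z))) := by
      rw [hG, gaussianWeightedMoment, scroogeMixtureMoment, ← Finset.sum_sub_distrib]
      refine Finset.sum_congr rfl fun z _ => ?_
      rw [smul_sub]
      congr 1
      rw [normCondState, gaussianMoment_smul, smul_smul, outcomeWeight]
      push_cast
      rfl
    rw [e1]
    refine (norm_trace_mul_sum_smul_le W _ _).trans (Finset.sum_le_sum fun z _ => ?_)
    have hq := h.expVal_reducedB_nonneg e z
    rw [abs_of_nonneg hq]
    rcases eq_or_ne (expVal (reducedB σ) (e z)) 0 with hz | hz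
    · simp [hz]
    · exact mul_le_mul_of_nonneg_left (norm_trace_mul_gaussianMoment_sub_le
        (h.isDensityMatrix_normCondState e hz) hk hW) hq

end

/-! ### The bound for projected ensembles -/

theorem theorem2 (k : ℕ) (hk : 1 ≤ k) :
    ∃ C : ℝ, 0 < C ∧
      ∀ (dA dB : ℕ) (σ : Matrix (Fin dA × Fin dB) (Fin dA × Fin dB) ℂ),
        IsDensityMatrix σ →
      ∀ (ε : ℝ), 0 ≤ ε →
      ∀ (μ : Measure (EuclideanSpace ℂ (Fin dA × Fin dB))),
        IsScroogeDesign σ (2 * k) ε μ →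
      ∀ (e : OrthonormalBasis (Fin dB) ℂ (EuclideanSpace ℂ (Fin dB))),
        Integrable (fun Ψ => traceNorm (projectedMoment k e Ψ - scroogeMixtureMoment k σ e)) μ ∧
        ∫ Ψ, traceNorm (projectedMoment k e Ψ - scroogeMixtureMoment k σ e) ∂μ ≤
          C * (Real.sqrt ((dA : ℝ) ^ k * (ε + hsNorm σ)) +
            ((k : ℝ) - 1) *
              ∑ z, expVal (reducedB σ) (e z) * hsNorm (normCondState σ (e z))) := by
  obtain ⟨C₁, hC₁, hvar⟩ := exists_integral_hsNorm_weightedMoment_sub_sq_le k hk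
  obtain ⟨C₂, hC₂, hdiag⟩ := exists_integral_abs_sub_outcomeWeight_le k hk
  set F : ℝ := ((k + k).factorial : ℝ) with hF
  set C₃ : ℝ := Real.sqrt (2 + 2 * ((2 * k).factorial : ℕ)) with hC₃
  have hk1 : (1 : ℝ) ≤ k := by exact_mod_cast hk
  have hk0 : (0 : ℝ) ≤ (k : ℝ) - 1 := by linarith
  have hF0 : 0 ≤ F := by positivity
  have hC₃0 : 0 ≤ C₃ := by positivity
  have h16 : 0 < Real.sqrt (16 * k) := Real.sqrt_pos.2 (by positivity)
  -- The first summand serves the trivial regime. The threshold `16 k` makes `4 (2 k) ‖σ‖₂ ≤ 1 / 2`,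
  -- the condition for the inverse moments in a comparison of degree `2 k`.
  refine ⟨2 * Real.sqrt (16 * k) + Real.sqrt (C₁ + F) + ((k : ℝ) - 1) * C₂ + (C₂ + C₃),
    by positivity, ?_⟩
  intro dA dB σ hσ ε hε μ hμ e
  have hμp : IsProbabilityMeasure μ := hμ.1.1
  have hμ1 : ∀ᵐ Ψ ∂μ, ‖Ψ‖ ≤ 1 := hμ.1.2.mono fun _ h => h.le
  obtain ⟨T, lam, h⟩ := exists_isGaussianFactor hσ
  have htwo : ∀ᵐ Ψ ∂μ, traceNorm (projectedMoment k e Ψ - scroogeMixtureMoment k σ e) ≤ 2 :=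
    hμ.1.2.mono fun Ψ hΨ => traceNorm_projectedMoment_sub_le_two e hσ k hΨ
  have hX0 : ∀ Ψ, 0 ≤ traceNorm (projectedMoment k e Ψ - scroogeMixtureMoment k σ e) := fun Ψ =>
    (Complex.le_def.1 (Matrix.nonneg_iff_posSemidef.1 (CFC.sqrt_nonneg _)).trace_nonneg).1
  have hint : Integrable
      (fun Ψ => traceNorm (projectedMoment k e Ψ - scroogeMixtureMoment k σ e)) μ := by
    refine (integrable_const (2 : ℝ)).mono'
      (stronglyMeasurable_traceNorm_projectedMoment_sub e k).aestronglyMeasurable ?_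
    filter_upwards [htwo] with Ψ hΨ
    rwa [Real.norm_of_nonneg (hX0 Ψ)]
  refine ⟨hint, ?_⟩
  set s := hsNorm σ with hs
  have hs0 : 0 ≤ s := hsNorm_nonneg σ
  set q : Fin dB → ℝ := fun z => expVal (reducedB σ) (e z) with hq
  have hq0 : ∀ z, 0 ≤ q z := h.expVal_reducedB_nonneg e
  have hq1 : ∑ z, q z = 1 := h.sum_expVal_reducedB e
  set P : ℝ := ∑ z, q z * hsNorm (normCondState σ (e z)) with hP
  have hP0 : 0 ≤ P := Finset.sum_nonneg fun z _ => mul_nonneg (hq0 z) (hsNorm_nonneg _)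
  set Q : ℝ := Real.sqrt ((dA : ℝ) ^ k * (ε + s)) with hQ
  have hQ0 : 0 ≤ Q := Real.sqrt_nonneg _
  have hd : (1 : ℝ) ≤ (dA : ℝ) ^ k := by
    refine one_le_pow₀ ?_
    rcases Nat.eq_zero_or_pos dA with h0 | h0
    · subst h0
      have := hσ.2
      simp [Matrix.trace] at this
    · exact_mod_cast h0
  have hkP : 0 ≤ ((k : ℝ) - 1) * P := mul_nonneg hk0 hP0
  rcases le_total 1 (16 * k * ((dA : ℝ) ^ k * (ε + s))) with hbig | hsmall
  · -- a large error is absorbed by the trivial bound `2`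
    have h1 : ∫ Ψ, traceNorm (projectedMoment k e Ψ - scroogeMixtureMoment k σ e) ∂μ ≤ 2 := by
      refine (integral_mono_ae hint (integrable_const 2) htwo).trans_eq ?_
      simp
    have h2 : 1 ≤ Real.sqrt (16 * k) * Q := by
      rw [hQ, ← Real.sqrt_mul (by positivity)]
      exact Real.one_le_sqrt.2 hbig
    have h3 : 0 ≤ (Real.sqrt (C₁ + F) + ((k : ℝ) - 1) * C₂ + (C₂ + C₃)) * (Q + ((k : ℝ) - 1) * P) :=
      by positivity
    have h4 : 0 ≤ Real.sqrt (16 * k) * (((k : ℝ) - 1) * P) := by positivity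
    linarith
  have hes : ε + s ≤ (dA : ℝ) ^ k * (ε + s) := le_mul_of_one_le_left (by linarith) hd
  have hds0 : 0 ≤ (dA : ℝ) ^ k * (ε + s) := by positivity
  have hds1 : (dA : ℝ) ^ k * (ε + s) ≤ 1 := by nlinarith
  have hε1 : ε ≤ 1 := by linarith
  have hs16 : 16 * k * s ≤ 1 := by
    refine le_trans ?_ hsmall
    exact mul_le_mul_of_nonneg_left (by linarith) (by positivity)
  have hds : (dA : ℝ) ^ k * s ≤ 1 :=
    (mul_le_mul_of_nonneg_left (by linarith) (by linarith)).trans hds1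
  have hrootQ : Real.sqrt (ε + s) ≤ Q := Real.sqrt_le_sqrt hes
  set V : EuclideanSpace ℂ (Fin dA × Fin dB) → ℝ := fun Ψ =>
    hsNorm (weightedMoment e k (outcomeWeight e k σ) Ψ
      - gaussianWeightedMoment e k (outcomeWeight e k σ) σ) with hV
  have hVc : Continuous V := continuous_hsNorm.comp
    ((continuous_weightedMoment e k _).sub continuous_const)
  have hVi := integrable_of_ae_norm_le_one hμ1 hVc
  have hV2 : ∫ Ψ, V Ψ ^ 2 ∂μ ≤ C₁ * (ε + s) + F * (dA : ℝ) ^ k * s ^ 2 := by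
    have := hvar e hσ hs16 hε hμ
    rwa [Fintype.card_fin] at this
  have hV1 : ∫ Ψ, V Ψ ∂μ ≤ Real.sqrt (∫ Ψ, V Ψ ^ 2 ∂μ) := by
    have h1 := (integral_mul_le_sqrt_mul_sqrt (f := V) (g := fun _ => 1) (μ := μ)
      hVc.aestronglyMeasurable aestronglyMeasurable_const
      (integrable_of_ae_norm_le_one hμ1 (hVc.pow 2)) (integrable_const _)).2
    have h2 : ∀ Ψ, |V Ψ| = V Ψ := fun Ψ => abs_of_nonneg (hsNorm_nonneg _)
    simpa [h2] using h1
  have hVQ : Real.sqrt ((dA : ℝ) ^ k) * ∫ Ψ, V Ψ ∂μ ≤ Real.sqrt (C₁ + F) * Q := by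
    refine (mul_le_mul_of_nonneg_left (hV1.trans (Real.sqrt_le_sqrt hV2))
      (Real.sqrt_nonneg _)).trans ?_
    rw [hQ, ← Real.sqrt_mul (by positivity), ← Real.sqrt_mul (by positivity)]
    refine Real.sqrt_le_sqrt ?_
    -- `D_A ^ k * s ^ 2 ≤ s` since `D_A ^ k * s ≤ 1`
    have h1 : F * ((dA : ℝ) ^ k * s * s) ≤ F * (1 * s) := by gcongr
    have h2 : (dA : ℝ) ^ k * (F * (dA : ℝ) ^ k * s ^ 2) ≤ (dA : ℝ) ^ k * (F * (ε + s)) := by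
      refine mul_le_mul_of_nonneg_left ?_ (by linarith)
      have : 0 ≤ F * ε := by positivity
      linarith
    linarith
  have hDi : ∀ z, Integrable (fun Ψ : EuclideanSpace ℂ (Fin dA × Fin dB) =>
      |‖projVec (e z) Ψ‖ ^ 2 - outcomeWeight e k σ z * (‖projVec (e z) Ψ‖ ^ 2) ^ k|) μ :=
    fun z => by
    have hc := (isSquareSum_norm_projVec_sq (α := Fin dA) (e z)).continuous
    exact integrable_of_ae_norm_le_one hμ1 (by fun_prop)
  have hD : ∑ z, ∫ Ψ, |‖projVec (e z) Ψ‖ ^ 2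
      - outcomeWeight e k σ z * (‖projVec (e z) Ψ‖ ^ 2) ^ k| ∂μ
      ≤ ((k : ℝ) - 1) * C₂ * Q + C₂ * (((k : ℝ) - 1) * P) := by
    calc _ ≤ ∑ z, ((k : ℝ) - 1) * (q z
            * (C₂ * (Q + hsNorm (normCondState σ (e z))))) := by
          refine Finset.sum_le_sum fun z _ => (hdiag e hσ hs16 hε hε1 hμ z).trans ?_
          have := hq0 z
          gcongr
      _ = ((k : ℝ) - 1) * C₂ * Q * ∑ z, q z + C₂ * (((k : ℝ) - 1) * P) := by
          rw [hP, Finset.mul_sum, Finset.mul_sum, Finset.mul_sum, ← Finset.sum_add_distrib]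
          exact Finset.sum_congr rfl fun z _ => by ring
      _ = _ := by rw [hq1, mul_one]
  have hS : ∑ z, q z * (((k : ℝ) - 1) * (hsNorm (normCondState σ (e z)) * C₃))
      = C₃ * (((k : ℝ) - 1) * P) := by
    rw [hP, Finset.mul_sum, Finset.mul_sum]
    exact Finset.sum_congr rfl fun z _ => by ring
  have hsumi := integrable_finsetSum Finset.univ fun z _ => hDi z
  have hmain : ∫ Ψ, traceNorm (projectedMoment k e Ψ - scroogeMixtureMoment k σ e) ∂μ
      ≤ ∑ z, ∫ Ψ, |‖projVec (e z) Ψ‖ ^ 2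
          - outcomeWeight e k σ z * (‖projVec (e z) Ψ‖ ^ 2) ^ k| ∂μ
        + Real.sqrt ((dA : ℝ) ^ k) * ∫ Ψ, V Ψ ∂μ
        + ∑ z, q z * (((k : ℝ) - 1) * (hsNorm (normCondState σ (e z)) * C₃)) := by
    have hpt := fun Ψ => traceNorm_projectedMoment_sub_le e hσ hk Ψ
    simp only [Fintype.card_fin] at hpt
    have i2 := hVi.const_mul (Real.sqrt ((dA : ℝ) ^ k))
    have i3 : Integrable (fun Ψ => ∑ z, |‖projVec (e z) Ψ‖ ^ 2
        - outcomeWeight e k σ z * (‖projVec (e z) Ψ‖ ^ 2) ^ k|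
          + Real.sqrt ((dA : ℝ) ^ k) * V Ψ) μ := hsumi.add i2
    refine (integral_mono hint (i3.add (integrable_const _)) hpt).trans_eq ?_
    simp only [Pi.add_apply]
    rw [integral_add i3 (integrable_const _), integral_add hsumi i2, integral_const_mul,
      integral_finsetSum _ fun z _ => hDi z]
    simp only [integral_const, probReal_univ, one_smul]
    rfl
  rw [hS] at hmain
  have y1 : 0 ≤ Real.sqrt (16 * k) * Q := by positivity
  have y2 : 0 ≤ Real.sqrt (16 * k) * (((k : ℝ) - 1) * P) := by positivity
  have y3 : 0 ≤ Real.sqrt (C₁ + F) * (((k : ℝ) - 1) * P) := by positivity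
  have y4 : 0 ≤ ((k : ℝ) - 1) * C₂ * (((k : ℝ) - 1) * P) := by positivity
  have y5 : 0 ≤ C₂ * Q := by positivity
  have y6 : 0 ≤ C₃ * Q := by positivity
  linarith
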